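/- Let $n\ge 1$ and $N=2^n$. Label the computational basis of $\mathbb{C}^N$ by $\mathbb{Z}_2^n$ and put $Z^{\vec p}|\vec z\rangle=(-1)^{\vec p\cdot\vec z}|\vec z\rangle$, $X^{\vec q}|\vec z\rangle=|\vec z+\vec q\rangle$, $Z_i=Z^{\vec e_i}$, $X_i=X^{\vec e_i}$. The Pauli group $\mathcal P_n$ is the subgroup of $\mathcal U(N)$ generated by all $Z_i$, $X_i$ and $i\mathbb I$. A stabiliser subgroup is a subgroup of $\mathcal P_n$ that is maximal among the abelian subgroups not containing $-\mathbb I$; a stabiliser state is a unit vector in $\mathbb C^N$ fixed by all elements of some stabiliser subgroup; a Clifford gate is a $C\in\mathcal U(N)$ with $C\mathcal P_nC^*\subseteq\mathcal P_n$. The conjugate tuple (stabiliser tableau) of $C$ consists of the pairs $U_i=CZ_iC^*$, $V_i=CX_iC^*$ $(1\le i\le n)$, each given by the $2n+1$ bits $(\vec p,\vec q,c)$ of $(-1)^c(-i)^{\vec p\cdot\vec q}Z^{\vec p}X^{\vec q}$ with $\vec p\cdot\vec q\in\mathbb Z_2=\{0,1\}$. Cost model: the input is a vector in $\mathbb C^N$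 or a matrix in $\mathbb C^{N\times N}$ with random access to its entries. Reading an entry, an exact arithmetic operation or equality test on complex numbers, an operation on bits, an operation or comparison on integers of $O(n)$ bits, an array access and each iteration of a loop cost one step; an operation on a vector of $m$ bits costs $\Theta(m)$ steps. The extraction algorithm (Algorithm 4), with the entries of a matrix $C$ as input: (1) In the first column $C|\vec 0\rangle$, find the support, shift it by its first label $\vec z_0$ and sort it as binary integers; the labels at the positions $2^0,2^1,\dots$ (counting from $0$) are a basis of a subspace $V$. Read off from the amplitudes at the combinations of one or two basis vectors a linear form $\ell$ and a quadratic form $Q$ with $C|\vec 0\rangle\propto\sum_{\vec z\in V}(-1)^{Q(\vec z)}i^{\ell(\vec z)}|\vec z+\vec z_0\rangle$. Row reduce the basis and compute from it, $\vec z_0$, $Q$ and $\ell$ generators $P_1,\dots,P_n$ of the stabiliser group of $C|\vec 0\rangle$. (2) For each $j$ find a nonzero entry of $C|\vec e_j\rangle$, compare it with the same entry of $P_iC|\vec e_j\rangle$ for all $i$, and so obtain $\vec\rho_i\in\mathbb Z_2^n$ with $P_iC|\vec e_j\rangle=(-1)^{\vec\rho_i\cdot\vec e_j}C|\vec e_j\rangle$.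 (3) Let $\vec\mu_i$ be the rows of the inverse over $\mathbb{Z}_2$ of the matrix with rows $\vec\rho_i$, and put $U_i=P^{\vec\mu_i}=\prod_jP_j^{(\vec\mu_i)_j}$. (4) From a right inverse over $\mathbb{Z}_2$, found by row reduction, of the matrix whose rows are the pairs $(\vec q_i,\vec p_i)$ belonging to the $U_i$, obtain Pauli gates $W_i$ of order 2 such that $W_i$ anticommutes with $U_j$ exactly if $i=j$. (5) Determine $V_i=(-1)^{c_i}(-i)^{d_i}W_iU^{\vec v_i}$ with $c_i,d_i\in\mathbb Z_2$, $\vec v_i\in\mathbb Z_2^n$ from $C|\vec z+\vec e_i\rangle=(-1)^{\vec v_i\cdot\vec z+c_i}(-i)^{d_i}W_iC|\vec z\rangle$, by comparing one nonzero entry for $\vec z=\vec 0$ and for each $\vec z=\vec e_j$. Output the bits of all $(U_i,V_i)$. The state verification algorithm carries out the first half of (1) (up to $V$, $\vec z_0$, $Q$, $\ell$) on an arbitrary $\psi\in\mathbb C^N$ and accepts if the support has size $2^k$ for some integer $k$, the sorted shifted support is listed by the combinations of the candidate basis, all nonzero amplitudes agree with $Q$ and $\ell$, and $\psi$ has norm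 one. The Clifford verification algorithm applies the state verification to the first column of an arbitrary $M\in\mathbb C^{N\times N}$, carries out (1)-(5), and accepts if that column is accepted, $U_iM|\vec z\rangle=(-1)^{z_i}M|\vec z\rangle$ for all $i$ and $\vec z$, the $V_i$ are Hermitian and commute, and one nonzero entry of $M|\vec z+\vec e_i\rangle$ agrees with that of $V_iM|\vec z\rangle$ for every step $\vec z\to\vec z+\vec e_i$ of the Gray code. Then, with absolute implied constants: (a) for every $n\ge1$ and every Clifford gate $C\in\mathcal U(N)$, the extraction algorithm outputs the conjugate tuple of $C$ in $O(N\log N)$ steps; (b) for every $n\ge1$ and every $\psi\in\mathbb C^N$, the state verification algorithm accepts $\psi$ if and only if $\psi$ is a stabiliser state, in $O(N\log^2N)$ steps; (c) for every $n\ge1$ and every $M\in\mathbb C^{N\times N}$, the Clifford verification algorithm accepts $M$ if and only if $M$ is a Clifford gate, in $O(N^2\log^2N)$ steps. -/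

import Mathlib

noncomputable section

namespace Stab

/-! Mathematical objects: Pauli gates, stabiliser states, Clifford gates, tableaux. -/

/-- Elements of `ℤ₂ⁿ`, which label the computational basis of an `n`-qubit system. -/
abbrev Label (n : ℕ) := Fin n → ZMod 2

/-- Vectors of amplitudes, i.e. elements of `ℂ^N` with `N = 2 ^ n`. -/
abbrev Vec (n : ℕ) := Label n → ℂ

/-- Complex `N × N` matrices; `C w z` is the entry in row `w` of the column labelled `z`. -/
abbrev Mat (n : ℕ) := Matrix (Label n) (Label n) ℂ

/-- `Z^p`, the gate `|z⟩ ↦ (-1)^(p·z) |z⟩`. -/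
def zGate {n : ℕ} (p : Label n) : Mat n :=
  Matrix.diagonal fun z => (-1 : ℂ) ^ (p ⬝ᵥ z).val

/-- `X^q`, the gate `|z⟩ ↦ |z + q⟩`. -/
def xGate {n : ℕ} (q : Label n) : Mat n :=
  Matrix.of fun w z => if w = z + q then 1 else 0

/-- The `i`-th unit vector of `ℤ₂ⁿ`. -/
def unitVec {n : ℕ} (i : Fin n) : Label n := Pi.single i 1

/-- The Pauli group: the subgroup of the unitary group that is generated by the basic gates
`Z_i`, `X_i` and by `i` times the identity. -/
def pauliGroup (n : ℕ) : Subgroup (Matrix.unitaryGroup (Label n) ℂ) :=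
  Subgroup.closure {A | (∃ i, (A : Mat n) = zGate (unitVec i)) ∨
    (∃ i, (A : Mat n) = xGate (unitVec i)) ∨ (A : Mat n) = Complex.I • (1 : Mat n)}

/-- An abelian subgroup of the Pauli group that does not contain `-1`. -/
def IsAbelianWithoutNegOne {n : ℕ} (S : Subgroup (Matrix.unitaryGroup (Label n) ℂ)) : Prop :=
  S ≤ pauliGroup n ∧ (∀ A ∈ S, ∀ B ∈ S, A * B = B * A) ∧ ∀ A ∈ S, (A : Mat n) ≠ -1

/-- A stabiliser subgroup: a maximal abelian subgroup of the Pauli group not containing `-1`. -/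
def IsStabiliserSubgroup {n : ℕ} (S : Subgroup (Matrix.unitaryGroup (Label n) ℂ)) : Prop :=
  Maximal IsAbelianWithoutNegOne S

/-- A stabiliser state: a unit vector fixed by every element of some stabiliser subgroup. -/
def IsStabiliserState {n : ℕ} (ψ : Vec n) : Prop :=
  (∑ z, ‖ψ z‖ ^ 2 = 1) ∧
    ∃ S : Subgroup (Matrix.unitaryGroup (Label n) ℂ), IsStabiliserSubgroup S ∧
      ∀ P ∈ S, (P : Mat n).mulVec ψ = ψ

/-- A Clifford gate: a unitary matrix `C` such that `C P C*` is a Pauli gate for every Pauli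
gate `P`. -/
def IsClifford {n : ℕ} (C : Mat n) : Prop :=
  ∃ U : Matrix.unitaryGroup (Label n) ℂ, (U : Mat n) = C ∧
    ∀ P ∈ pauliGroup n, U * P * U⁻¹ ∈ pauliGroup n

/-- The `2n + 1` bits `(p, q, c)` that specify a Pauli gate of order at most two. -/
structure PauliBits (n : ℕ) where
  p : Label n
  q : Label n
  c : ZMod 2

/-- The gate `(-1)^c (-i)^(p·q) Z^p X^q`, where `p·q` is taken in `ℤ₂ = {0, 1}`. -/
def PauliBits.toMatrix {n : ℕ} (P : PauliBits n) : Mat n :=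
  ((-1 : ℂ) ^ P.c.val * (-Complex.I) ^ (P.p ⬝ᵥ P.q).val) • (zGate P.p * xGate P.q)

/-- A tableau: `n` pairs of bit strings, which specify pairs of Pauli gates `(U_i, V_i)`. -/
abbrev Tableau (n : ℕ) := Fin n → PauliBits n × PauliBits n

/-- `T` is the conjugate tuple of `C`: `U_i = C Z_i C*` and `V_i = C X_i C*`. -/
def IsConjugateTupleOf {n : ℕ} (T : Tableau n) (C : Mat n) : Prop :=
  ∀ i, (T i).1.toMatrix = C * zGate (unitVec i) * C.conjTranspose ∧
    (T i).2.toMatrix = C * xGate (unitVec i) * C.conjTranspose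

/-! The cost model.  A computation carries its result and the number of elementary steps.
An elementary step is: reading one amplitude of the input, one exact arithmetic operation or test
on complex numbers, one operation on bits, one operation or comparison on machine integers (such
as the labels, as integers below `N`), or one access to a stored array; each of these costs `1`
(`op`).  An operation on a vector of `m` bits is made of `m` operations on bits.  Every iteration
of a loop costs one more step than its body, and loops never stop early. -/

/-- A result together with the number of elementary steps spent on it. -/
structure Timed (α : Type) where
  val : α
  cost : ℕ

instance : Monad Timed where
  pure a := ⟨a, 0⟩
  bind x f := ⟨(f x.val).val, x.cost + (f x.val).cost⟩

/-- `c` elementary steps with result `a`. -/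
def ops {α : Type} (c : ℕ) (a : α) : Timed α := ⟨a, c⟩

/-- A single elementary step (up to a fixed bounded number of machine instructions). -/
def op {α : Type} (a : α) : Timed α := ops 1 a

/-- Fill an array of length `m`. -/
def table {α : Type} {m : ℕ} (f : Fin m → Timed α) : Timed (Fin m → α) :=
  ⟨fun i => (f i).val, ∑ i, ((f i).cost + 1)⟩

/-- Add up `m` bits. -/
def sumOver {m : ℕ} (f : Fin m → Timed (ZMod 2)) : Timed (ZMod 2) :=
  ⟨∑ i, (f i).val, ∑ i, ((f i).cost + 1)⟩

/-- Test whether all of `m` checks succeed. -/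
def allOver {m : ℕ} (f : Fin m → Timed Bool) : Timed Bool :=
  ⟨(List.finRange m).all fun i => (f i).val, ∑ i, ((f i).cost + 1)⟩

/-- The first index, if any, at which a check succeeds. -/
def findFirst {m : ℕ} (f : Fin m → Timed Bool) : Timed (Option (Fin m)) :=
  ⟨(List.finRange m).find? fun i => (f i).val, ∑ i, ((f i).cost + 1)⟩

/-- The increasing list of all indices at which a check succeeds. -/
def collect {m : ℕ} (f : Fin m → Timed Bool) : Timed (List (Fin m)) :=
  ⟨(List.finRange m).filter fun i => (f i).val, ∑ i, ((f i).cost + 1)⟩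

/-- Apply a computation to all entries of a list. -/
def mapList {α β : Type} (f : α → Timed β) (l : List α) : Timed (List β) :=
  ⟨l.map fun a => (f a).val, (l.map fun a => (f a).cost + 1).sum⟩

/-- Run `f 0`, `f 1`, …, `f (m - 1)` in this order on a state. -/
def loop {σ : Type} : (m : ℕ) → (Fin m → σ → Timed σ) → σ → Timed σ
  | 0, _, s => pure s
  | m + 1, f, s => do
    let s ← loop m (fun i => f i.castSucc) s
    let s ← f (Fin.last m) s
    op s

/-! Linear algebra over `ℤ₂`. -/

/-- The sum of two bit vectors. -/
def vadd {m : ℕ} (u v : Fin m → ZMod 2) : Timed (Fin m → ZMod 2) :=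
  table fun i => op (u i + v i)

/-- The scalar product of two bit vectors. -/
def dot {m : ℕ} (u v : Fin m → ZMod 2) : Timed (ZMod 2) :=
  sumOver fun i => op (u i * v i)

/-- The linear combination `∑ i, x i • A i` of the rows of `A`. -/
def linComb {k m : ℕ} (x : Fin k → ZMod 2) (A : Fin k → Fin m → ZMod 2) :
    Timed (Fin m → ZMod 2) :=
  table fun c => sumOver fun i => op (x i * A i c)

/-- The product of two matrices. -/
def matMul {k l m : ℕ} (A : Fin k → Fin l → ZMod 2) (B : Fin l → Fin m → ZMod 2) :
    Timed (Fin k → Fin m → ZMod 2) :=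
  table fun i => linComb (A i) B

/-- The state of row reduction of a matrix `A`: the current rows, the change of basis matrix
that expresses them through the rows of `A`, and the pivot column of every row treated so far. -/
structure RowReduction (k m : ℕ) where
  rows : Fin k → Fin m → ZMod 2
  change : Fin k → Fin k → ZMod 2
  pivot : Fin k → Option (Fin m)

/-- Add row `r` of `A` to all other rows that are marked. -/
def addRowTo {k m : ℕ} (r : Fin k) (marked : Fin k → Bool) (A : Fin k → Fin m → ZMod 2) :
    Timed (Fin k → Fin m → ZMod 2) :=
  table fun t => do
    let b ← op (decide (t ≠ r) && marked t)
    if b then vadd (A t) (A r) else pure (A t)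

/-- Gauss-Jordan elimination.  Row `r` is used to clear its first nonzero column in all other
rows; afterwards the pivot columns are unit vectors.  Rows are not permuted. -/
def rowReduce {k m : ℕ} (A : Fin k → Fin m → ZMod 2) : Timed (RowReduction k m) := do
  let one ← table fun i => table fun j => op (if i = j then (1 : ZMod 2) else 0)
  let noPivot ← table fun _ => op (none : Option (Fin m))
  loop k (fun r s => do
    let piv ← findFirst fun c => op (decide (s.rows r c = 1))
    match piv with
    | none => pure s
    | some c => do
      let marked ← table fun t => op (decide (s.rows t c = 1))
      let rows ← addRowTo r marked s.rows
      let change ← addRowTo r marked s.change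
      let pivot ← table fun t => op (if t = r then some c else s.pivot t)
      pure ⟨rows, change, pivot⟩) ⟨A, one, noPivot⟩

/-- For every column the row, if any, of which it is the pivot column. -/
def pivotRows {k m : ℕ} (R : RowReduction k m) : Timed (Fin m → Option (Fin k)) :=
  table fun c => findFirst fun i => op (decide (R.pivot i = some c))

/-- A right inverse of a matrix with linearly independent rows (the inverse, if the matrix is
square), obtained by row reduction. -/
def rightInverse {k m : ℕ} (A : Fin k → Fin m → ZMod 2) :
    Timed (Fin m → Fin k → ZMod 2) := do
  let R ← rowReduce A
  let inv ← pivotRows R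
  table fun c => table fun j =>
    match inv c with
    | some i => op (R.change i j)
    | none => op 0

/-! From the amplitudes of a stabiliser state to an affine subspace triple. -/

/-- The label whose binary digits are those of `t`. -/
def label {n : ℕ} (t : ℕ) : Label n := fun i => if t.testBit i then 1 else 0

/-- The integer whose binary digits are the entries of `z`. -/
def index {n : ℕ} (z : Label n) : ℕ := ∑ i, (z i).val * 2 ^ (i : ℕ)

/-- Merge two sorted lists of labels. -/
def merge {n : ℕ} : List (Label n) → List (Label n) → Timed (List (Label n))
  | [], bs => pure bs
  | a :: as, [] => pure (a :: as)
  | a :: as, b :: bs => do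
    let le ← op (decide (index a ≤ index b))
    if le then do
      let l ← merge as (b :: bs)
      op (a :: l)
    else do
      let l ← merge (a :: as) bs
      op (b :: l)
termination_by as bs => as.length + bs.length

/-- Merge sort of at most `2 ^ d` labels, by the integers that they represent. -/
def mergeSort {n : ℕ} : ℕ → List (Label n) → Timed (List (Label n))
  | 0, l => pure l
  | d + 1, l => do
    let short ← op (decide (l.length ≤ 1))
    if short then pure l
    else do
      let halves ← ops l.length (l.splitAt (l.length / 2))
      let a ← mergeSort d halves.1
      let b ← mergeSort d halves.2
      merge a b

/-- The first label `z₀` of the support, and the sorted support shifted by `z₀`. -/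
structure ShiftedSupport (n : ℕ) where
  shift : Label n
  elements : List (Label n)

/-- Find the support of `ψ`, shift it by its first label, and sort. -/
def findSupport {n : ℕ} (ψ : Vec n) : Timed (ShiftedSupport n) := do
  let indices ← collect fun t : Fin (2 ^ n) => do
    let a ← op (ψ (label t))
    op (decide (a ≠ 0))
  let supp ← mapList (fun t => op (label t)) indices
  let z₀ ← op (supp.headD 0)
  let shifted ← mapList (fun z => vadd z z₀) supp
  let sorted ← mergeSort n shifted
  pure ⟨z₀, sorted⟩

/-- An affine subspace triple, in coordinates: a basis of a subspace `V` of dimension `k`, a shift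
vector, the coefficients `c_ij` (`i ≤ j`) of a quadratic form on `V`, and a linear form on `V`. -/
structure AffineTriple (n : ℕ) where
  k : ℕ
  basis : Fin k → Label n
  shift : Label n
  quad : Fin k → Fin k → ZMod 2
  ell : Fin k → ZMod 2

/-- Read off the affine subspace triple from the sorted shifted support and the amplitudes. The
basis consists of the elements whose position is a power of two; the linear form tells which
amplitudes at the basis vectors are imaginary relative to the first nonzero amplitude, and the
quadratic form is determined by the amplitudes at combinations of one or two basis vectors. -/
def readTriple {n : ℕ} (ψ : Vec n) (S : ShiftedSupport n) : Timed (AffineTriple n) := do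
  let k ← ops (n + 1) (Nat.log 2 S.elements.length)
  let basis ← table fun i : Fin k => op (S.elements.getD (2 ^ (i : ℕ)) 0)
  let a₀ ← op (ψ S.shift)
  let ratios ← table fun i => do
    let z ← vadd (basis i) S.shift
    let a ← op (ψ z)
    op (a / a₀)
  let ell ← table fun i =>
    op (if ratios i = Complex.I ∨ ratios i = -Complex.I then (1 : ZMod 2) else 0)
  let diag ← table fun i =>
    op (if ratios i = Complex.I ^ (ell i).val then (0 : ZMod 2) else 1)
  let quad ← table fun i => table fun j =>
    if i = j then op (diag i)
    else if j < i then op 0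
    else do
      let z ← vadd (basis i) (basis j)
      let z ← vadd z S.shift
      let a ← op (ψ z)
      let r ← op (a / a₀)
      let l ← op (ell i + ell j)
      let b ← op (if r = Complex.I ^ l.val then (0 : ZMod 2) else 1)
      op (b + diag i + diag j)
  pure ⟨k, basis, S.shift, quad, ell⟩

/-- Convert the amplitudes of a stabiliser state to an affine subspace triple. -/
def stateToTriple {n : ℕ} (ψ : Vec n) : Timed (AffineTriple n) := do
  let S ← findSupport ψ
  readTriple ψ S

/-! From an affine subspace triple to a check matrix. -/

/-- Convert an affine subspace triple to a check matrix, i.e. to `n` generators of the stabiliser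
group.  After row reduction every column `c` is either the pivot column of some row `i` or free;
row `c` of the check matrix is `(p_i, q_i, c_i)` in the first case, and it is `(ρ, 0, γ)`
in the second case, where the vectors `ρ` form a basis of the orthogonal complement of `V`. -/
def tripleToCheckMatrix {n : ℕ} (T : AffineTriple n) : Timed (Fin n → PauliBits n) := do
  let R ← rowReduce T.basis
  let inv ← pivotRows R
  -- the linear and the quadratic form in the new basis
  let ell ← table fun i => dot (R.change i) T.ell
  let transposed ← table fun i => table fun j => op (R.change j i)
  let half ← matMul R.change T.quad
  let full ← matMul half transposed
  let upper ← table fun i => table fun j =>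
    if i = j then op (full i i) else if i < j then op (full i j + full j i) else op 0
  table fun c =>
    match inv c with
    | some i => do
      -- solve `p · q_j = Q_ij + ℓ(q_i) ℓ(q_j)` in the pivot coordinates
      let p ← table fun d =>
        match inv d with
        | some j =>
          if i = j then op (ell i)
          else op ((if i < j then upper i j else upper j i) + ell i * ell j)
        | none => op 0
      let pq ← dot p (R.rows i)
      let shifted ← vadd (R.rows i) T.shift
      let e ← dot p shifted
      -- `pq` accounts for the order of `Z^p` and `X^q`
      let sign ← op (pq + e + upper i i)
      pure ⟨p, R.rows i, sign⟩
    | none => do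
      let ρ ← table fun d =>
        match inv d with
        | some j => op (R.rows j c)
        | none => op (if d = c then 1 else 0)
      let γ ← dot ρ T.shift
      let zero ← table fun _ => op 0
      pure ⟨ρ, zero, γ⟩

/-! Verification of stabiliser states. -/

/-- Decide whether a vector is a stabiliser state: the support must have `2 ^ k` elements, the
sorted shifted support must be enumerated by the combinations of the candidate basis,
all nonzero amplitudes must agree with the candidate forms, and the vector must have norm one. -/
def verifyStabiliserState {n : ℕ} (ψ : Vec n) : Timed Bool := do
  let S ← findSupport ψ
  let T ← readTriple ψ S
  let a₀ ← op (ψ S.shift)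
  let size ← ops (T.k + 1) (decide (S.elements.length = 2 ^ T.k))
  let affine ← allOver fun t : Fin (2 ^ T.k) => do
    let x ← ops T.k (label t : Label T.k)
    let v ← linComb x T.basis
    ops (n + 1) (decide (S.elements.getD t 0 = v))
  let coefficients ← allOver fun t : Fin (2 ^ T.k) => do
    let x ← ops T.k (label t : Label T.k)
    let v ← linComb x T.basis
    let z ← vadd v S.shift
    let l ← dot x T.ell
    let Qx ← table fun i => dot (T.quad i) x
    let b ← dot x Qx
    let a ← op (ψ z)
    let e ← op (Complex.I ^ l.val * a₀)
    let e ← op ((-1) ^ b.val * e)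
    op (decide (a = e))
  let normalised ← ops (T.k + 3) (decide ((2 : ℂ) ^ T.k * (a₀ * star a₀) = 1))
  op (size && affine && coefficients && normalised)

/-! Arithmetic of Pauli gates. -/

/-- The Pauli gate `i^r Z^p X^q`. -/
structure Pauli (n : ℕ) where
  p : Label n
  q : Label n
  r : ZMod 4

/-- Write `(-1)^c (-i)^(p·q) Z^p X^q` as `i^r Z^p X^q`. -/
def fromBits {n : ℕ} (P : PauliBits n) : Timed (Pauli n) := do
  let d ← dot P.p P.q
  let r ← op (2 * (P.c.val : ZMod 4) + 3 * (d.val : ZMod 4))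
  pure ⟨P.p, P.q, r⟩

/-- Write a Pauli gate of order at most two as `(-1)^c (-i)^(p·q) Z^p X^q`. -/
def toBits {n : ℕ} (P : Pauli n) : Timed (PauliBits n) := do
  let d ← dot P.p P.q
  let c ← op (if P.r = 3 * (d.val : ZMod 4) then (0 : ZMod 2) else 1)
  pure ⟨P.p, P.q, c⟩

/-- The product of two Pauli gates. -/
def pauliMul {n : ℕ} (A B : Pauli n) : Timed (Pauli n) := do
  let p ← vadd A.p B.p
  let q ← vadd A.q B.q
  let d ← dot A.q B.p
  let r ← op (A.r + B.r + 2 * (d.val : ZMod 4))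
  pure ⟨p, q, r⟩

/-- `P_0^(x_0) ⋯ P_(n-1)^(x_(n-1)) `, multiplied from the left by `A`. -/
def pauliMulPower {n : ℕ} (A : Pauli n) (P : Fin n → Pauli n) (x : Fin n → ZMod 2) :
    Timed (Pauli n) :=
  loop n (fun j B => do
    let b ← op (decide (x j = 1))
    if b then pauliMul B (P j) else pure B) A

/-- Rapid Pauli-vector multiplication: the entry of `P ψ` at `w`. -/
def pauliApply {n : ℕ} (P : Pauli n) (ψ : Vec n) (w : Label n) : Timed ℂ := do
  let d ← dot P.p w
  let w' ← vadd w P.q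
  let a ← op (ψ w')
  let a ← op ((-1) ^ d.val * a)
  op (Complex.I ^ P.r.val * a)

/-! From a Clifford gate to its conjugate tuple. -/

/-- The column of `C` labelled by `z`. -/
def column {n : ℕ} (C : Mat n) (z : Label n) : Vec n := fun w => C w z

/-- Write down the unit vector `e_i`. -/
def makeUnitVec {n : ℕ} (i : Fin n) : Timed (Label n) :=
  table fun j => op (if j = i then 1 else 0)

/-- The gates `U_i`, and the gates `V_i` still with an arbitrary power of `i` in front. -/
structure RawTableau (n : ℕ) where
  U : Fin n → Pauli n
  V : Fin n → Pauli n

/-- The extraction of the `U_i = C Z_i C*` and `V_i = C X_i C*` from the entries of a Clifford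
gate `C`. -/
def extractTuple {n : ℕ} (C : Mat n) : Timed (RawTableau n) := do
  let zero ← table fun _ => op (0 : ZMod 2)
  -- generators `P_i` of the stabiliser group of the first column
  let T ← stateToTriple (column C zero)
  let bits ← tripleToCheckMatrix T
  let P ← table fun i => fromBits (bits i)
  -- a nonzero entry in every column of weight one, and the signs `(-1)^(ρ_i j)`
  -- with which the `P_i` act on the columns
  let positions ← table fun j => do
    let e ← makeUnitVec j
    let t ← findFirst fun t : Fin (2 ^ n) => do
      let a ← op (C (label t) e)
      op (decide (a ≠ 0))
    op (label (match t with | some t => (t : ℕ) | none => 0) : Label n)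
  let ρ ← table fun i => table fun j => do
    let e ← makeUnitVec j
    let b ← pauliApply (P i) (column C e) (positions j)
    let a ← op (C (positions j) e)
    op (if b = a then (0 : ZMod 2) else 1)
  -- the inverse of the matrix with rows `ρ_i` gives `U_i = P^(μ_i)`
  let μ ← rightInverse ρ
  let one ← table fun _ => op (0 : ZMod 2)
  let U ← table fun i => pauliMulPower ⟨one, one, 0⟩ P (μ i)
  -- Pauli gates `W_i` of order two that anticommute with `U_i` and commute with the other `U_j`
  let rows ← table fun i => table fun c : Fin (n + n) => op (Fin.append (U i).q (U i).p c)
  let inv ← rightInverse rows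
  let W ← table fun i => do
    let α ← table fun c => op (inv (Fin.castAdd n c) i)
    let β ← table fun c => op (inv (Fin.natAdd n c) i)
    fromBits ⟨α, β, 0⟩
  -- correct the `W_i` by comparing single nonzero entries of columns
  let V ← table fun i => do
    let e ← makeUnitVec i
    let w ← vadd T.shift (W i).q
    let b ← pauliApply (W i) (column C zero) w
    let a ← op (C w e)
    let t ← op (a / b)
    let d ← op (if t = Complex.I ∨ t = -Complex.I then (1 : ZMod 2) else 0)
    let c ← op (if t = (-Complex.I) ^ d.val then (0 : ZMod 2) else 1)
    let v ← table fun j => do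
      let f ← makeUnitVec j
      let ef ← vadd e f
      let w' ← vadd w (W j).q
      let b ← pauliApply (W i) (column C f) w'
      let a ← op (C w' ef)
      let tb ← op (t * b)
      op (if a = tb then (0 : ZMod 2) else 1)
    let r ← op ((W i).r + 2 * (c.val : ZMod 4) + 3 * (d.val : ZMod 4))
    pauliMulPower ⟨(W i).p, (W i).q, r⟩ U v
  pure ⟨U, V⟩

/-- Extract the conjugate tuple of a Clifford gate from its matrix entries. -/
def cliffordToTableau {n : ℕ} (C : Mat n) : Timed (Tableau n) := do
  let X ← extractTuple C
  table fun i => do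
    let u ← toBits (X.U i)
    let v ← toBits (X.V i)
    op (u, v)

/-! Verification of Clifford gates. -/

/-- Whether `P` is of order at most two. -/
def pauliIsHermitian {n : ℕ} (P : Pauli n) : Timed Bool := do
  let d ← dot P.p P.q
  op (decide (P.r = 3 * (d.val : ZMod 4) ∨ P.r = 3 * (d.val : ZMod 4) + 2))

/-- Whether two Pauli gates commute. -/
def pauliCommute {n : ℕ} (A B : Pauli n) : Timed Bool := do
  let x ← dot A.p B.q
  let y ← dot A.q B.p
  op (decide (x = y))

/-- Whether `U_i` stabilises the columns of `M` with `z i = 0` and antistabilises those with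
`z i = 1`, for all `i`. -/
def checkColumns {n : ℕ} (U : Fin n → Pauli n) (M : Mat n) : Timed Bool :=
  allOver fun s : Fin (2 ^ n) => do
    let z ← op (label s : Label n)
    allOver fun i : Fin n => allOver fun t : Fin (2 ^ n) => do
      let w ← op (label t : Label n)
      let b ← pauliApply (U i) (column M z) w
      let a ← op (M w z)
      let a ← op ((-1) ^ (z i).val * a)
      op (decide (b = a))

/-- The state of the walk along the Gray code: the current column, a nonzero position in it, and
whether all checks have succeeded so far. -/
structure GrayState (n : ℕ) where
  z : Label n
  w : Label n
  ok : Bool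

/-- Walk through all columns of `M` along the Gray code, starting from the column `0` with a
nonzero entry at `z₀`; step `t` changes the bit whose position is that of the last
binary digit `1` of `t + 1`.  Compare one nonzero entry of `M |z + e_i⟩` and `V_i M |z⟩`. -/
def checkGray {n : ℕ} (V : Fin n → Pauli n) (M : Mat n) (z₀ : Label n) : Timed Bool := do
  let zero ← table fun _ => op (0 : ZMod 2)
  let a₀ ← op (M z₀ zero)
  let start ← op (decide (a₀ ≠ 0))
  let s ← loop (2 ^ n - 1) (fun t (s : GrayState n) => do
    let bit ← findFirst fun i : Fin n => op (Nat.testBit ((t : ℕ) + 1) i)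
    match bit with
    | none => pure s
    | some i => do
      let e ← makeUnitVec i
      let z ← vadd s.z e
      let w ← vadd s.w (V i).q
      let b ← pauliApply (V i) (column M s.z) w
      let a ← op (M w z)
      let ok ← op (s.ok && decide (b = a))
      pure ⟨z, w, ok⟩) ⟨zero, z₀, start⟩
  pure s.ok

/-- Decide whether a matrix is a Clifford gate. -/
def verifyClifford {n : ℕ} (M : Mat n) : Timed Bool := do
  let zero ← table fun _ => op (0 : ZMod 2)
  let first ← verifyStabiliserState (column M zero)
  let S ← findSupport (column M zero)
  let X ← extractTuple M
  let columns ← checkColumns X.U M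
  let hermitian ← allOver fun i => pauliIsHermitian (X.V i)
  let commuting ← allOver fun i => allOver fun j => pauliCommute (X.V i) (X.V j)
  let phases ← checkGray X.V M S.shift
  op (first && columns && hermitian && commuting && phases)

end Stab

end

namespace Stab

/-! Results of timed computations. -/

/-! Pauli gates are handled as triples `(p, q, r)` that stand for `i^r Z^p X^q`. They act on vectors
by a translation and signs (`Pauli.app`), any two commute up to the sign `Pauli.omega`, and all of
them are isometries.

States. Let ψ be fixed by a stabiliser group `S`. The shifts `q` of its elements form a subspace
`V`, and by maximality the support of ψ is a full coset of `V`
(`IsStabiliserSubgroup.exists_shift`). A gate of `S` that shifts by a basis vector shows that the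
amplitude ratios `f` obey `f(x + e_i) = f(x) f(e_i) (-1)^(β_i·x)`. Such a function is determined by
its values at labels of weight one and two (`IsQuadratic.ext`), which are the values from which the
forms are read off, so the candidate forms agree with all amplitudes (`ratio_eq_phase`). The
candidate basis is right because a subspace sorted by integer value is listed by the combinations of
its elements at the positions `2^i` (`exists_increasing_basis`). Conversely, a vector with such a
description is determined up to a factor by the Pauli gates that fix it (`Represents.fixed`), and
this forces the group of these gates to be maximal (`isStabiliserState_of_fixed`). Together this is
`verifyStabiliserState_iff`.

Clifford gates. By `isClifford_iff`, `C` is a Clifford gate exactly if it is unitary and there are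
Pauli gates with `U_i C|z⟩ = (-1)^(z_i) C|z⟩` and `V_i C|z⟩ = C|z + e_i⟩`. Gates with the first
property have the columns as joint eigenvectors, with one-dimensional eigenspaces
(`eq_smul_column`). The generators `P_i` that fix the first column act on column `z` by signs
`(-1)^(ρ_i·z)`; they are independent, so `ρ` is invertible and products of the `P_i` give the `U_i`
(`IsTableau.extractU_app`). A gate `W_i` that anticommutes with `U_i` alone permutes the eigenspaces
like `X_i`, so it agrees with `V_i` up to `s (-1)^(v·z)`, and this is known once it is known at `z =
0` and `z = e_j` (`IsTableau.antiGates_app`, `IsTableau.extractV_app`).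

For the verification on an arbitrary matrix, the checked `U_i` and the nonzero columns found on the
Gray walk make each `V_i` map column `z` to a multiple of column `z + e_i`. The comparisons make the
multiple one along the walk. Since the `V_i` are commuting involutions, this determines every column
as a product of the `V_i` applied to the first one, so the relation holds for all steps
(`app_column_of_gray`). Orthogonality of the eigenspaces and the norm of the first column then give
unitarity.

Costs. Control flow depends on the input only through the length of the support list, at most `2^n`,
and the dimension `k ≤ n`, apart from branches that are bounded separately. Linear algebra costs
`O(n^3)`, which `cube_le_two_pow` absorbs into `2^n n`; the scans of columns supply the exponential
factors. -/

@[simp] lemma bind_val {α β : Type} (x : Timed α) (f : α → Timed β) :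
    (x >>= f).val = (f x.val).val := rfl

@[simp] lemma pure_val {α : Type} (a : α) : (pure a : Timed α).val = a := rfl

@[simp] lemma op_val {α : Type} (a : α) : (op a).val = a := rfl

@[simp] lemma ops_val {α : Type} (c : ℕ) (a : α) : (ops c a).val = a := rfl

@[simp] lemma table_val {α : Type} {m : ℕ} (f : Fin m → Timed α) :
    (table f).val = fun i => (f i).val := rfl

lemma allOver_val {m : ℕ} (f : Fin m → Timed Bool) :
    (allOver f).val = true ↔ ∀ i, (f i).val = true := by
  simp [allOver]

lemma findFirst_some {m : ℕ} {f : Fin m → Timed Bool} {i : Fin m}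
    (h : (findFirst f).val = some i) : (f i).val = true :=
  List.find?_some (p := fun i => (f i).val) h

lemma findFirst_isSome {m : ℕ} {f : Fin m → Timed Bool} {i : Fin m} (h : (f i).val = true) :
    ∃ j, (findFirst f).val = some j ∧ (f j).val = true := by
  cases hf : (findFirst f).val with
  | none =>
    have := List.find?_eq_none.1 hf i (List.mem_finRange i)
    exact absurd h this
  | some j => exact ⟨j, rfl, findFirst_some hf⟩

/-- An invariant of a loop. -/
lemma loop_invariant {σ : Type} (I : ℕ → σ → Prop) :
    ∀ (m : ℕ) (f : Fin m → σ → Timed σ) (s : σ), I 0 s →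
      (∀ (t : Fin m) (s : σ), I t s → I (t + 1) (f t s).val) → I m (loop m f s).val
  | 0, _, _, h0, _ => h0
  | m + 1, f, s, h0, hs =>
    hs (Fin.last m) _ (loop_invariant I m (fun i => f i.castSucc) s h0 fun t s => hs t.castSucc s)

/-! Signs and powers of `i`. -/

/-- The sign `(-1)^a`. -/
noncomputable def sgn (a : ZMod 2) : ℂ := (-1) ^ a.val

/-- The power `i^r`. -/
noncomputable def ipow (r : ZMod 4) : ℂ := Complex.I ^ r.val

@[simp] lemma sgn_zero : sgn 0 = 1 := by simp [sgn]

@[simp] lemma sgn_one : sgn 1 = -1 := by simp [sgn, ZMod.val_one]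

lemma bit_cases (a : ZMod 2) : a = 0 ∨ a = 1 := by
  revert a; decide

lemma bit_add_self (a : ZMod 2) : a + a = 0 := CharTwo.add_self_eq_zero a

lemma sgn_add (a b : ZMod 2) : sgn (a + b) = sgn a * sgn b := by
  rcases bit_cases a with rfl | rfl <;> rcases bit_cases b with rfl | rfl <;> simp [bit_add_self]

@[simp] lemma sgn_mul_self (a : ZMod 2) : sgn a * sgn a = 1 := by
  rw [← sgn_add, bit_add_self, sgn_zero]

lemma sgn_ne_zero (a : ZMod 2) : sgn a ≠ 0 := by
  rcases bit_cases a with rfl | rfl <;> simp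

lemma sgn_injective : Function.Injective sgn := by
  intro a b h
  rcases bit_cases a with rfl | rfl <;> rcases bit_cases b with rfl | rfl <;>
    first | rfl | (exfalso; norm_num at h)

@[simp] lemma star_sgn (a : ZMod 2) : star (sgn a) = sgn a := by
  rcases bit_cases a with rfl | rfl <;> simp

lemma ipow_add (r s : ZMod 4) : ipow (r + s) = ipow r * ipow s := by
  unfold ipow
  rw [← pow_add, ZMod.val_add, ← Complex.I_pow_eq_pow_mod]

@[simp] lemma ipow_zero : ipow 0 = 1 := by simp [ipow]

@[simp] lemma ipow_one : ipow 1 = Complex.I := by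
  have : (1 : ZMod 4).val = 1 := rfl
  simp [ipow, this]

@[simp] lemma ipow_two : ipow 2 = -1 := by
  have : (2 : ZMod 4).val = 2 := rfl
  simp [ipow, this]

@[simp] lemma ipow_three : ipow 3 = -Complex.I := by
  have : (3 : ZMod 4).val = 3 := rfl
  simp [ipow, this]

lemma ipow_ne_zero (r : ZMod 4) : ipow r ≠ 0 := by simp [ipow]

lemma ipow_injective : Function.Injective ipow := by
  have h : ∀ r : ZMod 4, r = 0 ∨ r = 1 ∨ r = 2 ∨ r = 3 := by decide
  intro a b hab
  rcases h a with rfl | rfl | rfl | rfl <;> rcases h b with rfl | rfl | rfl | rfl <;>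
    first | rfl | (exfalso; simp [Complex.ext_iff] at hab; try norm_num at hab)

lemma star_ipow_mul (r : ZMod 4) : star (ipow r) * ipow r = 1 := by
  simp [ipow, ← mul_pow]

lemma ipow_two_mul_val (c : ZMod 2) : ipow (2 * (c.val : ZMod 4)) = sgn c := by
  rcases bit_cases c with rfl | rfl <;> simp [ZMod.val_one]

/-- As `-i = i^3`, the factor `(-i)^(p·q)` of the bit format becomes the summand `3 (p·q)` in the
exponent modulo 4. -/
lemma ipow_three_mul_val (d : ZMod 2) :
    ipow (3 * (d.val : ZMod 4)) = (-Complex.I) ^ d.val := by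
  rcases bit_cases d with rfl | rfl <;> simp [ZMod.val_one]

/-! Labels. -/

lemma label_add_self {n : ℕ} (z : Label n) : z + z = 0 := by
  ext i; exact bit_add_self _

lemma label_add_add_cancel {n : ℕ} (z w : Label n) : z + w + w = z := by
  rw [add_assoc, label_add_self, add_zero]

lemma label_sub_eq {n : ℕ} (z w : Label n) : z - w = z + w := by
  rw [sub_eq_iff_eq_add, label_add_add_cancel]

lemma label_add_eq_iff {n : ℕ} (z w v : Label n) : z + w = v ↔ z = v + w := by
  rw [← label_sub_eq v w, eq_sub_iff_add_eq]

@[simp] lemma dotProduct_unitVec {n : ℕ} (p : Label n) (i : Fin n) : p ⬝ᵥ unitVec i = p i := by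
  simp [unitVec]

@[simp] lemma unitVec_dotProduct {n : ℕ} (p : Label n) (i : Fin n) : unitVec i ⬝ᵥ p = p i := by
  simp [unitVec]

@[simp] lemma unitVec_apply_self {n : ℕ} (i : Fin n) : (unitVec i : Label n) i = 1 := by
  simp [unitVec]

lemma unitVec_apply {n : ℕ} (i j : Fin n) : (unitVec i : Label n) j = if j = i then 1 else 0 := by
  simp [unitVec, Pi.single_apply]

/-- Every label is reached from zero by adding unit vectors. -/
lemma label_induction {n : ℕ} {p : Label n → Prop} (h0 : p 0)
    (hs : ∀ z i, p z → p (z + unitVec i)) (z : Label n) : p z := by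
  have key : ∀ s : Finset (Fin n), p (∑ i ∈ s, unitVec i) := by
    intro s
    induction s using Finset.induction_on with
    | empty => simpa using h0
    | insert a s ha ih => rw [Finset.sum_insert ha, add_comm]; exact hs _ _ ih
  -- A label is the sum of the unit vectors over its support.
  convert key (Finset.univ.filter fun i => z i = 1)
  ext j
  rw [Finset.sum_apply]
  rcases bit_cases (z j) with h | h <;> simp [unitVec_apply, h]

lemma label_ext_dotProduct {n : ℕ} {x : Label n} (h : ∀ z, x ⬝ᵥ z = 0) : x = 0 := by
  ext i; simpa using h (unitVec i)

/-! The action of Pauli gates on vectors. -/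

/-- The vector `P ψ`. -/
noncomputable def Pauli.app {n : ℕ} (P : Pauli n) (ψ : Vec n) : Vec n := fun w =>
  ipow P.r * (sgn (P.p ⬝ᵥ w) * ψ (w + P.q))

/-- The product of Pauli gates. -/
def Pauli.mul {n : ℕ} (A B : Pauli n) : Pauli n :=
  ⟨A.p + B.p, A.q + B.q, A.r + B.r + 2 * ((A.q ⬝ᵥ B.p).val : ZMod 4)⟩

lemma pauliMul_val {n : ℕ} (A B : Pauli n) : (pauliMul A B).val = A.mul B := rfl

/-- Moving `X^(A.q)` past `Z^(B.p)` costs the sign `(-1)^(A.q·B.p)`, which accounts for the last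
summand of the exponent. -/
lemma Pauli.app_mul {n : ℕ} (A B : Pauli n) (ψ : Vec n) :
    (A.mul B).app ψ = A.app (B.app ψ) := by
  ext w
  simp only [Pauli.app, Pauli.mul, ipow_add, ipow_two_mul_val, add_dotProduct, dotProduct_add,
    sgn_add]
  rw [dotProduct_comm B.p A.q, ← add_assoc w]
  ring

lemma Pauli.app_smul {n : ℕ} (A : Pauli n) (a : ℂ) (ψ : Vec n) :
    A.app (a • ψ) = a • A.app ψ := by
  ext w
  simp only [Pauli.app, Pi.smul_apply, smul_eq_mul]
  ring

/-- Two Pauli gates commute if this is `0` and anticommute if it is `1`. -/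
def Pauli.omega {n : ℕ} (A B : Pauli n) : ZMod 2 := A.p ⬝ᵥ B.q + A.q ⬝ᵥ B.p

lemma Pauli.app_comm {n : ℕ} (A B : Pauli n) (ψ : Vec n) :
    A.app (B.app ψ) = sgn (A.omega B) • B.app (A.app ψ) := by
  ext w
  simp only [Pauli.app, Pauli.omega, Pi.smul_apply, smul_eq_mul, sgn_add, dotProduct_add]
  rw [dotProduct_comm A.q B.p, add_right_comm w A.q B.q]
  linear_combination -(ipow A.r * ipow B.r * sgn (A.p ⬝ᵥ w) * sgn (B.p ⬝ᵥ w) *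
    sgn (B.p ⬝ᵥ A.q) * ψ (w + B.q + A.q)) * sgn_mul_self (A.p ⬝ᵥ B.q)

lemma Pauli.app_app {n : ℕ} (A : Pauli n) (ψ : Vec n) :
    A.app (A.app ψ) = (ipow (2 * A.r) * sgn (A.p ⬝ᵥ A.q)) • ψ := by
  ext w
  simp only [Pauli.app, Pi.smul_apply, smul_eq_mul, sgn_add, dotProduct_add, two_mul, ipow_add]
  rw [label_add_add_cancel]
  linear_combination (ipow A.r * ipow A.r * sgn (A.p ⬝ᵥ A.q) * ψ w) * sgn_mul_self (A.p ⬝ᵥ w)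

/-- This is the scalar in `Pauli.app_app`: `2 r` is even, so Pauli gates square to plus or minus the
identity. -/
lemma ipow_two_mul_mul_sgn (r : ZMod 4) (d : ZMod 2) :
    ipow (2 * r) * sgn d = 1 ∨ ipow (2 * r) * sgn d = -1 := by
  have h : ∀ r : ZMod 4, 2 * r = 0 ∨ 2 * r = 2 := by decide
  rcases h r with h | h <;> rcases bit_cases d with rfl | rfl <;> simp [h]

/-- A Pauli gate permutes positions up to phases. This lets nonzero entries be followed from column
to column without a new search. -/
lemma Pauli.app_ne_zero {n : ℕ} (A : Pauli n) {ψ : Vec n} {w : Label n} (h : ψ w ≠ 0) :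
    A.app ψ (w + A.q) ≠ 0 := by
  simp only [Pauli.app, label_add_add_cancel]
  exact mul_ne_zero (ipow_ne_zero _) (mul_ne_zero (sgn_ne_zero _) h)

/-- Pauli gates are isometries. -/
lemma Pauli.dot_app {n : ℕ} (A : Pauli n) (ψ φ : Vec n) :
    star (A.app ψ) ⬝ᵥ A.app φ = star ψ ⬝ᵥ φ := by
  rw [dotProduct, dotProduct]
  simp only [Pauli.app, Pi.star_apply, star_mul', star_sgn]
  rw [← Equiv.sum_comp (Equiv.addRight A.q) fun w => star (ψ w) * φ w]
  refine Finset.sum_congr rfl fun w _ => ?_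
  simp only [Equiv.coe_addRight]
  linear_combination (star (ψ (w + A.q)) * φ (w + A.q) * sgn (A.p ⬝ᵥ w) * sgn (A.p ⬝ᵥ w)) *
    star_ipow_mul A.r + (star (ψ (w + A.q)) * φ (w + A.q)) * sgn_mul_self (A.p ⬝ᵥ w)

/-! Matrices of Pauli gates. -/

/-- The matrix `i^r Z^p X^q`. -/
noncomputable def Pauli.toMat {n : ℕ} (P : Pauli n) : Mat n :=
  ipow P.r • (zGate P.p * xGate P.q)

lemma zGate_mulVec {n : ℕ} (p : Label n) (ψ : Vec n) :
    (zGate p).mulVec ψ = fun w => sgn (p ⬝ᵥ w) * ψ w := by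
  ext w
  simp [zGate, Matrix.mulVec_diagonal, sgn]

lemma xGate_mulVec {n : ℕ} (q : Label n) (ψ : Vec n) :
    (xGate q).mulVec ψ = fun w => ψ (w + q) := by
  ext w
  simp only [Matrix.mulVec, dotProduct, xGate, Matrix.of_apply]
  have : ∀ z : Label n, (w = z + q) ↔ z = w + q := fun z => by
    rw [eq_comm, label_add_eq_iff]
  simp [this]

lemma Pauli.toMat_mulVec {n : ℕ} (P : Pauli n) (ψ : Vec n) : P.toMat.mulVec ψ = P.app ψ := by
  ext w
  simp [Pauli.toMat, Matrix.smul_mulVec, ← Matrix.mulVec_mulVec, zGate_mulVec, xGate_mulVec,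
    Pauli.app]

lemma mat_ext_mulVec {n : ℕ} {A B : Mat n} (h : ∀ ψ, A.mulVec ψ = B.mulVec ψ) : A = B :=
  Matrix.ext_of_mulVec_single fun i => h (Pi.single i 1)

lemma Pauli.toMat_mul {n : ℕ} (A B : Pauli n) : (A.mul B).toMat = A.toMat * B.toMat :=
  mat_ext_mulVec fun ψ => by
    rw [← Matrix.mulVec_mulVec, Pauli.toMat_mulVec, Pauli.toMat_mulVec, Pauli.toMat_mulVec,
      Pauli.app_mul]

/-- The inverse of a Pauli gate. -/
def Pauli.inv {n : ℕ} (A : Pauli n) : Pauli n :=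
  ⟨A.p, A.q, -A.r + 2 * ((A.p ⬝ᵥ A.q).val : ZMod 4)⟩

lemma Pauli.app_inv {n : ℕ} (A : Pauli n) (ψ : Vec n) : A.app (A.inv.app ψ) = ψ := by
  ext w
  simp only [Pauli.app, Pauli.inv, ipow_add, ipow_two_mul_val, sgn_add, dotProduct_add]
  rw [label_add_add_cancel]
  have h : ipow A.r * ipow (-A.r) = 1 := by rw [← ipow_add]; simp
  linear_combination (ψ w * sgn (A.p ⬝ᵥ w) * sgn (A.p ⬝ᵥ w) * sgn (A.p ⬝ᵥ A.q) *
    sgn (A.p ⬝ᵥ A.q)) * h + (ψ w * sgn (A.p ⬝ᵥ A.q) * sgn (A.p ⬝ᵥ A.q)) *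
    sgn_mul_self (A.p ⬝ᵥ w) + ψ w * sgn_mul_self (A.p ⬝ᵥ A.q)

lemma Pauli.toMat_inv {n : ℕ} (A : Pauli n) : A.toMat * A.inv.toMat = 1 :=
  mat_ext_mulVec fun ψ => by
    rw [← Matrix.mulVec_mulVec, Pauli.toMat_mulVec, Pauli.toMat_mulVec, Pauli.app_inv,
      Matrix.one_mulVec]

/-- The entries of `A* A` are the inner products of the images of basis vectors, which an isometry
preserves. -/
lemma Pauli.toMat_conjTranspose {n : ℕ} (A : Pauli n) : A.toMat.conjTranspose * A.toMat = 1 := by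
  refine Matrix.ext_of_mulVec_single fun z => ?_
  ext w
  have h := A.dot_app (Pi.single w 1) (Pi.single z 1)
  rw [← Pauli.toMat_mulVec, ← Pauli.toMat_mulVec, Matrix.star_mulVec,
    ← Matrix.dotProduct_mulVec, Matrix.mulVec_mulVec] at h
  have hs : star (Pi.single w (1 : ℂ) : Vec n) = Pi.single w 1 := by
    ext v; simp [Pi.single_apply, apply_ite]
  rw [hs] at h
  simpa [Matrix.one_apply, Pi.single_apply, eq_comm] using h

lemma Pauli.toMat_mem_unitary {n : ℕ} (A : Pauli n) :
    A.toMat ∈ Matrix.unitaryGroup (Label n) ℂ :=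
  Matrix.mem_unitaryGroup_iff'.2 A.toMat_conjTranspose

/-- The identity as a Pauli gate. -/
def Pauli.one (n : ℕ) : Pauli n := ⟨0, 0, 0⟩

lemma Pauli.app_one {n : ℕ} (ψ : Vec n) : (Pauli.one n).app ψ = ψ := by
  ext w; simp [Pauli.app, Pauli.one]

lemma Pauli.toMat_one (n : ℕ) : (Pauli.one n).toMat = 1 :=
  mat_ext_mulVec fun ψ => by rw [Pauli.toMat_mulVec, Pauli.app_one, Matrix.one_mulVec]

lemma zGate_zero (n : ℕ) : zGate (0 : Label n) = 1 :=
  mat_ext_mulVec fun ψ => by rw [zGate_mulVec]; simp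

lemma xGate_zero (n : ℕ) : xGate (0 : Label n) = 1 :=
  mat_ext_mulVec fun ψ => by rw [xGate_mulVec]; simp

lemma zGate_add {n : ℕ} (p p' : Label n) : zGate (p + p') = zGate p * zGate p' :=
  mat_ext_mulVec fun ψ => by
    rw [← Matrix.mulVec_mulVec, zGate_mulVec, zGate_mulVec, zGate_mulVec]
    ext w
    simp only [add_dotProduct, sgn_add]
    ring

lemma xGate_add {n : ℕ} (p p' : Label n) : xGate (p + p') = xGate p * xGate p' :=
  mat_ext_mulVec fun ψ => by
    rw [← Matrix.mulVec_mulVec, xGate_mulVec, xGate_mulVec, xGate_mulVec]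
    ext w
    simp only [add_assoc]

/-- The elements of the Pauli group are the gates `i^r Z^p X^q`. -/
lemma mem_pauliGroup_iff {n : ℕ} (A : Matrix.unitaryGroup (Label n) ℂ) :
    A ∈ pauliGroup n ↔ ∃ P : Pauli n, (A : Mat n) = P.toMat := by
  constructor
  · intro h
    unfold pauliGroup at h
    induction h using Subgroup.closure_induction with
    | mem x hx =>
      rcases hx with ⟨i, h⟩ | ⟨i, h⟩ | h
      · exact ⟨⟨unitVec i, 0, 0⟩, by simp [h, Pauli.toMat, xGate_zero]⟩
      · exact ⟨⟨0, unitVec i, 0⟩, by simp [h, Pauli.toMat, zGate_zero]⟩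
      · exact ⟨⟨0, 0, 1⟩, by simp [h, Pauli.toMat, zGate_zero, xGate_zero]⟩
    | one => exact ⟨Pauli.one n, by simp [Pauli.toMat_one]⟩
    | mul x y _ _ hx hy =>
      obtain ⟨P, hP⟩ := hx
      obtain ⟨Q, hQ⟩ := hy
      exact ⟨P.mul Q, by rw [Pauli.toMat_mul, ← hP, ← hQ]; rfl⟩
    | inv x _ hx =>
      obtain ⟨P, hP⟩ := hx
      refine ⟨P.inv, ?_⟩
      have h1 : (x : Mat n) * ((x⁻¹ : Matrix.unitaryGroup (Label n) ℂ) : Mat n) = 1 := by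
        simp
      have h2 : P.inv.toMat * (x : Mat n) = 1 :=
        mul_eq_one_comm.1 (by rw [hP]; exact P.toMat_inv)
      calc ((x⁻¹ : Matrix.unitaryGroup (Label n) ℂ) : Mat n)
          = P.inv.toMat * (x : Mat n) * ((x⁻¹ : Matrix.unitaryGroup (Label n) ℂ) : Mat n) := by
            rw [h2, one_mul]
        _ = P.inv.toMat := by rw [mul_assoc, h1, mul_one]
  · rintro ⟨P, hP⟩
    have hz : ∀ p : Label n, ∃ B ∈ pauliGroup n, (B : Mat n) = zGate p := by
      refine label_induction ⟨1, one_mem _, by simp [zGate_zero]⟩ ?_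
      rintro z i ⟨B, hB, hBz⟩
      refine ⟨B * ⟨zGate (unitVec i), ?_⟩, mul_mem hB
        (Subgroup.subset_closure (Or.inl ⟨i, rfl⟩)), by simp [hBz, zGate_add]⟩
      have := Pauli.toMat_mem_unitary (⟨unitVec i, 0, 0⟩ : Pauli n)
      simpa [Pauli.toMat, xGate_zero] using this
    have hx : ∀ p : Label n, ∃ B ∈ pauliGroup n, (B : Mat n) = xGate p := by
      refine label_induction ⟨1, one_mem _, by simp [xGate_zero]⟩ ?_
      rintro z i ⟨B, hB, hBz⟩
      refine ⟨B * ⟨xGate (unitVec i), ?_⟩, mul_mem hB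
        (Subgroup.subset_closure (Or.inr (Or.inl ⟨i, rfl⟩))), by simp [hBz, xGate_add]⟩
      have := Pauli.toMat_mem_unitary (⟨0, unitVec i, 0⟩ : Pauli n)
      simpa [Pauli.toMat, zGate_zero] using this
    have hI : ∀ r : ℕ, ∃ B ∈ pauliGroup n, (B : Mat n) = Complex.I ^ r • (1 : Mat n) := by
      intro r
      induction r with
      | zero => exact ⟨1, one_mem _, by simp⟩
      | succ r ih =>
        obtain ⟨B, hB, hBz⟩ := ih
        refine ⟨B * ⟨Complex.I • 1, ?_⟩, mul_mem hB
          (Subgroup.subset_closure (Or.inr (Or.inr rfl))), by simp [hBz, pow_succ, smul_smul, mul_comm]⟩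
        have := Pauli.toMat_mem_unitary (⟨0, 0, 1⟩ : Pauli n)
        simpa [Pauli.toMat, zGate_zero, xGate_zero] using this
    obtain ⟨B, hB, hB'⟩ := hI P.r.val
    obtain ⟨D, hD, hD'⟩ := hz P.p
    obtain ⟨E, hE, hE'⟩ := hx P.q
    have : A = B * (D * E) := by
      apply Subtype.ext
      simp [hP, hB', hD', hE', Pauli.toMat, ipow]
    rw [this]
    exact mul_mem hB (mul_mem hD hE)

/-! Row reduction. -/

/-- The linear combination of the rows of `A` with coefficients `x`. -/
def comb {k m : ℕ} (x : Fin k → ZMod 2) (A : Fin k → Fin m → ZMod 2) : Fin m → ZMod 2 :=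
  fun c => ∑ i, x i * A i c

lemma add_comb {k m : ℕ} (x y : Fin k → ZMod 2) (A : Fin k → Fin m → ZMod 2) :
    comb (x + y) A = comb x A + comb y A := by
  ext c; simp [comb, add_mul, Finset.sum_add_distrib]

@[simp] lemma zero_comb {k m : ℕ} (A : Fin k → Fin m → ZMod 2) : comb 0 A = 0 := by
  ext c; simp [comb]

lemma single_comb {k m : ℕ} (r : Fin k) (a : ZMod 2) (A : Fin k → Fin m → ZMod 2) :
    comb (Pi.single r a) A = a • A r := by
  ext c; simp [comb, Pi.single_apply]

@[simp] lemma unitVec_comb {k m : ℕ} (r : Fin k) (A : Fin k → Fin m → ZMod 2) :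
    comb (unitVec r) A = A r := by
  rw [unitVec, single_comb, one_smul]

lemma comb_comb {k l m : ℕ} (x : Fin k → ZMod 2) (A : Fin k → Fin l → ZMod 2)
    (B : Fin l → Fin m → ZMod 2) : comb (comb x A) B = comb x fun i => comb (A i) B := by
  ext c
  simp only [comb, Finset.sum_mul, Finset.mul_sum, mul_assoc]
  exact Finset.sum_comm

lemma comb_dotProduct {k m : ℕ} (x : Fin k → ZMod 2) (A : Fin k → Fin m → ZMod 2)
    (v : Fin m → ZMod 2) : comb x A ⬝ᵥ v = x ⬝ᵥ fun i => A i ⬝ᵥ v := by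
  simp only [comb, dotProduct, Finset.sum_mul, Finset.mul_sum, mul_assoc]
  exact Finset.sum_comm

lemma comb_injective {k m : ℕ} {A : Fin k → Fin m → ZMod 2} (hA : ∀ x, comb x A = 0 → x = 0) :
    Function.Injective fun x => comb x A := fun x y hxy => by
  have hxy : comb x A = comb y A := hxy
  have h := hA (x + y) (by rw [add_comb, hxy, label_add_self])
  simpa using (label_add_eq_iff _ _ _).1 h

/-- What holds during row reduction after the rows below `r` have been treated, if the rows of `A`
are linearly independent. -/
structure IsReduced {k m : ℕ} (A : Fin k → Fin m → ZMod 2) (r : ℕ)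
    (R : RowReduction k m) : Prop where
  rows_eq : ∀ x, comb x R.rows = comb (comb x R.change) A
  change_inj : ∀ x, comb x R.change = 0 → x = 0
  pivot_some : ∀ i : Fin k, (i : ℕ) < r →
    ∃ c, R.pivot i = some c ∧ ∀ t, R.rows t c = if t = i then 1 else 0
  pivot_none : ∀ i : Fin k, r ≤ (i : ℕ) → R.pivot i = none

/-- Whether row `r` is added to row `t`. -/
def addBit {k : ℕ} (r : Fin k) (marked : Fin k → Bool) (t : Fin k) : ZMod 2 :=
  if t ≠ r ∧ marked t = true then 1 else 0

lemma addRowTo_apply {k m : ℕ} (r : Fin k) (marked : Fin k → Bool)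
    (A : Fin k → Fin m → ZMod 2) (t : Fin k) (c : Fin m) :
    (addRowTo r marked A).val t c = A t c + addBit r marked t * A r c := by
  by_cases h : t ≠ r ∧ marked t = true
  · have : (decide (t ≠ r) && marked t) = true := by simpa using h
    simp [addRowTo, addBit, h, vadd]
  · have : (decide (t ≠ r) && marked t) = false := by simpa using h
    simp only [addRowTo, addBit, h, table_val, bind_val, op_val, this]
    simp

/-- A row operation is a substitution in the coefficients that does not depend on the matrix.
Applied to the rows and to the change of basis at once, it therefore preserves the relation between
them. -/
lemma comb_addRowTo {k m : ℕ} (r : Fin k) (marked : Fin k → Bool)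
    (A : Fin k → Fin m → ZMod 2) (x : Fin k → ZMod 2) :
    comb x (addRowTo r marked A).val = comb (x + Pi.single r (x ⬝ᵥ addBit r marked)) A := by
  rw [add_comb, single_comb]
  ext c
  simp only [comb, dotProduct, addRowTo_apply, Pi.add_apply, mul_add,
    Finset.sum_add_distrib, smul_eq_mul, Finset.sum_mul, Pi.smul_apply, mul_assoc]

/-- The substitution of a row operation is injective: it alters only the coefficient at `r`, by an
amount that does not involve that coefficient because `b r = 0`. -/
lemma add_single_eq_zero {k : ℕ} {r : Fin k} {b x : Fin k → ZMod 2} (hb : b r = 0)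
    (h : x + Pi.single r (x ⬝ᵥ b) = 0) : x = 0 := by
  have h1 : ∀ t, t ≠ r → x t = 0 := fun t ht => by
    have := congrFun h t
    simpa [ht] using this
  have h2 : x ⬝ᵥ b = 0 := by
    refine Finset.sum_eq_zero fun t _ => ?_
    by_cases ht : t = r
    · rw [ht, hb, mul_zero]
    · rw [h1 t ht, zero_mul]
  rw [h2] at h
  simpa using h

lemma rowReduce_isReduced {k m : ℕ} (A : Fin k → Fin m → ZMod 2)
    (hA : ∀ x, comb x A = 0 → x = 0) : IsReduced A k (rowReduce A).val := by
  unfold rowReduce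
  simp only [bind_val, table_val, op_val]
  refine loop_invariant (IsReduced A) k _ _ ?_ ?_
  · have h1 : ∀ x : Fin k → ZMod 2,
        comb x (fun i j : Fin k => if i = j then (1 : ZMod 2) else 0) = x := fun x => by
      ext c; simp [comb]
    refine ⟨fun x => ?_, fun x hx => ?_, fun i hi => absurd hi (Nat.not_lt_zero _), fun i _ => rfl⟩
    · rw [h1]
    · rwa [h1] at hx
  · intro r s hs
    -- A zero row would be a nontrivial relation between the rows of `A`, so the search for a pivot
    -- never fails.
    have hrow : s.rows r ≠ 0 := by
      intro h0
      have h1 := hs.rows_eq (unitVec r)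
      rw [unitVec_comb, h0] at h1
      have := hs.change_inj _ (hA _ h1.symm)
      simpa using congrFun this r
    obtain ⟨c, hc⟩ : ∃ c, s.rows r c = 1 := by
      by_contra hne
      push Not at hne
      exact hrow (funext fun c => (bit_cases _).resolve_right (hne c))
    obtain ⟨c, hf, hc⟩ := findFirst_isSome
      (f := fun c => op (decide (s.rows r c = 1))) (i := c) (by simpa using hc)
    simp only [op_val, decide_eq_true_eq] at hc
    simp only [bind_val, hf, table_val, op_val, pure_val]
    set marked : Fin k → Bool := fun t => decide (s.rows t c = 1) with hm
    have hb : addBit r marked r = 0 := by simp [addBit]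
    refine ⟨fun x => ?_, fun x hx => ?_, fun i hi => ?_, fun i hi => ?_⟩
    · rw [comb_addRowTo, comb_addRowTo, hs.rows_eq]
    · rw [comb_addRowTo] at hx
      exact add_single_eq_zero hb (hs.change_inj _ hx)
    · by_cases hir : i = r
      · subst hir
        refine ⟨c, by simp, fun t => ?_⟩
        refine (addRowTo_apply _ _ _ _ _).trans ?_
        rw [hc]
        by_cases ht : t = i
        · subst ht; simp [hb, hc]
        · rcases bit_cases (s.rows t c) with h | h <;> simp [addBit, ht, hm, h, bit_add_self]
      · have hir' : (i : ℕ) < r := lt_of_le_of_ne (Nat.lt_succ_iff.1 hi) fun h => hir (Fin.ext h)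
        -- Row `r` vanishes in every earlier pivot column, so adding it leaves those unit vectors
        -- intact.
        obtain ⟨d, hd, hd'⟩ := hs.pivot_some i hir'
        refine ⟨d, by simp [hir, hd], fun t => ?_⟩
        refine (addRowTo_apply _ _ _ _ _).trans ?_
        rw [hd', hd' r, if_neg (Ne.symm hir), mul_zero, add_zero]
    · have hir : i ≠ r := fun h => by subst h; omega
      simp only [hir, if_false]
      exact hs.pivot_none i (by omega)

/-- The pivot columns of a reduced matrix. -/
lemma IsReduced.exists_pivots {k m : ℕ} {A : Fin k → Fin m → ZMod 2}
    {R : RowReduction k m} (h : IsReduced A k R) :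
    ∃ piv : Fin k → Fin m, (∀ t i, R.rows t (piv i) = if t = i then 1 else 0) ∧
      ∀ c i, (pivotRows R).val c = some i ↔ c = piv i := by
  choose piv h1 h2 using fun i : Fin k => h.pivot_some i i.2
  have hinj : Function.Injective piv := fun i j hij => by
    have h3 := h2 i i
    rw [hij, h2 j i] at h3
    by_contra hne
    simp [hne] at h3
  refine ⟨piv, fun t i => h2 i t, fun c i => ⟨fun hc => ?_, fun hc => ?_⟩⟩
  · have := findFirst_some hc
    simp only [op_val, h1, decide_eq_true_eq, Option.some.injEq] at this
    exact this.symm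
  · obtain ⟨j, hj, hj'⟩ := findFirst_isSome
      (f := fun i => op (decide (R.pivot i = some c))) (i := i) (by simp [h1, hc])
    simp only [op_val, h1, decide_eq_true_eq, Option.some.injEq] at hj'
    have : j = i := hinj (hj'.trans hc)
    rw [← this]
    exact hj

/-- Let `R = G A` be the reduced matrix, with change of basis `G`. The result `B` has row `i` of `G`
at the pivot column of row `i` and zeros elsewhere, so `R B = G`. Thus `G A B = G`, and `G` is
invertible. -/
lemma rightInverse_spec {k m : ℕ} (A : Fin k → Fin m → ZMod 2)
    (hA : ∀ x, comb x A = 0 → x = 0) (y : Fin k → ZMod 2) :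
    comb (comb y A) (rightInverse A).val = y := by
  have hR := rowReduce_isReduced A hA
  obtain ⟨piv, hpiv, hinv⟩ := hR.exists_pivots
  set R := (rowReduce A).val with hRdef
  set B := (rightInverse A).val with hB
  have hBval : ∀ c j, B c j = ∑ i, if c = piv i then R.change i j else 0 := by
    intro c j
    have : B c j = match (pivotRows R).val c with
        | some i => R.change i j
        | none => 0 := by
      simp only [hB, rightInverse, bind_val, table_val, ← hRdef]
      cases (pivotRows R).val c <;> rfl
    rw [this]
    cases hc : (pivotRows R).val c with
    | none =>
      refine (Finset.sum_eq_zero fun i _ => if_neg fun h => ?_).symm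
      rw [(hinv c i).2 h] at hc
      simp at hc
    | some i =>
      have hci : c = piv i := (hinv c i).1 hc
      rw [Finset.sum_eq_single i, if_pos hci]
      · intro t _ hti
        refine if_neg fun h => hti ?_
        have := (hinv c t).2 h
        rw [hc] at this
        exact (Option.some.inj this).symm
      · simp
  have hrows : ∀ x, comb (comb x R.rows) B = comb x R.change := by
    intro x
    rw [comb_comb]
    congr 1
    ext t j
    simp only [comb, hBval, Finset.mul_sum]
    rw [Finset.sum_comm]
    simp [hpiv]
  -- An injective map of a finite set to itself is surjective, so every coefficient vector comes
  -- from the reduced rows.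
  obtain ⟨x, rfl⟩ : ∃ x, comb x R.change = y :=
    Finite.injective_iff_surjective.1 (comb_injective hR.change_inj) y
  rw [← hR.rows_eq, hrows]

/-- A right inverse of a square matrix is a left inverse. -/
lemma rightInverse_spec' {k : ℕ} (A : Fin k → Fin k → ZMod 2)
    (hA : ∀ x, comb x A = 0 → x = 0) (y : Fin k → ZMod 2) :
    comb (comb y (rightInverse A).val) A = y := by
  obtain ⟨x, rfl⟩ : ∃ x, comb x A = y :=
    Finite.injective_iff_surjective.1 (comb_injective hA) y
  rw [rightInverse_spec A hA]

/-! Labels as integers. -/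

lemma label_apply {n : ℕ} (t : ℕ) (i : Fin n) :
    (label t : Label n) i = if t.testBit i then 1 else 0 := rfl

lemma index_label {n : ℕ} : ∀ {t : ℕ}, t < 2 ^ n → index (label t : Label n) = t := by
  induction n with
  | zero => intro t ht; simp [index]; omega
  | succ n ih =>
    intro t ht
    have h2 : t / 2 < 2 ^ n := by rw [pow_succ] at ht; omega
    have h3 := ih h2
    simp only [index, label_apply] at h3
    rw [index, Fin.sum_univ_succ]
    have h4 : ∀ i : Fin n, ((label t : Label (n + 1)) i.succ).val * 2 ^ ((i.succ : Fin (n + 1)) : ℕ) =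
        2 * ((if (t / 2).testBit i then (1 : ZMod 2) else 0).val * 2 ^ (i : ℕ)) := by
      intro i
      rw [label_apply, Fin.val_succ, Nat.testBit_succ, pow_succ]
      ring
    rw [Finset.sum_congr rfl fun i _ => h4 i, ← Finset.mul_sum, h3, label_apply]
    by_cases hb : t.testBit 0 = true
    · have : t % 2 = 1 := by simpa [Nat.testBit_zero] using hb
      simp [hb, ZMod.val_one]; omega
    · have : t % 2 = 0 := by simpa [Nat.testBit_zero] using hb
      simp [hb]; omega

lemma label_injOn {n : ℕ} {s t : ℕ} (hs : s < 2 ^ n) (ht : t < 2 ^ n)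
    (h : (label s : Label n) = label t) : s = t := by
  rw [← index_label hs, h, index_label ht]

lemma card_label (n : ℕ) : Fintype.card (Label n) = 2 ^ n := by simp

lemma label_bijective (n : ℕ) : Function.Bijective fun t : Fin (2 ^ n) => (label t : Label n) := by
  rw [Fintype.bijective_iff_injective_and_card]
  exact ⟨fun s t h => Fin.ext (label_injOn s.2 t.2 h), by simp⟩

lemma exists_label {n : ℕ} (z : Label n) : ∃ t < 2 ^ n, label t = z := by
  obtain ⟨t, ht⟩ := (label_bijective n).2 z
  exact ⟨t, t.2, ht⟩

lemma label_index {n : ℕ} (z : Label n) : label (index z) = z := by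
  obtain ⟨t, ht, rfl⟩ := exists_label z
  rw [index_label ht]

lemma index_lt {n : ℕ} (z : Label n) : index z < 2 ^ n := by
  obtain ⟨t, ht, rfl⟩ := exists_label z
  rwa [index_label ht]

lemma index_injective (n : ℕ) : Function.Injective (index : Label n → ℕ) := fun z w h => by
  rw [← label_index z, h, label_index]

lemma testBit_index {n : ℕ} (z : Label n) (i : Fin n) : (index z).testBit i = decide (z i = 1) := by
  conv_rhs => rw [← label_index z, label_apply]
  split_ifs with h <;> simp [h]

lemma index_lt_of {n : ℕ} {u v : Label n} (m : Fin n) (hu : u m = 0) (hv : v m = 1)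
    (h : ∀ i, m < i → u i = v i) : index u < index v := by
  refine Nat.lt_of_testBit m (by simp [testBit_index, hu]) (by simp [testBit_index, hv]) ?_
  intro j hj
  -- Digits beyond position `n` vanish in both integers.
  by_cases hjn : j < n
  · have := testBit_index u ⟨j, hjn⟩
    have h2 := testBit_index v ⟨j, hjn⟩
    simp only at this h2
    rw [this, h2, h ⟨j, hjn⟩ hj]
  · push Not at hjn
    rw [Nat.testBit_lt_two_pow ((index_lt u).trans_le (Nat.pow_le_pow_right (by norm_num) hjn)),
      Nat.testBit_lt_two_pow ((index_lt v).trans_le (Nat.pow_le_pow_right (by norm_num) hjn))]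

lemma exists_of_index_lt {n : ℕ} {u v : Label n} (huv : index u < index v) :
    ∃ m : Fin n, u m = 0 ∧ v m = 1 ∧ ∀ i, m < i → u i = v i := by
  have hne : (Finset.univ.filter fun i => u i ≠ v i).Nonempty := by
    by_contra h
    rw [Finset.not_nonempty_iff_eq_empty, Finset.filter_eq_empty_iff] at h
    have : u = v := funext fun i => by simpa using h (Finset.mem_univ i)
    rw [this] at huv
    exact lt_irrefl _ huv
  set m := (Finset.univ.filter fun i => u i ≠ v i).max' hne with hm
  have hmem : u m ≠ v m := by
    have := Finset.max'_mem _ hne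
    rw [← hm] at this
    simpa using this
  have hgt : ∀ i, m < i → u i = v i := fun i hi => by
    by_contra h
    exact absurd (Finset.le_max' _ i (by simpa using h)) (not_le.2 hi)
  rcases bit_cases (u m) with hu | hu <;> rcases bit_cases (v m) with hv | hv
  · exact absurd (hu.trans hv.symm) hmem
  · exact ⟨m, hu, hv, hgt⟩
  · exact absurd (index_lt_of m hv hu fun i hi => (hgt i hi).symm) (not_lt.2 huv.le)
  · exact absurd (hu.trans hv.symm) hmem

/-! Sorted subspaces. -/

/-- Appending a vector to a basis. -/
lemma comb_snoc {n k : ℕ} (b : Fin k → Label n) (u : Label n) (x : Label (k + 1)) :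
    comb x (Fin.snoc b u : Fin (k + 1) → Label n) =
      comb (fun i => x i.castSucc) b + x (Fin.last k) • u := by
  ext c
  simp [comb, Fin.sum_univ_castSucc]

lemma label_castSucc_of_lt {k t : ℕ} :
    (fun i => (label t : Label (k + 1)) i.castSucc) = (label t : Label k) := rfl

lemma label_last_of_lt {k t : ℕ} (ht : t < 2 ^ k) : (label t : Label (k + 1)) (Fin.last k) = 0 := by
  simp [label_apply, Nat.testBit_lt_two_pow ht]

lemma label_two_pow_add {k s : ℕ} : (label (2 ^ k + s) : Label k) = label s := by
  ext i
  rw [label_apply, label_apply, Nat.testBit_two_pow_add_gt i.2]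

lemma label_last_two_pow_add {k s : ℕ} (hs : s < 2 ^ k) :
    (label (2 ^ k + s) : Label (k + 1)) (Fin.last k) = 1 := by
  simp [label_apply, Nat.testBit_two_pow_add_eq, Nat.testBit_lt_two_pow hs]

/-- Every subspace has a basis whose combinations enumerate it in increasing order. -/
lemma exists_increasing_basis {n : ℕ} (V : Submodule (ZMod 2) (Label n)) :
    ∃ (k : ℕ) (b : Fin k → Label n),
      (∀ s t, s < t → t < 2 ^ k → index (comb (label s) b) < index (comb (label t) b)) ∧
      ∀ v, v ∈ V ↔ ∃ t < 2 ^ k, comb (label t) b = v := by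
  -- Induction on the number `j` of digits, for the part of `V` in which all digits from `j` on
  -- vanish.
  have key : ∀ j ≤ n, ∃ (k : ℕ) (b : Fin k → Label n),
      (∀ s t, s < t → t < 2 ^ k → index (comb (label s) b) < index (comb (label t) b)) ∧
      ∀ v, (v ∈ V ∧ ∀ i : Fin n, j ≤ i → v i = 0) ↔ ∃ t < 2 ^ k, comb (label t) b = v := by
    intro j
    induction j with
    | zero =>
      refine fun _ => ⟨0, Fin.elim0, fun s t h1 h2 => by simp at h2; omega, fun v => ?_⟩
      have h0 : ∀ t, comb (label t : Label 0) (Fin.elim0 : Fin 0 → Label n) = 0 := fun t => by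
        ext c; simp [comb]
      constructor
      · rintro ⟨-, h⟩
        exact ⟨0, by simp, by rw [h0]; exact (funext fun i => (h i (Nat.zero_le _))).symm⟩
      · rintro ⟨t, -, rfl⟩
        rw [h0]
        exact ⟨V.zero_mem, fun _ _ => rfl⟩
    | succ j ih =>
      intro hj
      obtain ⟨k, b, hmono, hmem⟩ := ih (by omega)
      let m : Fin n := ⟨j, hj⟩
      -- The next part is at most twice as large. If it grows, the new basis vector has to be the
      -- least element with highest digit `j`; it will stand at position `2^k`.
      by_cases hex : ∃ u ∈ V, (∀ i : Fin n, j + 1 ≤ i → u i = 0) ∧ u m = 1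
      · -- choose `u` with the smallest index
        obtain ⟨u, ⟨huV, hu0, hu1⟩, hmin⟩ : ∃ u, (u ∈ V ∧ (∀ i : Fin n, j + 1 ≤ i → u i = 0) ∧
            u m = 1) ∧ ∀ v, (v ∈ V ∧ (∀ i : Fin n, j + 1 ≤ i → v i = 0) ∧ v m = 1) →
            index u ≤ index v := by
          obtain ⟨u, hu, h⟩ := Set.exists_min_image
            {v : Label n | v ∈ V ∧ (∀ i : Fin n, j + 1 ≤ i → v i = 0) ∧ v m = 1} index
            (Set.toFinite _) (by obtain ⟨u, h1, h2⟩ := hex; exact ⟨u, h1, h2⟩)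
          exact ⟨u, hu, fun v hv => h v hv⟩
        have hlow : ∀ {t}, t < 2 ^ k → comb (label t) (Fin.snoc b u : Fin (k + 1) → Label n) =
            comb (label t) b := fun {t} ht => by
          rw [comb_snoc, label_last_of_lt ht, zero_smul, add_zero, label_castSucc_of_lt]
        have hhigh : ∀ {s}, s < 2 ^ k → comb (label (2 ^ k + s))
            (Fin.snoc b u : Fin (k + 1) → Label n) = comb (label s) b + u := fun {s} hs => by
          rw [comb_snoc, label_last_two_pow_add hs, one_smul, label_castSucc_of_lt,
            label_two_pow_add]
        have hin : ∀ {t}, t < 2 ^ k → comb (label t) b ∈ V ∧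
            ∀ i : Fin n, j ≤ i → comb (label t) b i = 0 := fun {t} ht => (hmem _).2 ⟨t, ht, rfl⟩
        refine ⟨k + 1, Fin.snoc b u, ?_, ?_⟩
        · intro s t hst ht
          rw [pow_succ] at ht
          by_cases h1 : t < 2 ^ k
          · rw [hlow h1, hlow (hst.trans h1)]
            exact hmono s t hst h1
          · obtain ⟨t, rfl⟩ := Nat.exists_eq_add_of_le (not_lt.1 h1)
            have ht' : t < 2 ^ k := by omega
            rw [hhigh ht']
            by_cases h2 : s < 2 ^ k
            · rw [hlow h2]
              refine index_lt_of m ((hin h2).2 m le_rfl) ?_ fun i hi => ?_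
              · rw [Pi.add_apply, (hin ht').2 m le_rfl, zero_add, hu1]
              · have hi' : j + 1 ≤ (i : ℕ) := hi
                rw [Pi.add_apply, (hin ht').2 i (by omega), (hin h2).2 i (by omega), hu0 i hi',
                  add_zero]
            · obtain ⟨s, rfl⟩ := Nat.exists_eq_add_of_le (not_lt.1 h2)
              have hs' : s < 2 ^ k := by omega
              rw [hhigh hs']
              obtain ⟨l, hl0, hl1, hl⟩ := exists_of_index_lt (hmono s t (by omega) ht')
              -- Here `l` is the highest digit in which the two combinations differ. If `u` had a
              -- one there, adding their sum to `u` would clear it without touching higher digits,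
              -- against the minimality of `u`. Hence adding `u` preserves the order.
              have hul : u l = 0 := by
                refine (bit_cases (u l)).resolve_right fun hul => ?_
                have hv := hmin (u + (comb (label s) b + comb (label t) b)) ⟨?_, ?_, ?_⟩
                · refine absurd (index_lt_of l ?_ hul ?_) (not_lt.2 hv)
                  · simp [hul, hl0, hl1, bit_add_self]
                  · intro i hi
                    simp [hl i hi, bit_add_self]
                · exact V.add_mem huV (V.add_mem (hin hs').1 (hin ht').1)
                · intro i hi
                  simp [hu0 i hi, (hin hs').2 i (by omega), (hin ht').2 i (by omega)]
                · simp [hu1, (hin hs').2 m le_rfl, (hin ht').2 m le_rfl]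
              refine index_lt_of l ?_ ?_ fun i hi => ?_
              · simp [hl0, hul]
              · simp [hl1, hul]
              · simp [hl i hi]
        · intro v
          constructor
          · rintro ⟨hvV, hv⟩
            rcases bit_cases (v m) with hvm | hvm
            · obtain ⟨t, ht, rfl⟩ := (hmem v).1 ⟨hvV, fun i hi => by
                rcases eq_or_lt_of_le hi with h | h
                · have : i = m := Fin.ext h.symm
                  rw [this, hvm]
                · exact hv i h⟩
              exact ⟨t, by rw [pow_succ]; omega, hlow ht⟩
            · obtain ⟨t, ht, htv⟩ := (hmem (v + u)).1 ⟨V.add_mem hvV huV, fun i hi => by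
                rcases eq_or_lt_of_le hi with h | h
                · have : i = m := Fin.ext h.symm
                  rw [this, Pi.add_apply, hvm, hu1, bit_add_self]
                · rw [Pi.add_apply, hv i h, hu0 i h, add_zero]⟩
              refine ⟨2 ^ k + t, by rw [pow_succ]; omega, ?_⟩
              rw [hhigh ht, htv, label_add_add_cancel]
          · rintro ⟨t, ht, rfl⟩
            rw [pow_succ] at ht
            by_cases h1 : t < 2 ^ k
            · rw [hlow h1]
              exact ⟨(hin h1).1, fun i hi => (hin h1).2 i (by omega)⟩
            · obtain ⟨t, rfl⟩ := Nat.exists_eq_add_of_le (not_lt.1 h1)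
              have ht' : t < 2 ^ k := by omega
              rw [hhigh ht']
              refine ⟨V.add_mem (hin ht').1 huV, fun i hi => ?_⟩
              rw [Pi.add_apply, (hin ht').2 i (by omega), hu0 i hi, add_zero]
      · refine ⟨k, b, hmono, fun v => ?_⟩
        rw [← hmem]
        refine and_congr_right fun hv => ⟨fun h i hi => ?_, fun h i hi => h i (by omega)⟩
        rcases eq_or_lt_of_le hi with h' | h'
        · have : i = m := Fin.ext h'.symm
          rw [this]
          exact (bit_cases _).resolve_right fun h1 => hex ⟨v, hv, h, h1⟩
        · exact h i h'
  obtain ⟨k, b, h1, h2⟩ := key n le_rfl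
  refine ⟨k, b, h1, fun v => ?_⟩
  rw [← h2]
  exact ⟨fun h => ⟨h, fun i hi => absurd i.2 (not_lt.2 hi)⟩, fun h => h.1⟩

/-! Sorting. -/

lemma merge_perm {n : ℕ} (as bs : List (Label n)) : (merge as bs).val.Perm (as ++ bs) := by
  fun_induction merge as bs with
  | case1 bs => exact List.Perm.refl _
  | case2 a as => simp
  | case3 a as b bs ih1 ih2 =>
    by_cases h : index a ≤ index b
    · simp only [bind_val, op_val, h, decide_true, if_true]
      exact ih1.cons a
    · simp only [bind_val, op_val, h, decide_false]
      exact (ih2.cons b).trans (List.perm_middle (l₁ := a :: as)).symm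

lemma merge_sorted {n : ℕ} (as bs : List (Label n))
    (ha : as.Pairwise fun u v => index u ≤ index v) (hb : bs.Pairwise fun u v => index u ≤ index v) :
    (merge as bs).val.Pairwise fun u v => index u ≤ index v := by
  fun_induction merge as bs with
  | case1 bs => exact hb
  | case2 a as => exact ha
  | case3 a as b bs ih1 ih2 =>
    rw [List.pairwise_cons] at ha hb
    by_cases h : index a ≤ index b
    · simp only [bind_val, op_val, h, decide_true, if_true]
      refine List.pairwise_cons.2 ⟨fun v hv => ?_, ih1 ha.2 (List.pairwise_cons.2 hb)⟩
      have := (merge_perm as (b :: bs)).mem_iff.1 hv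
      simp only [List.mem_append, List.mem_cons] at this
      rcases this with h' | rfl | h'
      · exact ha.1 v h'
      · exact h
      · exact h.trans (hb.1 v h')
    · simp only [bind_val, op_val, h, decide_false]
      refine List.pairwise_cons.2 ⟨fun v hv => ?_, ih2 (List.pairwise_cons.2 ha) hb.2⟩
      have := (merge_perm (a :: as) bs).mem_iff.1 hv
      simp only [List.mem_append, List.mem_cons] at this
      rcases this with (rfl | h') | h'
      · omega
      · have := ha.1 v h'; omega
      · exact hb.1 v h'

lemma mergeSort_perm {n : ℕ} : ∀ (d : ℕ) (l : List (Label n)), (mergeSort d l).val.Perm l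
  | 0, l => List.Perm.refl _
  | d + 1, l => by
    by_cases h : l.length ≤ 1
    · simp [mergeSort, h]
    · simp only [mergeSort, bind_val, op_val, h, decide_false, List.splitAt_eq]
      refine (merge_perm _ _).trans ?_
      refine ((mergeSort_perm d _).append (mergeSort_perm d _)).trans ?_
      exact List.Perm.of_eq (List.take_append_drop _ _)

/-- The parameter `d` limits the depth of recursion; the length bound guarantees that lists are down
to at most one element when it runs out. -/
lemma mergeSort_sorted {n : ℕ} : ∀ (d : ℕ) (l : List (Label n)), l.length ≤ 2 ^ d →
    (mergeSort d l).val.Pairwise fun u v => index u ≤ index v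
  | 0, l, hl => by
    simp only [mergeSort, pure_val]
    match l, hl with
    | [], _ => simp
    | [a], _ => simp
    | _ :: _ :: _, h => simp at h
  | d + 1, l, hl => by
    by_cases h : l.length ≤ 1
    · simp only [mergeSort, bind_val, op_val, h, decide_true, if_true, pure_val]
      match l, h with
      | [], _ => simp
      | [a], _ => simp
      | _ :: _ :: _, h => simp at h
    · simp only [mergeSort, bind_val, op_val, h, decide_false, List.splitAt_eq]
      rw [pow_succ] at hl
      refine merge_sorted _ _ (mergeSort_sorted d _ ?_) (mergeSort_sorted d _ ?_)
      · refine List.length_take.trans_le ?_; omega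
      · refine List.length_drop.trans_le ?_; omega

/-! The support. -/

/-- The labels at which `ψ` does not vanish, in increasing order. -/
noncomputable def supportList {n : ℕ} (ψ : Vec n) : List (Label n) :=
  ((List.finRange (2 ^ n)).filter fun t : Fin (2 ^ n) =>
    decide (ψ (label t) ≠ 0)).map fun t : Fin (2 ^ n) => label t

lemma mem_supportList {n : ℕ} (ψ : Vec n) (w : Label n) : w ∈ supportList ψ ↔ ψ w ≠ 0 := by
  simp only [supportList, List.mem_map, List.mem_filter, List.mem_finRange, true_and,
    decide_eq_true_eq]
  constructor
  · rintro ⟨t, h, rfl⟩; exact h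
  · intro h
    obtain ⟨t, rfl⟩ := (label_bijective n).2 w
    exact ⟨t, h, rfl⟩

lemma supportList_nodup {n : ℕ} (ψ : Vec n) : (supportList ψ).Nodup :=
  ((List.nodup_finRange _).filter _).map (label_bijective n).1

lemma supportList_length {n : ℕ} (ψ : Vec n) : (supportList ψ).length ≤ 2 ^ n := by
  rw [← card_label n]
  exact (supportList_nodup ψ).length_le_card

lemma findSupport_shift {n : ℕ} (ψ : Vec n) :
    (findSupport ψ).val.shift = (supportList ψ).headD 0 := by
  simp only [findSupport, collect, mapList, bind_val, op_val, pure_val, supportList,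
    bind_pure_comp, List.map_eq_map, List.map_map]
  rfl

lemma findSupport_elements {n : ℕ} (ψ : Vec n) : (findSupport ψ).val.elements =
    (mergeSort n ((supportList ψ).map fun z => z + (findSupport ψ).val.shift)).val := by
  simp only [findSupport, collect, mapList, bind_val, op_val, pure_val, supportList,
    bind_pure_comp, List.map_eq_map, List.map_map]
  rfl

lemma findSupport_perm {n : ℕ} (ψ : Vec n) : (findSupport ψ).val.elements.Perm
    ((supportList ψ).map fun z => z + (findSupport ψ).val.shift) := by
  rw [findSupport_elements]; exact mergeSort_perm _ _

lemma findSupport_length_eq {n : ℕ} (ψ : Vec n) :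
    (findSupport ψ).val.elements.length = (supportList ψ).length := by
  rw [(findSupport_perm ψ).length_eq, List.length_map]

lemma findSupport_length_le {n : ℕ} (ψ : Vec n) :
    (findSupport ψ).val.elements.length ≤ 2 ^ n := by
  rw [findSupport_length_eq]; exact supportList_length ψ

lemma mem_findSupport {n : ℕ} (ψ : Vec n) (v : Label n) :
    v ∈ (findSupport ψ).val.elements ↔ ψ (v + (findSupport ψ).val.shift) ≠ 0 := by
  rw [(findSupport_perm ψ).mem_iff, List.mem_map]
  constructor
  · rintro ⟨z, hz, rfl⟩
    rw [label_add_add_cancel]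
    exact (mem_supportList ψ z).1 hz
  · intro h
    exact ⟨_, (mem_supportList ψ _).2 h, label_add_add_cancel _ _⟩

lemma findSupport_nodup {n : ℕ} (ψ : Vec n) : (findSupport ψ).val.elements.Nodup :=
  (findSupport_perm ψ).nodup_iff.2 ((supportList_nodup ψ).map (add_left_injective _))

lemma findSupport_sorted {n : ℕ} (ψ : Vec n) :
    (findSupport ψ).val.elements.Pairwise fun u v => index u < index v := by
  have h1 : (findSupport ψ).val.elements.Pairwise fun u v => index u ≤ index v := by
    rw [findSupport_elements]
    exact mergeSort_sorted _ _ (by rw [List.length_map]; exact supportList_length ψ)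
  refine (h1.and (findSupport_nodup ψ)).imp fun {u v} h => ?_
  exact lt_of_le_of_ne h.1 fun he => h.2 (index_injective n he)

/-- The default value of the shift occurs only for empty support. -/
lemma findSupport_shift_ne {n : ℕ} {ψ : Vec n} (h : (findSupport ψ).val.elements ≠ []) :
    ψ (findSupport ψ).val.shift ≠ 0 := by
  rw [findSupport_shift]
  have hne : supportList ψ ≠ [] := by
    intro h0
    apply h
    rw [← List.length_eq_zero_iff, findSupport_length_eq, h0, List.length_nil]
  obtain ⟨a, l, hal⟩ := List.exists_cons_of_ne_nil hne
  rw [← mem_supportList, hal]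
  simp

/-- If the support is an affine subspace, its sorted shift is listed by the combinations of the
elements whose positions are powers of two. -/
lemma exists_basis_of_support {n : ℕ} {ψ : Vec n} (V : Submodule (ZMod 2) (Label n)) {z₀ : Label n}
    (hz₀ : ψ z₀ ≠ 0) (hsupp : ∀ w, ψ w ≠ 0 ↔ w + z₀ ∈ V) :
    ∃ (k : ℕ) (b : Fin k → Label n), (findSupport ψ).val.elements.length = 2 ^ k ∧
      (∀ t < 2 ^ k, (findSupport ψ).val.elements.getD t 0 = comb (label t) b) ∧
      (∀ v, v ∈ V ↔ ∃ x, comb x b = v) := by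
  obtain ⟨k, b, hmono, hmem⟩ := exists_increasing_basis V
  have hne : (findSupport ψ).val.elements ≠ [] := by
    intro h0
    have := (mem_findSupport ψ (z₀ + (findSupport ψ).val.shift)).2
      (by rwa [label_add_add_cancel])
    rw [h0] at this
    simp at this
  have hs := (hsupp _).1 (findSupport_shift_ne hne)
  set L := (List.range (2 ^ k)).map fun t => comb (label t : Label k) b with hL
  have hLs : L.Pairwise fun u v => index u < index v := by
    rw [hL, List.pairwise_map, List.pairwise_iff_getElem]
    intro i j hi hj hij
    simp only [List.length_range] at hi hj
    simpa using hmono i j hij hj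
  have hirr : ∀ {l : List (Label n)}, (l.Pairwise fun u v => index u < index v) → l.Nodup :=
    fun h => h.imp fun {u v} huv he => by rw [he] at huv; exact lt_irrefl _ huv
  -- The shift that is found lies in the same coset as `z₀`, so subtracting it also turns the
  -- support into `V`.
  have hperm : (findSupport ψ).val.elements.Perm L := by
    refine (List.perm_ext_iff_of_nodup (findSupport_nodup ψ) (hirr hLs)).2 fun v => ?_
    rw [mem_findSupport, hsupp, add_assoc, V.add_mem_iff_left hs, hmem, hL, List.mem_map]
    simp
  -- Two strictly increasing lists with the same elements coincide.
  have heq : (findSupport ψ).val.elements = L :=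
    hperm.eq_of_pairwise (fun u v _ _ h1 h2 => absurd h1 (not_lt.2 h2.le))
      (findSupport_sorted ψ) hLs
  refine ⟨k, b, by simp [heq, hL], fun t ht => ?_, fun v => ?_⟩
  · rw [heq, hL]
    simp [List.getD_eq_getElem?_getD, ht]
  · rw [hmem]
    constructor
    · rintro ⟨t, -, h⟩; exact ⟨_, h⟩
    · rintro ⟨x, h⟩
      obtain ⟨t, ht, rfl⟩ := exists_label x
      exact ⟨t, ht, h⟩

/-! Quadratic phase functions. -/

/-- The power `i^a` of a bit `a`. -/
noncomputable def ibit (a : ZMod 2) : ℂ := Complex.I ^ a.val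

@[simp] lemma ibit_zero : ibit 0 = 1 := by simp [ibit]

@[simp] lemma ibit_one : ibit 1 = Complex.I := by simp [ibit, ZMod.val_one]

/-- The sign is the carry: `1 + 1 = 0` for bits, whereas `i · i = -1`. -/
lemma ibit_add (a b : ZMod 2) : ibit (a + b) = ibit a * ibit b * sgn (a * b) := by
  rcases bit_cases a with rfl | rfl <;> rcases bit_cases b with rfl | rfl <;> simp [bit_add_self]

lemma ipow_three_mul_val_mul_ibit (d : ZMod 2) : ipow (3 * (d.val : ZMod 4)) * ibit d = 1 := by
  rcases bit_cases d with rfl | rfl <;> simp [ZMod.val_one]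

lemma ibit_ne_zero (a : ZMod 2) : ibit a ≠ 0 := by simp [ibit]

/-- The value at `x` of the quadratic form with coefficients `Q`. -/
def quadForm {k : ℕ} (Q : Fin k → Fin k → ZMod 2) (x : Label k) : ZMod 2 :=
  x ⬝ᵥ fun i => Q i ⬝ᵥ x

lemma quadForm_add {k : ℕ} (Q : Fin k → Fin k → ZMod 2) (x y : Label k) :
    quadForm Q (x + y) = quadForm Q x + quadForm Q y +
      ((x ⬝ᵥ fun i => Q i ⬝ᵥ y) + (y ⬝ᵥ fun i => Q i ⬝ᵥ x)) := by
  have : (fun i => Q i ⬝ᵥ (x + y)) = (fun i => Q i ⬝ᵥ x) + fun i => Q i ⬝ᵥ y := by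
    ext i; simp [dotProduct_add]
  unfold quadForm
  rw [this, dotProduct_add, add_dotProduct, add_dotProduct]
  ring

@[simp] lemma quadForm_zero {k : ℕ} (Q : Fin k → Fin k → ZMod 2) : quadForm Q 0 = 0 := by
  simp [quadForm]

@[simp] lemma quadForm_unitVec {k : ℕ} (Q : Fin k → Fin k → ZMod 2) (i : Fin k) :
    quadForm Q (unitVec i) = Q i i := by
  simp [quadForm]

/-- The function `(-1)^Q(x) i^ℓ(x)`. -/
noncomputable def phase {k : ℕ} (ell : Label k) (Q : Fin k → Fin k → ZMod 2) (x : Label k) : ℂ :=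
  sgn (quadForm Q x) * ibit (x ⬝ᵥ ell)

/-- The bilinear form that belongs to the phase function. -/
def polar {k : ℕ} (ell : Label k) (Q : Fin k → Fin k → ZMod 2) (i j : Fin k) : ZMod 2 :=
  Q i j + Q j i + ell i * ell j

lemma phase_zero {k : ℕ} (ell : Label k) (Q : Fin k → Fin k → ZMod 2) : phase ell Q 0 = 1 := by
  simp [phase]

lemma phase_unitVec {k : ℕ} (ell : Label k) (Q : Fin k → Fin k → ZMod 2) (i : Fin k) :
    phase ell Q (unitVec i) = sgn (Q i i) * ibit (ell i) := by
  simp [phase]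

/-- The sign combines the polarisation of `Q` with the carry `ℓ(x) ℓ(e_i)` from `ibit_add`. This is
the reason for the product of values of `ℓ` in `polar`. -/
lemma phase_add {k : ℕ} (ell : Label k) (Q : Fin k → Fin k → ZMod 2) (x : Label k) (i : Fin k) :
    phase ell Q (x + unitVec i) =
      phase ell Q x * phase ell Q (unitVec i) * sgn (polar ell Q i ⬝ᵥ x) := by
  have h : polar ell Q i ⬝ᵥ x =
      (x ⬝ᵥ fun j => Q j i) + Q i ⬝ᵥ x + (x ⬝ᵥ ell) * ell i := by
    simp only [polar, dotProduct, Finset.sum_mul, ← Finset.sum_add_distrib]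
    exact Finset.sum_congr rfl fun j _ => by ring
  simp only [phase, quadForm_add, h, add_dotProduct, unitVec_dotProduct, dotProduct_unitVec,
    ibit_add, sgn_add, quadForm_unitVec]
  ring

lemma phase_ne_zero {k : ℕ} (ell : Label k) (Q : Fin k → Fin k → ZMod 2) (x : Label k) :
    phase ell Q x ≠ 0 := mul_ne_zero (sgn_ne_zero _) (ibit_ne_zero _)

lemma norm_phase {k : ℕ} (ell : Label k) (Q : Fin k → Fin k → ZMod 2) (x : Label k) :
    ‖phase ell Q x‖ = 1 := by
  simp [phase, sgn, ibit]

/-- Functions that are multiplicative up to the signs of a bilinear form. -/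
def IsQuadratic {k : ℕ} (f : Label k → ℂ) : Prop :=
  f 0 = 1 ∧ ∀ i, ∃ β : Label k, ∀ x, f (x + unitVec i) = f x * f (unitVec i) * sgn (β ⬝ᵥ x)

lemma phase_isQuadratic {k : ℕ} (ell : Label k) (Q : Fin k → Fin k → ZMod 2) :
    IsQuadratic (phase ell Q) :=
  ⟨phase_zero ell Q, fun i => ⟨_, fun x => phase_add ell Q x i⟩⟩

/-- Take `x = e_i` in the functional equation and use `e_i + e_i = 0` and `f 0 = 1`. So values at
unit vectors are fourth roots of unity. -/
lemma IsQuadratic.mul_self {k : ℕ} {f : Label k → ℂ} (hf : IsQuadratic f) (i : Fin k) :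
    f (unitVec i) * f (unitVec i) = 1 ∨ f (unitVec i) * f (unitVec i) = -1 := by
  obtain ⟨β, hβ⟩ := hf.2 i
  have h := hβ (unitVec i)
  rw [label_add_self, hf.1, dotProduct_unitVec] at h
  rcases bit_cases (β i) with h' | h' <;> rw [h'] at h
  · left; simpa using h.symm
  · right; rw [sgn_one] at h; linear_combination h

lemma IsQuadratic.ne_zero {k : ℕ} {f : Label k → ℂ} (hf : IsQuadratic f) (i : Fin k) :
    f (unitVec i) ≠ 0 := by
  intro h
  rcases hf.mul_self i with h' | h' <;> simp [h] at h'

/-- The values at `e_i`, `e_j` and `e_i + e_j` determine the `j`-th bit of `β_i`; then the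
functional equation yields all other values by induction over unit vectors. -/
lemma IsQuadratic.ext {k : ℕ} {f g : Label k → ℂ} (hf : IsQuadratic f) (hg : IsQuadratic g)
    (h1 : ∀ i, f (unitVec i) = g (unitVec i))
    (h2 : ∀ i j, i < j → f (unitVec i + unitVec j) = g (unitVec i + unitVec j)) (x : Label k) :
    f x = g x := by
  choose β hβ using hf.2
  choose γ hγ using hg.2
  have h2' : ∀ i j, f (unitVec j + unitVec i) = g (unitVec j + unitVec i) := fun i j => by
    rcases lt_trichotomy i j with h | rfl | h
    · rw [add_comm]; exact h2 i j h
    · rw [label_add_self, hf.1, hg.1]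
    · exact h2 j i h
  have hβγ : ∀ i, β i = γ i := fun i => funext fun j => by
    have h := h2' i j
    rw [hβ, hγ, h1, h1, dotProduct_unitVec, dotProduct_unitVec] at h
    exact sgn_injective (mul_left_cancel₀ (mul_ne_zero (hg.ne_zero j) (hg.ne_zero i)) h)
  induction x using label_induction with
  | h0 => rw [hf.1, hg.1]
  | hs x i ih => rw [hβ, hγ, ih, h1, hβγ]

/-! Affine subspace triples of states. -/

/-- `ψ` is the vector, up to a factor, that is given by an affine subspace triple. -/
structure Represents {n : ℕ} (T : AffineTriple n) (ψ : Vec n) : Prop where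
  inj : ∀ x, comb x T.basis = 0 → x = 0
  shift_ne : ψ T.shift ≠ 0
  supp : ∀ w, ψ w ≠ 0 → ∃ x, w = comb x T.basis + T.shift
  amp : ∀ x, ψ (comb x T.basis + T.shift) = phase T.ell T.quad x * ψ T.shift

/-- The support has `2^k` elements, and all amplitudes on it have the modulus of the one at the
shift. -/
lemma Represents.sum_norm {n : ℕ} {T : AffineTriple n} {ψ : Vec n} (h : Represents T ψ) :
    ∑ z, ‖ψ z‖ ^ 2 = 2 ^ T.k * ‖ψ T.shift‖ ^ 2 := by
  have hinj : Function.Injective fun x => comb x T.basis + T.shift :=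
    (add_left_injective _).comp (comb_injective h.inj)
  rw [← Finset.sum_subset (Finset.subset_univ (Finset.univ.map ⟨_, hinj⟩))]
  · rw [Finset.sum_map]
    simp [h.amp, norm_phase]
  · intro z _ hz
    by_contra hne
    obtain ⟨x, rfl⟩ := h.supp z fun h0 => hne (by simp [h0])
    exact hz (by simp)

lemma Represents.normalised_iff {n : ℕ} {T : AffineTriple n} {ψ : Vec n} (h : Represents T ψ) :
    (2 : ℂ) ^ T.k * (ψ T.shift * star (ψ T.shift)) = 1 ↔ ∑ z, ‖ψ z‖ ^ 2 = 1 := by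
  rw [h.sum_norm, Complex.star_def, Complex.mul_conj']
  norm_cast

lemma label_two_pow {k : ℕ} (i : Fin k) : (label (2 ^ (i : ℕ)) : Label k) = unitVec i := by
  ext j
  rw [label_apply, unitVec_apply, Nat.testBit_two_pow]
  by_cases h : (i : ℕ) = j
  · simp [Fin.ext h]
  · have : j ≠ i := fun h' => h (by rw [h'])
    simp [h, this]

@[simp] lemma label_zero {k : ℕ} : (label 0 : Label k) = 0 := by
  ext j; simp [label_apply]

lemma stateToTriple_val {n : ℕ} (ψ : Vec n) :
    (stateToTriple ψ).val = (readTriple ψ (findSupport ψ).val).val := rfl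

lemma verify_val {n : ℕ} (ψ : Vec n) : (verifyStabiliserState ψ).val = true ↔
    (findSupport ψ).val.elements.length = 2 ^ (stateToTriple ψ).val.k ∧
    (∀ t : Fin (2 ^ (stateToTriple ψ).val.k),
      (findSupport ψ).val.elements.getD t 0 = comb (label t) (stateToTriple ψ).val.basis) ∧
    (∀ t : Fin (2 ^ (stateToTriple ψ).val.k),
      ψ (comb (label t) (stateToTriple ψ).val.basis + (stateToTriple ψ).val.shift) =
        phase (stateToTriple ψ).val.ell (stateToTriple ψ).val.quad (label t) *
          ψ (stateToTriple ψ).val.shift) ∧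
    (2 : ℂ) ^ (stateToTriple ψ).val.k *
      (ψ (stateToTriple ψ).val.shift * star (ψ (stateToTriple ψ).val.shift)) = 1 := by
  have hs : (stateToTriple ψ).val.shift = (findSupport ψ).val.shift := rfl
  simp only [verifyStabiliserState, bind_val, op_val, ops_val, Bool.and_eq_true, allOver_val,
    decide_eq_true_eq, ← stateToTriple_val, and_assoc, hs]
  refine and_congr decide_eq_true_iff (and_congr Iff.rfl (and_congr (forall_congr' fun t => ?_)
    decide_eq_true_iff))
  unfold phase
  rw [mul_assoc]
  exact decide_eq_true_iff

lemma findSupport_getD_injOn {n : ℕ} {ψ : Vec n} {s t : ℕ}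
    (hs : s < (findSupport ψ).val.elements.length) (ht : t < (findSupport ψ).val.elements.length)
    (h : (findSupport ψ).val.elements.getD s 0 = (findSupport ψ).val.elements.getD t 0) :
    s = t := by
  rw [List.getD_eq_getElem _ _ hs, List.getD_eq_getElem _ _ ht] at h
  exact (findSupport_nodup ψ).getElem_inj_iff.1 h

/-- The sorted list has no repetitions, so a list of length `2^k` that is enumerated by all
combinations forces distinct coefficients to give distinct vectors. -/
lemma inj_of_getD {n k : ℕ} {ψ : Vec n} {b : Fin k → Label n}
    (hlen : (findSupport ψ).val.elements.length = 2 ^ k)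
    (h : ∀ t < 2 ^ k, (findSupport ψ).val.elements.getD t 0 = comb (label t) b)
    (x : Label k) (hx : comb x b = 0) : x = 0 := by
  obtain ⟨t, ht, rfl⟩ := exists_label x
  have h0 : t = 0 := findSupport_getD_injOn (by rwa [hlen]) (by rw [hlen]; positivity)
    (by rw [h t ht, h 0 (by positivity), hx, label_zero, zero_comb])
  rw [h0, label_zero]

/-- Soundness of the checks: the enumeration places the support inside the affine subspace and makes
the basis independent, and the amplitude checks cover every point of that subspace. -/
lemma represents_of_verify {n : ℕ} {ψ : Vec n} (h : (verifyStabiliserState ψ).val = true) :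
    Represents (stateToTriple ψ).val ψ ∧ ∑ z, ‖ψ z‖ ^ 2 = 1 := by
  obtain ⟨hlen, haff, hamp, hnorm⟩ := (verify_val ψ).1 h
  have hne : (findSupport ψ).val.elements ≠ [] := by
    intro h0
    rw [h0, List.length_nil] at hlen
    exact absurd hlen.symm (by positivity)
  have hR : Represents (stateToTriple ψ).val ψ := by
    refine ⟨inj_of_getD hlen fun t ht => haff ⟨t, ht⟩, findSupport_shift_ne hne, fun w hw => ?_,
      fun x => ?_⟩
    · have hmem : w + (findSupport ψ).val.shift ∈ (findSupport ψ).val.elements := by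
        rw [mem_findSupport, label_add_add_cancel]
        exact hw
      obtain ⟨t, ht, hwt⟩ := List.getElem_of_mem hmem
      have h1 := haff ⟨t, by rwa [← hlen]⟩
      rw [List.getD_eq_getElem _ _ ht, hwt] at h1
      exact ⟨_, (label_add_eq_iff _ _ _).1 h1⟩
    · obtain ⟨t, ht, rfl⟩ := exists_label x
      exact hamp ⟨t, ht⟩
  exact ⟨hR, hR.normalised_iff.1 hnorm⟩

/-- The candidate basis is the increasing one of `exists_basis_of_support`: the logarithm recovers
`k` from the length `2^k`, and the combination at position `2^i` is the `i`-th basis vector. -/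
lemma exists_basis_of_stateToTriple {n : ℕ} {ψ : Vec n} (V : Submodule (ZMod 2) (Label n))
    {z₀ : Label n} (hz₀ : ψ z₀ ≠ 0) (hsupp : ∀ w, ψ w ≠ 0 ↔ w + z₀ ∈ V) :
    (findSupport ψ).val.elements.length = 2 ^ (stateToTriple ψ).val.k ∧
      (∀ t < 2 ^ (stateToTriple ψ).val.k,
        (findSupport ψ).val.elements.getD t 0 = comb (label t) (stateToTriple ψ).val.basis) ∧
      (∀ v, v ∈ V ↔ ∃ x, comb x (stateToTriple ψ).val.basis = v) := by
  obtain ⟨k, b, hlen, hget, hV⟩ := exists_basis_of_support V hz₀ hsupp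
  have hk : (stateToTriple ψ).val.k = Nat.log 2 (findSupport ψ).val.elements.length := rfl
  rw [hlen, Nat.log_pow (by norm_num)] at hk
  subst hk
  have hb : (stateToTriple ψ).val.basis = b := funext fun i => by
    have h1 : (stateToTriple ψ).val.basis i =
      (findSupport ψ).val.elements.getD (2 ^ (i : ℕ)) 0 := rfl
    rw [h1, hget _ (Nat.pow_lt_pow_right (by norm_num) i.2), label_two_pow, unitVec_comb]
  rw [hb]
  exact ⟨hlen, hget, hV⟩

lemma verify_of_represents {n : ℕ} {ψ : Vec n} (h : Represents (stateToTriple ψ).val ψ)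
    (hnorm : ∑ z, ‖ψ z‖ ^ 2 = 1) : (verifyStabiliserState ψ).val = true := by
  let V : Submodule (ZMod 2) (Label n) := Submodule.span _ (Set.range (stateToTriple ψ).val.basis)
  have hV : ∀ v, v ∈ V ↔ ∃ x, comb x (stateToTriple ψ).val.basis = v := fun v => by
    rw [Submodule.mem_span_range_iff_exists_fun]
    refine exists_congr fun x => ?_
    rw [← (show ∑ i, x i • (stateToTriple ψ).val.basis i = comb x (stateToTriple ψ).val.basis by
      ext c; simp [comb])]
  obtain ⟨h1, h2, -⟩ := exists_basis_of_stateToTriple V h.shift_ne fun w => by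
    rw [hV]
    constructor
    · intro hw
      obtain ⟨x, rfl⟩ := h.supp w hw
      exact ⟨x, by rw [label_add_add_cancel]⟩
    · rintro ⟨x, hx⟩
      rw [← (label_add_eq_iff _ _ _).2 hx, h.amp]
      exact mul_ne_zero (phase_ne_zero _ _ _) h.shift_ne
  exact (verify_val ψ).2 ⟨h1, fun t => h2 t t.2, fun t => h.amp _, h.normalised_iff.2 hnorm⟩

/-! ### Reading off the linear and the quadratic form. -/

/-- The amplitude at a combination of basis vectors relative to the first nonzero amplitude. -/
noncomputable def ratio {n : ℕ} (ψ : Vec n) (x : Label (stateToTriple ψ).val.k) : ℂ :=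
  ψ (comb x (stateToTriple ψ).val.basis + (stateToTriple ψ).val.shift) /
    ψ (stateToTriple ψ).val.shift

/-- The diagonal coefficients of the quadratic form that is read off. -/
noncomputable def readDiag {n : ℕ} (ψ : Vec n) (i : Fin (stateToTriple ψ).val.k) : ZMod 2 :=
  if ψ ((stateToTriple ψ).val.basis i + (stateToTriple ψ).val.shift) /
    ψ (stateToTriple ψ).val.shift = Complex.I ^ ((stateToTriple ψ).val.ell i).val then 0 else 1

lemma readDiag_eq {n : ℕ} (ψ : Vec n) (i : Fin (stateToTriple ψ).val.k) :
    readDiag ψ i = if ratio ψ (unitVec i) = ibit ((stateToTriple ψ).val.ell i) then 0 else 1 := by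
  unfold ratio
  rw [unitVec_comb]
  rfl

lemma stateToTriple_ell {n : ℕ} (ψ : Vec n) (i : Fin (stateToTriple ψ).val.k) :
    (stateToTriple ψ).val.ell i = if ratio ψ (unitVec i) = Complex.I ∨
      ratio ψ (unitVec i) = -Complex.I then 1 else 0 := by
  unfold ratio
  rw [unitVec_comb]
  rfl

lemma stateToTriple_quad {n : ℕ} (ψ : Vec n) (i j : Fin (stateToTriple ψ).val.k) :
    (stateToTriple ψ).val.quad i j = if i = j then readDiag ψ i else if j < i then 0 else
      (if ratio ψ (unitVec i + unitVec j) =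
        ibit ((stateToTriple ψ).val.ell i + (stateToTriple ψ).val.ell j) then 0 else 1)
        + readDiag ψ i + readDiag ψ j := by
  have h : (stateToTriple ψ).val.quad i j = (if i = j then op (readDiag ψ i)
    else if j < i then op 0
    else do
      let z ← vadd ((stateToTriple ψ).val.basis i) ((stateToTriple ψ).val.basis j)
      let z ← vadd z (stateToTriple ψ).val.shift
      let a ← op (ψ z)
      let r ← op (a / ψ (stateToTriple ψ).val.shift)
      let l ← op ((stateToTriple ψ).val.ell i + (stateToTriple ψ).val.ell j)
      let b ← op (if r = Complex.I ^ l.val then (0 : ZMod 2) else 1)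
      op (b + readDiag ψ i + readDiag ψ j)).val := rfl
  rw [h]
  unfold ratio
  rw [add_comb, unitVec_comb, unitVec_comb]
  by_cases hij : i = j
  · rw [if_pos hij, if_pos hij, op_val]
  · rw [if_neg hij, if_neg hij]
    by_cases hji : j < i
    · rw [if_pos hji, if_pos hji, op_val]
    · rw [if_neg hji, if_neg hji]
      rfl

lemma sq_cases {a : ℂ} (h : a * a = 1 ∨ a * a = -1) :
    a = 1 ∨ a = -1 ∨ a = Complex.I ∨ a = -Complex.I := by
  rcases h with h | h
  · rcases mul_self_eq_one_iff.1 h with h | h <;> simp [h]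
  · rcases mul_self_eq_mul_self_iff.1 (h.trans Complex.I_mul_I.symm) with h | h <;> simp [h]

/-- The forms that are read off from the amplitudes agree with them. -/
lemma ratio_eq_phase {n : ℕ} {ψ : Vec n} (hf : IsQuadratic (ratio ψ))
    (x : Label (stateToTriple ψ).val.k) :
    ratio ψ x = phase (stateToTriple ψ).val.ell (stateToTriple ψ).val.quad x := by
  have hI1 : Complex.I ≠ 1 := fun h => by simpa using congrArg Complex.re h
  have hI2 : -Complex.I ≠ 1 := fun h => by simpa using congrArg Complex.re h
  have hI3 : Complex.I ≠ -1 := fun h => by simpa using congrArg Complex.re h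
  have hI4 : -Complex.I ≠ Complex.I := fun h => by
    have := congrArg Complex.im h
    norm_num at this
  have hone : (-1 : ℂ) ≠ 1 := by norm_num
  -- The ratio is one of `±1`, `±i`; `ℓ` records whether it is imaginary and the diagonal
  -- coefficient records its sign.
  have h1 : ∀ i, ratio ψ (unitVec i) =
      sgn (readDiag ψ i) * ibit ((stateToTriple ψ).val.ell i) := fun i => by
    rw [readDiag_eq, stateToTriple_ell]
    rcases sq_cases (hf.mul_self i) with h | h | h | h <;> rw [h] <;>
      simp [hI1.symm, hI2.symm, hI4, hone, hI3.symm]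
  refine hf.ext (phase_isQuadratic _ _) (fun i => ?_) (fun i j hij => ?_) x
  · rw [h1, phase_unitVec, stateToTriple_quad, if_pos rfl]
  · have hq : ∀ i, (stateToTriple ψ).val.quad i i = readDiag ψ i := fun i => by
      rw [stateToTriple_quad, if_pos rfl]
    have hji : (stateToTriple ψ).val.quad j i = 0 := by
      rw [stateToTriple_quad, if_neg hij.ne', if_pos hij]
    obtain ⟨β, hβ⟩ := hf.2 j
    -- A priori only a sign is unknown at `e_i + e_j`, so a single equality test determines it.
    obtain ⟨s, hs⟩ : ∃ s, ratio ψ (unitVec i + unitVec j) =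
        sgn s * ibit ((stateToTriple ψ).val.ell i + (stateToTriple ψ).val.ell j) := by
      refine ⟨readDiag ψ i + readDiag ψ j + β i +
        (stateToTriple ψ).val.ell i * (stateToTriple ψ).val.ell j, ?_⟩
      rw [hβ, h1, h1, dotProduct_unitVec, ibit_add, sgn_add, sgn_add, sgn_add]
      linear_combination -(sgn (readDiag ψ i) * ibit ((stateToTriple ψ).val.ell i) *
        sgn (readDiag ψ j) * ibit ((stateToTriple ψ).val.ell j) * sgn (β i)) *
        sgn_mul_self ((stateToTriple ψ).val.ell i * (stateToTriple ψ).val.ell j)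
    have hs' : (if ratio ψ (unitVec i + unitVec j) =
        ibit ((stateToTriple ψ).val.ell i + (stateToTriple ψ).val.ell j) then (0 : ZMod 2) else 1)
        = s := by
      rw [hs]
      rcases bit_cases s with rfl | rfl
      · simp
      · rw [if_neg]
        rw [sgn_one, neg_one_mul]
        exact neg_ne_self.2 (ibit_ne_zero _)
    have hqij := stateToTriple_quad ψ i j
    rw [if_neg hij.ne, if_neg (not_lt.2 hij.le), hs'] at hqij
    -- The two diagonal coefficients added to the off-diagonal one cancel the diagonal contributions
    -- to the value at `e_i + e_j`.
    have hQ : quadForm (stateToTriple ψ).val.quad (unitVec i + unitVec j) = s := by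
      rw [quadForm_add]
      simp only [quadForm_unitVec, hq, unitVec_dotProduct, dotProduct_unitVec, hqij, hji]
      linear_combination bit_add_self (readDiag ψ i) + bit_add_self (readDiag ψ j)
    rw [hs, phase, hQ, add_dotProduct, unitVec_dotProduct, unitVec_dotProduct]

/-- A vector that is supported by a coset of `V` and fixed by Pauli gates with all elements of `V`
as their shifts is represented by the triple that is read off. -/
lemma represents_of_coset {n : ℕ} {ψ : Vec n} (V : Submodule (ZMod 2) (Label n))
    {z₀ : Label n} (hz₀ : ψ z₀ ≠ 0) (hsupp : ∀ w, ψ w ≠ 0 ↔ w + z₀ ∈ V)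
    (hstab : ∀ q ∈ V, ∃ P : Pauli n, P.q = q ∧ P.app ψ = ψ) :
    Represents (stateToTriple ψ).val ψ := by
  obtain ⟨hlen, hget, hV⟩ := exists_basis_of_stateToTriple V hz₀ hsupp
  have hne : (findSupport ψ).val.elements ≠ [] := by
    intro h0
    rw [h0, List.length_nil] at hlen
    exact absurd hlen.symm (by positivity)
  have hs : ψ (stateToTriple ψ).val.shift ≠ 0 := findSupport_shift_ne hne
  have hsV := (hsupp _).1 hs
  refine ⟨inj_of_getD hlen hget, hs, fun w hw => ?_, fun x => ?_⟩
  · have h1 : w + (stateToTriple ψ).val.shift ∈ V := by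
      have := V.add_mem ((hsupp _).1 hw) hsV
      rwa [add_add_add_comm, label_add_self, add_zero] at this
    obtain ⟨x, hx⟩ := (hV _).1 h1
    exact ⟨x, (label_add_eq_iff _ _ _).1 hx.symm⟩
  · rw [← div_eq_iff hs]
    refine ratio_eq_phase ⟨?_, fun i => ?_⟩ x
    · unfold ratio
      rw [zero_comb, zero_add, div_self hs]
    · obtain ⟨P, hPq, hP⟩ := hstab _ ((hV _).2 ⟨unitVec i, rfl⟩)
      rw [unitVec_comb] at hPq
      refine ⟨fun j => (stateToTriple ψ).val.basis j ⬝ᵥ P.p, fun y => ?_⟩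
      -- The equation `P ψ = ψ`, evaluated on the coset. Its sign is linear in `y`, which supplies
      -- the vector `β_i`.
      have h1 : ∀ y, ψ (comb y (stateToTriple ψ).val.basis + (stateToTriple ψ).val.shift) =
          ipow P.r * (sgn (P.p ⬝ᵥ (stateToTriple ψ).val.shift) *
          sgn (y ⬝ᵥ fun j => (stateToTriple ψ).val.basis j ⬝ᵥ P.p)) *
          ψ (comb (y + unitVec i) (stateToTriple ψ).val.basis + (stateToTriple ψ).val.shift) := by
        intro y
        refine (congrFun hP _).symm.trans ?_
        rw [Pauli.app, dotProduct_add, dotProduct_comm P.p, comb_dotProduct, sgn_add, hPq, add_comb,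
          unitVec_comb, add_right_comm]
        ring
      -- The case `y = 0` eliminates the unknown scalar of the gate.
      have h2 := h1 0
      rw [zero_comb, zero_add, zero_add, zero_dotProduct, sgn_zero] at h2
      unfold ratio
      rw [h1 y, dotProduct_comm _ y]
      set u := y ⬝ᵥ fun j => (stateToTriple ψ).val.basis j ⬝ᵥ P.p
      set v := P.p ⬝ᵥ (stateToTriple ψ).val.shift
      set a := ψ (comb (y + unitVec i) (stateToTriple ψ).val.basis + (stateToTriple ψ).val.shift)
      set b := ψ (comb (unitVec i) (stateToTriple ψ).val.basis + (stateToTriple ψ).val.shift)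
      set c := ψ (stateToTriple ψ).val.shift
      field_simp
      rw [pow_two, sgn_mul_self]
      linear_combination a * h2

/-! Stabiliser groups. -/

lemma Pauli.toMat_comm {n : ℕ} (A B : Pauli n) (h : A.omega B = 0) :
    A.toMat * B.toMat = B.toMat * A.toMat :=
  mat_ext_mulVec fun ψ => by
    rw [← Matrix.mulVec_mulVec, ← Matrix.mulVec_mulVec, Pauli.toMat_mulVec, Pauli.toMat_mulVec,
      Pauli.toMat_mulVec, Pauli.toMat_mulVec, Pauli.app_comm, h, sgn_zero, one_smul]

/-- The gate `-P`. -/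
def Pauli.neg {n : ℕ} (P : Pauli n) : Pauli n := ⟨P.p, P.q, P.r + 2⟩

lemma Pauli.app_neg {n : ℕ} (P : Pauli n) (ψ : Vec n) : P.neg.app ψ = -P.app ψ := by
  ext w
  simp [Pauli.app, Pauli.neg, ipow_add]

lemma Pauli.toMat_neg {n : ℕ} (P : Pauli n) : P.neg.toMat = -P.toMat := by
  simp [Pauli.toMat, Pauli.neg, ipow_add]

/-- A Pauli gate as a unitary. -/
noncomputable def Pauli.toUnitary {n : ℕ} (P : Pauli n) : Matrix.unitaryGroup (Label n) ℂ :=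
  ⟨P.toMat, P.toMat_mem_unitary⟩

lemma Pauli.toUnitary_mem {n : ℕ} (P : Pauli n) : P.toUnitary ∈ pauliGroup n :=
  (mem_pauliGroup_iff _).2 ⟨P, rfl⟩

/-- A unit vector that is determined up to a factor by the Pauli gates that fix it is a
stabiliser state. -/
lemma isStabiliserState_of_fixed {n : ℕ} {ψ : Vec n} (hnorm : ∑ z, ‖ψ z‖ ^ 2 = 1)
    (hfix : ∀ φ : Vec n, (∀ P : Pauli n, P.app ψ = ψ → P.app φ = φ) → ∃ a : ℂ, φ = a • ψ) :
    IsStabiliserState ψ := by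
  have hψ : ψ ≠ 0 := by
    rintro rfl
    simp at hnorm
  have hne : ψ ≠ -ψ := fun h => hψ (self_eq_neg.1 h)
  -- All Pauli gates that fix ψ.
  let S : Subgroup (Matrix.unitaryGroup (Label n) ℂ) :=
    { carrier := {A | A ∈ pauliGroup n ∧ (A : Mat n).mulVec ψ = ψ}
      mul_mem' := by
        rintro A B ⟨hA, hA'⟩ ⟨hB, hB'⟩
        refine ⟨mul_mem hA hB, ?_⟩
        rw [Matrix.UnitaryGroup.mul_val, ← Matrix.mulVec_mulVec, hB', hA']
      one_mem' := ⟨one_mem _, by simp⟩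
      inv_mem' := by
        rintro A ⟨hA, hA'⟩
        refine ⟨inv_mem hA, ?_⟩
        conv_lhs => rw [← hA']
        rw [Matrix.mulVec_mulVec, ← Matrix.UnitaryGroup.mul_val, inv_mul_cancel,
          Matrix.UnitaryGroup.one_val, Matrix.one_mulVec] }
  have hS : ∀ A, A ∈ S ↔ A ∈ pauliGroup n ∧ (A : Mat n).mulVec ψ = ψ := fun A => Iff.rfl
  refine ⟨hnorm, S, ⟨⟨fun A hA => hA.1, ?_, ?_⟩, ?_⟩, fun A hA => hA.2⟩
  · intro A hA B hB
    obtain ⟨P, hP⟩ := (mem_pauliGroup_iff A).1 hA.1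
    obtain ⟨Q, hQ⟩ := (mem_pauliGroup_iff B).1 hB.1
    have hA' := hA.2
    have hB' := hB.2
    rw [hP, Pauli.toMat_mulVec] at hA'
    rw [hQ, Pauli.toMat_mulVec] at hB'
    apply Subtype.ext
    rw [Matrix.UnitaryGroup.mul_val, Matrix.UnitaryGroup.mul_val, hP, hQ]
    refine Pauli.toMat_comm _ _ ((bit_cases _).resolve_right fun h1 => hne ?_)
    have := Pauli.app_comm P Q ψ
    rw [hB', hA', hB', h1, sgn_one, neg_one_smul] at this
    exact this
  · intro A hA h
    have := hA.2
    rw [h, Matrix.neg_mulVec, Matrix.one_mulVec] at this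
    exact hne this.symm
  -- A gate `A` of a larger abelian group maps ψ to a vector fixed by all gates in `S`, hence to `a
  -- ψ`. It remains to exclude every value of `a` except one.
  · intro S' hS' hle A hA
    obtain ⟨P, hP⟩ := (mem_pauliGroup_iff A).1 (hS'.1 hA)
    have hcomm : ∀ Q : Pauli n, Q.app ψ = ψ → Q.app (P.app ψ) = P.app ψ := by
      intro Q hQ
      have hQS : Q.toUnitary ∈ S' := hle ⟨Q.toUnitary_mem, by
        show Q.toMat.mulVec ψ = ψ
        rw [Pauli.toMat_mulVec, hQ]⟩
      have h1 := congrArg Subtype.val (hS'.2.1 _ hQS _ hA)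
      rw [Matrix.UnitaryGroup.mul_val, Matrix.UnitaryGroup.mul_val, hP] at h1
      have h2 := congrArg (fun M => Matrix.mulVec M ψ) h1
      simp only [Pauli.toUnitary, ← Matrix.mulVec_mulVec, Pauli.toMat_mulVec, hQ] at h2
      exact h2
    obtain ⟨a, ha⟩ := hfix _ hcomm
    have hAA : P.toMat * P.toMat ≠ -1 := by
      have := hS'.2.2 _ (mul_mem hA hA)
      rwa [Matrix.UnitaryGroup.mul_val, hP] at this
    -- The square of `A` is plus or minus the identity, and it lies in `S'`, which excludes the
    -- minus sign.
    have hsq : a * a = 1 := by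
      have h1 := Pauli.app_app P ψ
      rw [ha, Pauli.app_smul, ha, smul_smul] at h1
      obtain ⟨w, hw⟩ := Function.ne_iff.1 hψ
      have h2 := mul_right_cancel₀ hw (congrFun h1 w)
      rw [h2]
      refine (ipow_two_mul_mul_sgn _ _).resolve_right fun h3 => hAA (mat_ext_mulVec fun φ => ?_)
      rw [← Matrix.mulVec_mulVec, Pauli.toMat_mulVec, Pauli.toMat_mulVec, Pauli.app_app, h3,
        Matrix.neg_mulVec, Matrix.one_mulVec, neg_one_smul]
    rcases mul_self_eq_one_iff.1 hsq with h1 | h1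
    · refine ⟨hS'.1 hA, ?_⟩
      rw [hP, Pauli.toMat_mulVec, ha, h1, one_smul]
    -- If `a = -1`, then `-A` fixes ψ, so both `A` and `-A` lie in `S'`, and so does their quotient
    -- `-1`.
    · exfalso
      have hN : P.neg.toUnitary ∈ S' := hle ⟨P.neg.toUnitary_mem, by
        show P.neg.toMat.mulVec ψ = ψ
        rw [Pauli.toMat_mulVec, Pauli.app_neg, ha, h1, neg_one_smul, neg_neg]⟩
      refine hS'.2.2 _ (mul_mem hN (inv_mem hA)) ?_
      have h2 : (P.neg.toUnitary : Mat n) = -(A : Mat n) := by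
        rw [hP, ← Pauli.toMat_neg]; rfl
      rw [Matrix.UnitaryGroup.mul_val, h2, neg_mul, ← Matrix.UnitaryGroup.mul_val, mul_inv_cancel,
        Matrix.UnitaryGroup.one_val]

/-- The gate that shifts by a basis vector and fixes the vector given by a triple. -/
lemma Represents.app_eq {n : ℕ} {T : AffineTriple n} {ψ : Vec n} (h : Represents T ψ) (i : Fin T.k)
    {p : Label n} (h2 : (fun j => T.basis j ⬝ᵥ p) = polar T.ell T.quad i) :
    (⟨p, T.basis i, 3 * ((T.ell i).val : ZMod 4) +
      2 * ((T.quad i i + T.shift ⬝ᵥ p).val : ZMod 4)⟩ : Pauli n).app ψ = ψ := by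
  set β := polar T.ell T.quad i with hβ
  ext v
  simp only [Pauli.app, ipow_add, ipow_two_mul_val]
  by_cases hv : ∃ x, v = comb x T.basis + T.shift
  · obtain ⟨x, rfl⟩ := hv
    have h1 : comb x T.basis + T.shift + T.basis i = comb (x + unitVec i) T.basis + T.shift := by
      rw [add_comb, unitVec_comb, add_right_comm]
    -- On the coset, the condition on `p` makes the sign of the gate cancel the one from
    -- `phase_add`; the exponent of the gate cancels the value of the phase at `e_i`.
    rw [h1, h.amp, h.amp, phase_add, phase_unitVec, dotProduct_comm p, add_dotProduct,
      comb_dotProduct, h2, sgn_add, sgn_add, dotProduct_comm _ x]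
    have e1 := ipow_three_mul_val_mul_ibit (T.ell i)
    have e2 := sgn_mul_self (T.quad i i)
    have e3 := sgn_mul_self (T.shift ⬝ᵥ p)
    have e4 := sgn_mul_self (x ⬝ᵥ β)
    set s1 := sgn (T.quad i i)
    set s2 := sgn (T.shift ⬝ᵥ p)
    set s3 := sgn (x ⬝ᵥ β)
    calc _ = (ipow (3 * ((T.ell i).val : ZMod 4)) * ibit (T.ell i)) * (s1 * s1) * (s2 * s2) *
        (s3 * s3) * (phase T.ell T.quad x * ψ T.shift) := by ring
      _ = _ := by rw [e1, e2, e3, e4]; ring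
  -- Off the coset both amplitudes vanish, because shifting by a basis vector does not lead into it.
  · have h1 : ψ v = 0 := by
      by_contra hne
      exact hv (h.supp v hne)
    have h2 : ψ (v + T.basis i) = 0 := by
      by_contra hne
      obtain ⟨x, hx⟩ := h.supp _ hne
      refine hv ⟨x + unitVec i, ?_⟩
      rw [add_comb, unitVec_comb, (label_add_eq_iff _ _ _).1 hx, add_right_comm]
    rw [h1, h2]
    simp

/-- The Pauli gates that fix a vector given by an affine subspace triple, and their joint
fixed vectors. -/
lemma Represents.fixed {n : ℕ} {T : AffineTriple n} {ψ : Vec n} (h : Represents T ψ) (φ : Vec n)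
    (hφ : ∀ P : Pauli n, P.app ψ = ψ → P.app φ = φ) : ∃ a : ℂ, φ = a • ψ := by
  set B := (rightInverse T.basis).val with hB
  have hBspec : ∀ y, comb (comb y T.basis) B = y := rightInverse_spec _ h.inj
  have hBi : ∀ i, comb (T.basis i) B = unitVec i := fun i => by
    have := hBspec (unitVec i)
    rwa [unitVec_comb] at this
  have hcoset : ∀ w, φ w ≠ 0 → ∃ x, w = comb x T.basis + T.shift := by
    intro w hw
    by_contra hne
    set u := w + T.shift with hu
    -- The linear map `v ↦ v + comb (comb v B) T.basis` kills the span `V` of the basis, and it does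
    -- not kill `u`, which lies outside. A coordinate that it leaves nonzero at `u`, written as `v ↦
    -- v·p`, gives a diagonal gate that fixes ψ and negates the entry of φ at `w`.
    have hx : u + comb (comb u B) T.basis ≠ 0 := by
      intro h0
      refine hne ⟨comb u B, ?_⟩
      rw [label_add_eq_iff, zero_add] at h0
      exact (label_add_eq_iff _ _ _).1 h0
    obtain ⟨c, hc⟩ := Function.ne_iff.1 hx
    set p : Label n := fun d => unitVec d c + comb (B d) T.basis c with hp
    have hpd : ∀ v, v ⬝ᵥ p = (v + comb (comb v B) T.basis) c := by
      intro v
      rw [comb_comb, hp]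
      simp [dotProduct, mul_add, Finset.sum_add_distrib, comb, unitVec_apply]
    have hpb : ∀ i, T.basis i ⬝ᵥ p = 0 := fun i => by
      rw [hpd, hBi, unitVec_comb, label_add_self]; rfl
    have hfix : ∀ v, (⟨p, 0, 2 * ((T.shift ⬝ᵥ p).val : ZMod 4)⟩ : Pauli n).app φ v =
        sgn ((v + T.shift) ⬝ᵥ p) * φ v := fun v => by
      simp only [Pauli.app, ipow_two_mul_val, add_zero, add_dotProduct, sgn_add,
        dotProduct_comm p v]
      ring
    have h1 := congrFun (hφ ⟨p, 0, 2 * ((T.shift ⬝ᵥ p).val : ZMod 4)⟩ (by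
      ext v
      simp only [Pauli.app, ipow_two_mul_val, add_zero]
      by_cases hv : ψ v = 0
      · simp [hv]
      · obtain ⟨x, rfl⟩ := h.supp v hv
        rw [dotProduct_comm p, add_dotProduct, comb_dotProduct]
        have : (fun i => T.basis i ⬝ᵥ p) = 0 := funext hpb
        rw [this, dotProduct_zero, zero_add, ← mul_assoc, sgn_mul_self, one_mul])) w
    rw [hfix, hpd] at h1
    have h2 : sgn ((u + comb (comb u B) T.basis) c) = sgn 0 := by
      rw [sgn_zero]
      exact mul_right_cancel₀ hw (by rw [h1, one_mul])
    exact hc (sgn_injective h2)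
  -- The right inverse of the basis solves `b_j·p = β_j`, the condition of `Represents.app_eq`.
  have hstep : ∀ i, ∃ P : Pauli n, P.q = T.basis i ∧ P.app ψ = ψ := by
    intro i
    set β := polar T.ell T.quad i with hβ
    set p : Label n := fun c => B c ⬝ᵥ β with hp
    have hpb : ∀ j, T.basis j ⬝ᵥ p = β j := fun j => by
      rw [hp, ← comb_dotProduct, hBi, unitVec_dotProduct]
    exact ⟨_, rfl, h.app_eq i (funext hpb)⟩
  refine ⟨φ T.shift / ψ T.shift, ?_⟩
  ext v
  rw [Pi.smul_apply, smul_eq_mul]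
  by_cases hv : ∃ x, v = comb x T.basis + T.shift
  · obtain ⟨x, rfl⟩ := hv
    induction x using label_induction with
    | h0 =>
      rw [zero_comb, zero_add, div_mul_cancel₀ _ h.shift_ne]
    | hs x i ih =>
      -- The same gate fixes both vectors, so their quotient is the same at neighbouring points of
      -- the coset.
      obtain ⟨P, hq, hP⟩ := hstep i
      have h1 := congrFun hP (comb x T.basis + T.shift)
      have h2 := congrFun (hφ P hP) (comb x T.basis + T.shift)
      simp only [Pauli.app, hq] at h1 h2
      rw [add_comb, unitVec_comb, add_right_comm]
      have hc : ipow P.r * sgn (P.p ⬝ᵥ (comb x T.basis + T.shift)) ≠ 0 :=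
        mul_ne_zero (ipow_ne_zero _) (sgn_ne_zero _)
      refine mul_left_cancel₀ hc ?_
      linear_combination h2 + ih - (φ T.shift / ψ T.shift) * h1
  · have h1 : ψ v = 0 := by
      by_contra hne
      exact hv (h.supp v hne)
    have h2 : φ v = 0 := by
      by_contra hne
      exact hv (hcoset v hne)
    rw [h1, h2, mul_zero]

/-! ### Maximal groups and the support of a stabiliser state. -/

lemma dual_eq_dotProduct {n : ℕ} (g : Module.Dual (ZMod 2) (Label n)) :
    ∃ p : Label n, ∀ x, g x = p ⬝ᵥ x := by
  refine ⟨fun i => g (unitVec i), fun x => ?_⟩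
  conv_lhs => rw [← Finset.univ_sum_single x]
  rw [map_sum]
  refine Finset.sum_congr rfl fun i _ => ?_
  have : (Pi.single i (x i) : Label n) = x i • unitVec i := by
    ext j; simp [unitVec, Pi.single_apply]
  rw [this, map_smul, smul_eq_mul, mul_comm]

/-- A maximal group contains, up to a sign, all gates of order two that commute with it. -/
lemma IsStabiliserSubgroup.mem_or_neg {n : ℕ} {S : Subgroup (Matrix.unitaryGroup (Label n) ℂ)}
    (hS : IsStabiliserSubgroup S) (A : Matrix.unitaryGroup (Label n) ℂ) (hA : A ∈ pauliGroup n)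
    (hAA : A * A = 1) (hcomm : ∀ B ∈ S, B * A = A * B) :
    A ∈ S ∨ ∃ B ∈ S, (B : Mat n) = -(A : Mat n) := by
  by_contra hne
  push Not at hne
  obtain ⟨hAS, hneg⟩ := hne
  have hinv : A⁻¹ = A := inv_eq_of_mul_eq_one_left hAA
  -- The group `S ∪ S A` generated by `S` and the commuting involution `A`. Neither `A` nor `-A`
  -- being in `S`, it would be a larger abelian group without `-1`.
  let S' : Subgroup (Matrix.unitaryGroup (Label n) ℂ) :=
    { carrier := {B | B ∈ S ∨ B * A ∈ S}
      mul_mem' := by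
        rintro B D (hB | hB) (hD | hD)
        · exact Or.inl (mul_mem hB hD)
        · exact Or.inr (by rw [mul_assoc]; exact mul_mem hB hD)
        · refine Or.inr ?_
          have : B * D * A = B * A * D := by rw [mul_assoc, hcomm D hD, mul_assoc]
          rw [this]
          exact mul_mem hB hD
        · refine Or.inl ?_
          have h1 : B * D = (B * A) * (D * A) := by
            have h2 : D * A * A = D := by rw [mul_assoc, hAA, mul_one]
            rw [mul_assoc B A, ← hcomm _ hD, h2]
          rw [h1]
          exact mul_mem hB hD
      one_mem' := Or.inl (one_mem _)
      inv_mem' := by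
        rintro B (hB | hB)
        · exact Or.inl (inv_mem hB)
        · refine Or.inr ?_
          have h1 := inv_mem hB
          rw [mul_inv_rev, hinv] at h1
          have h2 : B⁻¹ * A = A * B⁻¹ := by
            have h3 := hcomm _ h1
            rw [mul_assoc, ← mul_assoc A A, hAA, one_mul] at h3
            calc B⁻¹ * A = A * A * (B⁻¹ * A) := by rw [hAA, one_mul]
              _ = A * B⁻¹ := by rw [mul_assoc, h3]
          rw [h2]
          exact h1 }
  have hBA : ∀ B, B * A * A = B := fun B => by rw [mul_assoc, hAA, mul_one]
  have hcomm' : ∀ B ∈ S', B * A = A * B := by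
    rintro B (hB | hB)
    · exact hcomm B hB
    · have := hcomm _ hB
      rw [hBA] at this
      rw [← mul_assoc] at this
      calc B * A = A * B * A * A := by rw [← this]
        _ = A * B := hBA _
  have hS' : IsAbelianWithoutNegOne S' := by
    refine ⟨?_, ?_, ?_⟩
    · rintro B (hB | hB)
      · exact hS.1.1 hB
      · rw [← hBA B]
        exact mul_mem (hS.1.1 hB) hA
    · have h1 : ∀ B ∈ S, ∀ D ∈ S', B * D = D * B := by
        rintro B hB D (hD | hD)
        · exact hS.1.2.1 B hB D hD
        · have h2 := hS.1.2.1 B hB _ hD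
          rw [← mul_assoc, mul_assoc D, ← hcomm B hB, ← mul_assoc] at h2
          exact mul_right_cancel h2
      rintro B (hB | hB) D hD
      · exact h1 B hB D hD
      · have h2 := h1 _ hB D hD
        rw [mul_assoc, ← hcomm' D hD, ← mul_assoc, ← mul_assoc] at h2
        exact mul_right_cancel h2
    · rintro B (hB | hB) h
      · exact hS.1.2.2 B hB h
      · exact hneg _ hB (by rw [Matrix.UnitaryGroup.mul_val, h, neg_one_mul])
  refine hAS (hS.2 hS' (fun B hB => Or.inl hB) (Or.inr ?_ : A ∈ S'))
  rw [hAA]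
  exact one_mem _

lemma Pauli.toUnitary_mul {n : ℕ} (P Q : Pauli n) :
    (P.mul Q).toUnitary = P.toUnitary * Q.toUnitary := Subtype.ext (Pauli.toMat_mul P Q)

lemma Pauli.toUnitary_one (n : ℕ) : (Pauli.one n).toUnitary = 1 :=
  Subtype.ext (Pauli.toMat_one n)

/-- The pairs `(p, q)` that belong to the elements of a group of Pauli gates. -/
noncomputable def pauliLabels {n : ℕ} (S : Subgroup (Matrix.unitaryGroup (Label n) ℂ)) :
    Submodule (ZMod 2) (Label n × Label n) where
  carrier := {v | ∃ r, (⟨v.1, v.2, r⟩ : Pauli n).toUnitary ∈ S}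
  add_mem' := by
    rintro v w ⟨r, hr⟩ ⟨s, hs⟩
    have := mul_mem hr hs
    rw [← Pauli.toUnitary_mul] at this
    exact ⟨_, this⟩
  zero_mem' := ⟨0, by
    have := one_mem S
    rwa [← Pauli.toUnitary_one] at this⟩
  smul_mem' := by
    rintro c v ⟨r, hr⟩
    rcases bit_cases c with rfl | rfl
    · refine ⟨0, ?_⟩
      have := one_mem S
      rw [← Pauli.toUnitary_one] at this
      rw [zero_smul]
      exact this
    · exact ⟨r, by rwa [one_smul]⟩

/-- The Hermitian gate `i^(p·q) Z^p X^q`. -/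
def hermitian {n : ℕ} (p q : Label n) : Pauli n := ⟨p, q, ((p ⬝ᵥ q).val : ZMod 4)⟩

lemma hermitian_mul_self {n : ℕ} (p q : Label n) :
    (hermitian p q).toUnitary * (hermitian p q).toUnitary = 1 := by
  apply Subtype.ext
  refine mat_ext_mulVec fun χ => ?_
  show ((hermitian p q).toMat * (hermitian p q).toMat).mulVec χ = (1 : Mat n).mulVec χ
  rw [← Matrix.mulVec_mulVec, Pauli.toMat_mulVec, Pauli.toMat_mulVec, Pauli.app_app]
  simp only [hermitian, ipow_two_mul_val, sgn_mul_self]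
  rw [one_smul, Matrix.one_mulVec]

/-- A maximal group contains a gate with shift `q` if `q` is orthogonal to its diagonal part. -/
lemma IsStabiliserSubgroup.exists_shift {n : ℕ}
    {S : Subgroup (Matrix.unitaryGroup (Label n) ℂ)} (hS : IsStabiliserSubgroup S) (q : Label n)
    (hq : ∀ p, (p, 0) ∈ pauliLabels S → p ⬝ᵥ q = 0) : ∃ p, (p, q) ∈ pauliLabels S := by
  let f : pauliLabels S →ₗ[ZMod 2] Label n :=
    (LinearMap.snd (ZMod 2) (Label n) (Label n)).comp (pauliLabels S).subtype
  let φ : Module.Dual (ZMod 2) (pauliLabels S) :=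
    { toFun := fun v => v.1.1 ⬝ᵥ q
      map_add' := fun v w => by simp [add_dotProduct]
      map_smul' := fun c v => by simp [smul_dotProduct] }
  -- The functional `(p', q') ↦ p'·q` vanishes where `q' = 0`, by hypothesis. So it factors through
  -- the shift and has the form `(p', q') ↦ p·q'`.
  have hφ : φ ∈ (LinearMap.ker f).dualAnnihilator := by
    rw [Submodule.mem_dualAnnihilator]
    rintro ⟨⟨p, q'⟩, hv⟩ hker
    have hq' : q' = 0 := hker
    subst hq'
    exact hq p hv
  rw [← LinearMap.range_dualMap_eq_dualAnnihilator_ker] at hφ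
  obtain ⟨g, hg⟩ := hφ
  obtain ⟨p, hp⟩ := dual_eq_dotProduct g
  -- This identity of functionals says that the Hermitian gate with labels `p` and `q` commutes with
  -- `S`; maximality puts it or its negative into `S`.
  have hcomm : ∀ P : Pauli n, P.toUnitary ∈ S → P.omega (hermitian p q) = 0 := by
    intro P hP
    have hmem : (P.p, P.q) ∈ pauliLabels S := ⟨P.r, hP⟩
    have h1 := LinearMap.congr_fun hg ⟨_, hmem⟩
    have h2 : p ⬝ᵥ P.q = P.p ⬝ᵥ q := by rw [← hp]; exact h1
    simp only [Pauli.omega, hermitian]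
    rw [← h2, dotProduct_comm P.q, bit_add_self]
  rcases hS.mem_or_neg (hermitian p q).toUnitary (Pauli.toUnitary_mem _) (hermitian_mul_self p q)
    (fun B hB => by
      obtain ⟨P, hP⟩ := (mem_pauliGroup_iff B).1 (hS.1.1 hB)
      have hPB : P.toUnitary = B := Subtype.ext hP.symm
      rw [← hPB] at hB ⊢
      exact Subtype.ext (Pauli.toMat_comm _ _ (hcomm P hB))) with h1 | ⟨B, hB, h1⟩
  · exact ⟨p, _, h1⟩
  · have : (hermitian p q).neg.toUnitary = B :=
      Subtype.ext (by rw [h1]; exact Pauli.toMat_neg _)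
    rw [← this] at hB
    exact ⟨p, _, hB⟩

/-- A stabiliser state is represented by the triple that is read off from its amplitudes. -/
lemma represents_of_isStabiliserState {n : ℕ} {ψ : Vec n} (h : IsStabiliserState ψ) :
    Represents (stateToTriple ψ).val ψ := by
  obtain ⟨hnorm, S, hS, hfix⟩ := h
  have happ : ∀ P : Pauli n, P.toUnitary ∈ S → P.app ψ = ψ := fun P hP => by
    rw [← Pauli.toMat_mulVec]; exact hfix _ hP
  let V : Submodule (ZMod 2) (Label n) :=
    (pauliLabels S).map (LinearMap.snd (ZMod 2) (Label n) (Label n))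
  have hV : ∀ q, q ∈ V ↔ ∃ p, (p, q) ∈ pauliLabels S := by
    intro q
    constructor
    · rintro ⟨⟨p, q'⟩, hr, rfl⟩
      exact ⟨p, hr⟩
    · rintro ⟨p, hr⟩
      exact ⟨(p, q), hr, rfl⟩
  obtain ⟨z₀, hz₀⟩ : ∃ z₀, ψ z₀ ≠ 0 := by
    by_contra hne
    push Not at hne
    simp [hne] at hnorm
  have hstep : ∀ q ∈ V, ∀ w, ψ w ≠ 0 → ψ (w + q) ≠ 0 := by
    intro q hq w hw
    obtain ⟨p, r, hP⟩ := (hV q).1 hq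
    have h1 := congrFun (happ _ hP) w
    simp only [Pauli.app] at h1
    intro h0
    rw [h0, mul_zero, mul_zero] at h1
    exact hw h1.symm
  refine represents_of_coset V hz₀ (fun w => ⟨fun hw => (hV _).2 (hS.exists_shift _ ?_), fun hw => ?_⟩) ?_
  -- A diagonal gate of the group has eigenvalue one at every point of the support, so its signs at
  -- `w` and `z₀` agree and `p` is orthogonal to `w + z₀`.
  · rintro p ⟨r, hr⟩
    have h1 := fun z => congrFun (happ _ hr) z
    simp only [Pauli.app, add_zero, ← mul_assoc] at h1
    have h2 := mul_right_cancel₀ hw ((h1 w).trans (one_mul _).symm)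
    have h3 := mul_right_cancel₀ hz₀ ((h1 z₀).trans (one_mul _).symm)
    have h4 := sgn_injective (mul_left_cancel₀ (ipow_ne_zero r) (h2.trans h3.symm))
    rw [dotProduct_add, h4, bit_add_self]
  · have := hstep _ hw z₀ hz₀
    rwa [add_comm w, ← add_assoc, label_add_self, zero_add] at this
  · intro q hq
    obtain ⟨p, r, hP⟩ := (hV q).1 hq
    exact ⟨_, rfl, happ _ hP⟩

/-- The verification of stabiliser states is correct. -/
lemma verifyStabiliserState_iff {n : ℕ} (ψ : Vec n) :
    (verifyStabiliserState ψ).val = true ↔ IsStabiliserState ψ := by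
  constructor
  · intro h
    obtain ⟨h1, h2⟩ := represents_of_verify h
    exact isStabiliserState_of_fixed h2 fun φ hφ => h1.fixed φ hφ
  · intro h
    exact verify_of_represents (represents_of_isStabiliserState h) h.1

/-! Check matrices. -/

/-- The affine subspace triple in the row reduced basis. -/
def reducedTriple {n : ℕ} (T : AffineTriple n) : AffineTriple n where
  k := T.k
  basis := (rowReduce T.basis).val.rows
  shift := T.shift
  quad := fun i j =>
    let full := fun i j => comb (comb ((rowReduce T.basis).val.change i) T.quad)
      (fun a b => (rowReduce T.basis).val.change b a) j
    (if i = j then op (full i i) else if i < j then op (full i j + full j i) else op 0 :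
      Timed (ZMod 2)).val
  ell := fun i => (rowReduce T.basis).val.change i ⬝ᵥ T.ell

lemma reducedTriple_quad {n : ℕ} (T : AffineTriple n) : (reducedTriple T).quad =
    let full := fun i j => comb (comb ((rowReduce T.basis).val.change i) T.quad)
      (fun a b => (rowReduce T.basis).val.change b a) j
    fun i j => if i = j then full i i else if i < j then full i j + full j i else 0 := by
  ext i j
  simp only [reducedTriple]
  split_ifs <;> rfl

lemma quadForm_eq {k : ℕ} (Q : Fin k → Fin k → ZMod 2) (x : Label k) :
    quadForm Q x = comb x Q ⬝ᵥ x := (comb_dotProduct x Q x).symm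

/-- Under the substitution `x ↦ x M` the coefficient matrix becomes `M Q Mᵀ` and the linear form
becomes `M ℓ`. -/
lemma phase_comb {k : ℕ} (ell : Label k) (Q M : Fin k → Fin k → ZMod 2) (x : Label k) :
    phase ell Q (comb x M) = phase (fun i => M i ⬝ᵥ ell)
      (fun i => comb (comb (M i) Q) fun a b => M b a) x := by
  have h1 : quadForm Q (comb x M) =
      quadForm (fun i => comb (comb (M i) Q) fun a b => M b a) x := by
    rw [quadForm_eq, comb_comb, comb_dotProduct, quadForm]
    congr 1
    ext i
    rw [dotProduct_comm, comb_dotProduct, dotProduct_comm]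
    congr 1
    ext j
    rw [dotProduct_comm]
    rfl
  rw [phase, phase, h1, comb_dotProduct]

/-- A quadratic form sees only the coefficients `Q_ii` and the sums `Q_ij + Q_ji`. -/
lemma phase_upper {k : ℕ} (ell : Label k) (Q : Fin k → Fin k → ZMod 2) (x : Label k) :
    phase ell (fun i j => if i = j then Q i i else if i < j then Q i j + Q j i else 0) x =
      phase ell Q x := by
  refine (phase_isQuadratic _ _).ext (phase_isQuadratic _ _) (fun i => ?_) (fun i j hij => ?_) x
  · simp [phase_unitVec]
  · simp only [phase, quadForm_add, quadForm_unitVec, unitVec_dotProduct, dotProduct_unitVec,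
      if_true, if_neg hij.ne, if_neg hij.ne', if_pos hij, if_neg (not_lt.2 hij.le), add_zero]

/-- The change of basis is invertible, so the reduced rows span the same subspace, and the forms are
transported by `phase_comb`. -/
lemma Represents.reduced {n : ℕ} {T : AffineTriple n} {ψ : Vec n} (h : Represents T ψ) :
    Represents (reducedTriple T) ψ := by
  have hR := rowReduce_isReduced T.basis h.inj
  have hsurj : ∀ y, ∃ x, comb x (rowReduce T.basis).val.change = y :=
    Finite.injective_iff_surjective.1 (comb_injective hR.change_inj)
  refine ⟨fun (x : Label T.k) hx => ?_, h.shift_ne, fun w hw => ?_, fun (x : Label T.k) => ?_⟩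
  · have : comb x (rowReduce T.basis).val.rows = 0 := hx
    rw [hR.rows_eq] at this
    exact hR.change_inj _ (h.inj _ this)
  · obtain ⟨y, rfl⟩ := h.supp w hw
    obtain ⟨x, rfl⟩ := hsurj y
    refine ⟨x, ?_⟩
    rw [← hR.rows_eq]
    rfl
  · have h1 := h.amp (comb x (rowReduce T.basis).val.change)
    rw [← hR.rows_eq, phase_comb, ← phase_upper] at h1
    rw [reducedTriple_quad]
    exact h1

/-- The first part of a row of the check matrix that belongs to row `i` of the reduced basis. -/
def checkP {n : ℕ} (T : AffineTriple n) (i : Fin T.k) : Label n := fun d =>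
  match (pivotRows (rowReduce T.basis).val).val d with
  | some j => if i = j then (reducedTriple T).ell i
    else (if i < j then (reducedTriple T).quad i j else (reducedTriple T).quad j i) +
      (reducedTriple T).ell i * (reducedTriple T).ell j
  | none => 0

/-- The first part of a row of the check matrix that belongs to a free column. -/
def checkRho {n : ℕ} (T : AffineTriple n) (c : Fin n) : Label n := fun d =>
  match (pivotRows (rowReduce T.basis).val).val d with
  | some j => (reducedTriple T).basis j c
  | none => if d = c then 1 else 0

lemma tripleToCheckMatrix_some {n : ℕ} (T : AffineTriple n) {c : Fin n} {i : Fin T.k}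
    (h : (pivotRows (rowReduce T.basis).val).val c = some i) :
    (tripleToCheckMatrix T).val c = ⟨checkP T i, (reducedTriple T).basis i,
      checkP T i ⬝ᵥ (reducedTriple T).basis i +
      checkP T i ⬝ᵥ ((reducedTriple T).basis i + T.shift) + (reducedTriple T).quad i i⟩ := by
  have hp : checkP T i = fun d => (match (pivotRows (rowReduce T.basis).val).val d with
      | some j => if i = j then op ((reducedTriple T).ell i)
        else op ((if i < j then (reducedTriple T).quad i j else (reducedTriple T).quad j i) +
          (reducedTriple T).ell i * (reducedTriple T).ell j)
      | none => op 0 : Timed (ZMod 2)).val := by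
    ext d
    unfold checkP
    cases (pivotRows (rowReduce T.basis).val).val d with
    | none => rfl
    | some j => by_cases hij : i = j <;> simp [hij]
  unfold tripleToCheckMatrix
  simp only [bind_val, table_val, -eq_self]
  rw [h, hp]
  rfl

lemma tripleToCheckMatrix_none {n : ℕ} (T : AffineTriple n) {c : Fin n}
    (h : (pivotRows (rowReduce T.basis).val).val c = none) :
    (tripleToCheckMatrix T).val c = ⟨checkRho T c, 0, checkRho T c ⬝ᵥ T.shift⟩ := by
  have hp : checkRho T c = fun d => (match (pivotRows (rowReduce T.basis).val).val d with
      | some j => op ((reducedTriple T).basis j c)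
      | none => op (if d = c then 1 else 0) : Timed (ZMod 2)).val := by
    ext d
    unfold checkRho
    cases (pivotRows (rowReduce T.basis).val).val d <;> rfl
  unfold tripleToCheckMatrix
  simp only [bind_val, table_val, -eq_self]
  rw [h, hp]
  rfl

/-- The gate `i^(2 c + 3 (p·q)) Z^p X^q` with the given bits. -/
def PauliBits.toPauli {n : ℕ} (P : PauliBits n) : Pauli n :=
  ⟨P.p, P.q, 2 * (P.c.val : ZMod 4) + 3 * ((P.p ⬝ᵥ P.q).val : ZMod 4)⟩

/-- The pivot columns of the reduced basis. -/
lemma Represents.exists_pivots {n : ℕ} {T : AffineTriple n} {ψ : Vec n} (h : Represents T ψ) :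
    ∃ piv : Fin T.k → Fin n,
      (∀ t i : Fin T.k, (reducedTriple T).basis t (piv i) = if t = i then 1 else 0) ∧
      ∀ c i, (pivotRows (rowReduce T.basis).val).val c = some i ↔ c = piv i :=
  (rowReduce_isReduced T.basis h.inj).exists_pivots

/-- Sums over all columns, split into pivot columns and free columns. -/
lemma sum_pivots {n k : ℕ} {inv : Fin n → Option (Fin k)} {piv : Fin k → Fin n}
    (hinv : ∀ c i, inv c = some i ↔ c = piv i) (f : Fin n → ZMod 2) :
    ∑ d, f d = ∑ i, f (piv i) + ∑ d, if inv d = none then f d else 0 := by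
  have h1 : ∀ d, f d = (∑ i, if d = piv i then f (piv i) else 0) +
      if inv d = none then f d else 0 := by
    intro d
    cases hd : inv d with
    | none =>
      rw [Finset.sum_eq_zero, zero_add, if_pos rfl]
      intro i _
      refine if_neg fun hdi => ?_
      rw [(hinv d i).2 hdi] at hd
      simp at hd
    | some i =>
      have hdi := (hinv d i).1 hd
      rw [Finset.sum_eq_single i, if_pos hdi, hdi]
      · simp
      · intro j _ hji
        refine if_neg fun hdj => hji ?_
        rw [(hinv d j).2 hdj] at hd
        exact Option.some.inj hd
      · simp
  rw [Finset.sum_congr rfl fun d _ => h1 d, Finset.sum_add_distrib, Finset.sum_comm]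
  simp

/-- The rows of the check matrix fix the state. -/
lemma Represents.checkMatrix_app {n : ℕ} {T : AffineTriple n} {ψ : Vec n} (h : Represents T ψ)
    (c : Fin n) : ((tripleToCheckMatrix T).val c).toPauli.app ψ = ψ := by
  obtain ⟨piv, hpiv, hinv⟩ := h.exists_pivots
  have hr := h.reduced
  cases hc : (pivotRows (rowReduce T.basis).val).val c with
  | none =>
    rw [tripleToCheckMatrix_none T hc]
    ext w
    simp only [Pauli.app, PauliBits.toPauli, ipow_add, ipow_two_mul_val]
    simp only [dotProduct_zero, ZMod.val_zero, Nat.cast_zero, mul_zero, ipow_zero, mul_one, add_zero]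
    by_cases hw : ψ w = 0
    · simp [hw]
    · obtain ⟨x, rfl⟩ := hr.supp w hw
      -- The vector ρ is orthogonal to every basis vector `b_j`: pivot columns contribute `b_j(c)`,
      -- free columns contribute `b_j(c)` once more, and the sum vanishes modulo 2.
      have hb : (fun i => (reducedTriple T).basis i ⬝ᵥ checkRho T c) = 0 := by
        funext (j : Fin T.k)
        show ∑ d, (reducedTriple T).basis j d * checkRho T c d = 0
        rw [sum_pivots hinv]
        have h1 : ∀ i, checkRho T c (piv i) = (reducedTriple T).basis i c := fun i => by
          unfold checkRho
          rw [(hinv _ i).2 rfl]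
        have h2 : ∀ d, (if (pivotRows (rowReduce T.basis).val).val d = none then
            (reducedTriple T).basis j d * checkRho T c d else 0) =
            if d = c then (reducedTriple T).basis j c else 0 := fun d => by
          by_cases hd : (pivotRows (rowReduce T.basis).val).val d = none
          · rw [if_pos hd]
            unfold checkRho
            rw [hd]
            by_cases hdc : d = c <;> simp [hdc]
          · rw [if_neg hd, if_neg]
            rintro rfl
            exact hd hc
        simp only [h1, h2, hpiv]
        have h3 : ∀ i : Fin T.k, (if j = i then (1 : ZMod 2) else 0) *
            (reducedTriple T).basis i c = if j = i then (reducedTriple T).basis j c else 0 :=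
          fun i => by
            by_cases hij : j = i
            · rw [if_pos hij, if_pos hij, one_mul, hij]
            · rw [if_neg hij, if_neg hij, zero_mul]
        rw [Finset.sum_congr rfl fun i _ => h3 i, Finset.sum_ite_eq, Finset.sum_ite_eq']
        simp only [Finset.mem_univ, if_true]
        exact bit_add_self _
      rw [dotProduct_comm _ (comb x _ + _), add_dotProduct, comb_dotProduct, hb, dotProduct_zero,
        zero_add, dotProduct_comm]
      have hs : (reducedTriple T).shift = T.shift := rfl
      rw [hs, ← mul_assoc, sgn_mul_self, one_mul]
  | some i =>
    rw [tripleToCheckMatrix_some T hc]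
    -- As `p` vanishes in free columns and pivot columns are unit vectors, `b_j·p` is just the entry
    -- of `p` at the pivot of row `j`.
    have hb : (fun j => (reducedTriple T).basis j ⬝ᵥ checkP T i) =
        polar (reducedTriple T).ell (reducedTriple T).quad i := by
      funext (j : Fin T.k)
      show ∑ d, (reducedTriple T).basis j d * checkP T i d = _
      rw [sum_pivots hinv]
      have h1 : ∀ l, checkP T i (piv l) = polar (reducedTriple T).ell (reducedTriple T).quad i l :=
        fun l => by
          unfold checkP
          rw [(hinv _ l).2 rfl]
          have hlow : ∀ a b : Fin T.k, b < a → (reducedTriple T).quad a b = 0 := fun a b hab => by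
            rw [reducedTriple_quad]
            simp only
            rw [if_neg hab.ne', if_neg (not_lt.2 hab.le)]
          simp only [polar]
          rcases lt_trichotomy i l with hil | rfl | hil
          · rw [if_neg hil.ne, if_pos hil, hlow l i hil, add_zero]
          · rw [if_pos rfl, bit_add_self, zero_add]
            rcases bit_cases ((reducedTriple T).ell i) with h0 | h0 <;> simp [h0]
          · rw [if_neg hil.ne', if_neg (not_lt.2 hil.le), hlow i l hil, zero_add]
      have h2 : ∀ d, (if (pivotRows (rowReduce T.basis).val).val d = none then
          (reducedTriple T).basis j d * checkP T i d else 0) = 0 := fun d => by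
        by_cases hd : (pivotRows (rowReduce T.basis).val).val d = none
        · rw [if_pos hd]
          unfold checkP
          rw [hd]
          exact mul_zero _
        · rw [if_neg hd]
      simp only [h1, h2, hpiv, Finset.sum_const_zero, add_zero, ite_mul, one_mul, zero_mul]
      exact Finset.sum_ite_eq _ _ _ |>.trans (if_pos (Finset.mem_univ _))
    -- The diagonal of the polar form is `ℓ_i² = ℓ_i`, which matches the factor `(-i)^(p·q)` of the
    -- bit format with the exponent in `Represents.app_eq`.
    have hself : (reducedTriple T).basis i ⬝ᵥ checkP T i = (reducedTriple T).ell i := by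
      have := congrFun hb i
      simp only [polar, bit_add_self, zero_add] at this
      rw [this]
      rcases bit_cases ((reducedTriple T).ell i) with h0 | h0 <;> simp [h0]
    have hsign : checkP T i ⬝ᵥ (reducedTriple T).basis i +
        checkP T i ⬝ᵥ ((reducedTriple T).basis i + T.shift) + (reducedTriple T).quad i i =
        (reducedTriple T).quad i i + T.shift ⬝ᵥ checkP T i := by
      rw [dotProduct_add, ← add_assoc, bit_add_self, zero_add, dotProduct_comm, add_comm]
    refine Eq.trans ?_ (hr.app_eq i hb)
    simp only [PauliBits.toPauli, hsign]
    rw [dotProduct_comm _ ((reducedTriple T).basis i), hself, add_comm]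
    rfl

/-- The rows of the check matrix are independent. -/
lemma Represents.checkMatrix_independent {n : ℕ} {T : AffineTriple n} {ψ : Vec n}
    (h : Represents T ψ) (x : Label n)
    (hp : comb x (fun c => ((tripleToCheckMatrix T).val c).p) = 0)
    (hq : comb x (fun c => ((tripleToCheckMatrix T).val c).q) = 0) : x = 0 := by
  obtain ⟨piv, hpiv, hinv⟩ := h.exists_pivots
  -- The `q` parts are unit vectors in the pivot columns and vanish for free rows.
  have hx1 : ∀ i, x (piv i) = 0 := by
    intro j
    have h1 := congrFun hq (piv j)
    simp only [comb] at h1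
    rw [sum_pivots hinv] at h1
    have h2 : ∀ i, ((tripleToCheckMatrix T).val (piv i)).q (piv j) = if i = j then 1 else 0 :=
      fun i => by rw [tripleToCheckMatrix_some T ((hinv _ i).2 rfl)]; exact hpiv i j
    have h3 : ∀ d, (if (pivotRows (rowReduce T.basis).val).val d = none then
        x d * ((tripleToCheckMatrix T).val d).q (piv j) else 0) = 0 := fun d => by
      by_cases hd : (pivotRows (rowReduce T.basis).val).val d = none
      · rw [if_pos hd, tripleToCheckMatrix_none T hd]
        exact mul_zero _
      · rw [if_neg hd]
    simpa [h2, h3] using h1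
  funext e
  cases he : (pivotRows (rowReduce T.basis).val).val e with
  | some i => rw [(hinv e i).1 he, hx1]; rfl
  -- With the pivot coefficients gone, only free rows remain, and their `p` parts are unit vectors
  -- in the free columns.
  | none =>
    have h1 := congrFun hp e
    simp only [comb] at h1
    rw [sum_pivots hinv] at h1
    have h3 : ∀ d, (if (pivotRows (rowReduce T.basis).val).val d = none then
        x d * ((tripleToCheckMatrix T).val d).p e else 0) = if d = e then x e else 0 := fun d => by
      by_cases hd : (pivotRows (rowReduce T.basis).val).val d = none
      · rw [if_pos hd, tripleToCheckMatrix_none T hd]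
        simp only [checkRho, he]
        by_cases hde : d = e
        · simp [hde]
        · simp [hde, Ne.symm hde]
      · rw [if_neg hd, if_neg]
        rintro rfl
        exact hd he
    simpa [h3, hx1] using h1

/-! Clifford gates and their tableaux. -/

/-- The gates `U_i` and `V_i` act on the columns of `C` in the same way as `Z_i` and `X_i` act on the
basis vectors. -/
structure IsTableau {n : ℕ} (U V : Fin n → Pauli n) (C : Mat n) : Prop where
  U_app : ∀ i z, (U i).app (column C z) = sgn (z i) • column C z
  V_app : ∀ i z, (V i).app (column C z) = column C (z + unitVec i)

lemma column_mul {n : ℕ} (A C : Mat n) (z : Label n) :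
    column (A * C) z = A.mulVec (column C z) := rfl

lemma mat_ext_column {n : ℕ} {A B : Mat n} (h : ∀ z, column A z = column B z) : A = B := by
  ext w z; exact congrFun (h z) w

lemma column_mul_zGate {n : ℕ} (C : Mat n) (p z : Label n) :
    column (C * zGate p) z = sgn (p ⬝ᵥ z) • column C z := by
  ext w
  simp [column, zGate, Matrix.mul_diagonal, sgn, mul_comm]

lemma column_mul_xGate {n : ℕ} (C : Mat n) (q z : Label n) :
    column (C * xGate q) z = column C (z + q) := by
  ext w
  simp [column, xGate, Matrix.mul_apply]

lemma toMat_mul_eq_zGate_iff {n : ℕ} {P : Pauli n} {C : Mat n} {p : Label n} :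
    P.toMat * C = C * zGate p ↔ ∀ z, P.app (column C z) = sgn (p ⬝ᵥ z) • column C z := by
  constructor
  · intro h z
    rw [← Pauli.toMat_mulVec, ← column_mul, h, column_mul_zGate]
  · intro h
    refine mat_ext_column fun z => ?_
    rw [column_mul, Pauli.toMat_mulVec, h, column_mul_zGate]

lemma toMat_mul_eq_xGate_iff {n : ℕ} {P : Pauli n} {C : Mat n} {q : Label n} :
    P.toMat * C = C * xGate q ↔ ∀ z, P.app (column C z) = column C (z + q) := by
  constructor
  · intro h z
    rw [← Pauli.toMat_mulVec, ← column_mul, h, column_mul_xGate]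
  · intro h
    refine mat_ext_column fun z => ?_
    rw [column_mul, Pauli.toMat_mulVec, h, column_mul_xGate]

/-- Conjugation is a homomorphism, so only the generators of the Pauli group have to be tested, and
scalars are harmless. An equation `P C = C B` is then read column by column. -/
lemma isClifford_iff {n : ℕ} (C : Mat n) :
    IsClifford C ↔ C.conjTranspose * C = 1 ∧ ∃ U V, IsTableau U V C := by
  constructor
  · rintro ⟨A, rfl, hA⟩
    have hconj : ∀ B ∈ pauliGroup n, ∃ P : Pauli n, P.toMat * (A : Mat n) = A * B := by
      intro B hB
      obtain ⟨P, hP⟩ := (mem_pauliGroup_iff _).1 (hA B hB)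
      refine ⟨P, ?_⟩
      rw [← hP, ← Matrix.UnitaryGroup.mul_val, inv_mul_cancel_right, Matrix.UnitaryGroup.mul_val]
    have hz : ∀ i : Fin n, ∃ P : Pauli n, P.toMat * (A : Mat n) = A * zGate (unitVec i) := by
      intro i
      have h1 := Pauli.toUnitary_mem (⟨unitVec i, 0, 0⟩ : Pauli n)
      obtain ⟨P, hP⟩ := hconj _ h1
      exact ⟨P, by rw [hP]; simp [Pauli.toUnitary, Pauli.toMat, xGate_zero]⟩
    have hx : ∀ i : Fin n, ∃ P : Pauli n, P.toMat * (A : Mat n) = A * xGate (unitVec i) := by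
      intro i
      have h1 := Pauli.toUnitary_mem (⟨0, unitVec i, 0⟩ : Pauli n)
      obtain ⟨P, hP⟩ := hconj _ h1
      exact ⟨P, by rw [hP]; simp [Pauli.toUnitary, Pauli.toMat, zGate_zero]⟩
    choose U hU using hz
    choose V hV using hx
    refine ⟨Matrix.mem_unitaryGroup_iff'.1 A.2, U, V, fun i z => ?_, fun i z => ?_⟩
    · rw [toMat_mul_eq_zGate_iff.1 (hU i), unitVec_dotProduct]
    · rw [toMat_mul_eq_xGate_iff.1 (hV i)]
  · rintro ⟨hC, U, V, h⟩
    set A : Matrix.unitaryGroup (Label n) ℂ := ⟨C, Matrix.mem_unitaryGroup_iff'.2 hC⟩ with hA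
    refine ⟨A, rfl, fun B hB => ?_⟩
    unfold pauliGroup at hB
    have key : ∀ (B : Matrix.unitaryGroup (Label n) ℂ) (P : Pauli n),
        P.toMat * C = C * B → A * B * A⁻¹ ∈ pauliGroup n := by
      intro B P hP
      have : A * B * A⁻¹ = P.toUnitary := by
        rw [mul_inv_eq_iff_eq_mul]
        exact Subtype.ext hP.symm
      rw [this]
      exact P.toUnitary_mem
    induction hB using Subgroup.closure_induction with
    | mem B hB =>
      rcases hB with ⟨i, hi⟩ | ⟨i, hi⟩ | hi
      · refine key B (U i) ?_
        rw [hi, toMat_mul_eq_zGate_iff]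
        intro z
        rw [h.U_app, unitVec_dotProduct]
      · refine key B (V i) ?_
        rw [hi, toMat_mul_eq_xGate_iff]
        exact h.V_app i
      · refine key B ⟨0, 0, 1⟩ ?_
        rw [hi]
        simp [Pauli.toMat, zGate_zero, xGate_zero]
    | one => simp
    | mul B D _ _ hB hD =>
      have : A * (B * D) * A⁻¹ = (A * B * A⁻¹) * (A * D * A⁻¹) := by group
      rw [this]
      exact mul_mem hB hD
    | inv B _ hB =>
      have : A * B⁻¹ * A⁻¹ = (A * B * A⁻¹)⁻¹ := by group
      rw [this]
      exact inv_mem hB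

/-! Joint eigenspaces. -/

/-- An isometry preserves the inner product, whereas the two different signs negate it. -/
lemma dotProduct_eq_zero_of_app {n : ℕ} (P : Pauli n) {a b : ZMod 2} (hab : a ≠ b) {φ ψ : Vec n}
    (hφ : P.app φ = sgn a • φ) (hψ : P.app ψ = sgn b • ψ) : star φ ⬝ᵥ ψ = 0 := by
  have h := P.dot_app φ ψ
  rw [hφ, hψ, star_smul, smul_dotProduct, dotProduct_smul, star_sgn, smul_smul, ← sgn_add] at h
  have hab' : a + b = 1 := by
    rcases bit_cases a with rfl | rfl <;> rcases bit_cases b with rfl | rfl <;>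
      first | exact absurd rfl hab | simp
  rw [hab', sgn_one, neg_one_smul] at h
  exact self_eq_neg.1 h.symm

section Eigen

variable {n : ℕ} {U : Fin n → Pauli n} {M : Mat n}

lemma column_orthogonal (hU : ∀ i z, (U i).app (column M z) = sgn (z i) • column M z)
    {y z : Label n} (hyz : y ≠ z) {φ : Vec n} (hφ : ∀ i, (U i).app φ = sgn (y i) • φ) :
    star (column M z) ⬝ᵥ φ = 0 := by
  obtain ⟨i, hi⟩ := Function.ne_iff.1 hyz
  exact dotProduct_eq_zero_of_app (U i) (Ne.symm hi) (hU i z) (hφ i)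

lemma star_column_dot_mulVec (hU : ∀ i z, (U i).app (column M z) = sgn (z i) • column M z)
    (x : Vec n) (z : Label n) :
    star (column M z) ⬝ᵥ M.mulVec x = (star (column M z) ⬝ᵥ column M z) * x z := by
  have h1 : Matrix.vecMul (star (column M z)) M =
      Pi.single z (star (column M z) ⬝ᵥ column M z) := by
    ext v
    show star (column M z) ⬝ᵥ column M v = _
    by_cases hv : v = z
    · rw [hv, Pi.single_eq_same]
    · rw [Pi.single_eq_of_ne hv, column_orthogonal hU hv fun i => hU i v]
  rw [Matrix.dotProduct_mulVec, h1, single_dotProduct]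

open scoped ComplexOrder in
lemma star_dotProduct_self_ne_zero {φ : Vec n} (h : φ ≠ 0) : star φ ⬝ᵥ φ ≠ 0 := by
  rwa [Ne, dotProduct_star_self_eq_zero]

/-- Nonzero columns with distinct sign patterns are orthogonal, hence independent, and there are as
many as the dimension. -/
lemma mulVec_surjective (hU : ∀ i z, (U i).app (column M z) = sgn (z i) • column M z)
    (hne : ∀ z, column M z ≠ 0) : Function.Surjective M.mulVec := by
  have hinj : Function.Injective M.mulVecLin := by
    rw [injective_iff_map_eq_zero]
    intro x hx
    ext z
    have h1 := star_column_dot_mulVec hU x z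
    have h2 : M.mulVec x = 0 := hx
    rw [h2, dotProduct_zero] at h1
    exact (mul_eq_zero.1 h1.symm).resolve_left (star_dotProduct_self_ne_zero (hne z))
  exact LinearMap.injective_iff_surjective.1 hinj

/-- The joint eigenspaces of the `U_i` are spanned by the columns. -/
lemma eq_smul_column (hU : ∀ i z, (U i).app (column M z) = sgn (z i) • column M z)
    (hne : ∀ z, column M z ≠ 0) (y : Label n) (φ : Vec n)
    (hφ : ∀ i, (U i).app φ = sgn (y i) • φ) : ∃ a : ℂ, φ = a • column M y := by
  obtain ⟨x, rfl⟩ := mulVec_surjective hU hne φ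
  refine ⟨x y, ?_⟩
  have hx : x = Pi.single y (x y) := by
    ext z
    by_cases hz : z = y
    · rw [hz, Pi.single_eq_same]
    · rw [Pi.single_eq_of_ne hz]
      have h1 := column_orthogonal hU (Ne.symm hz) hφ
      rw [star_column_dot_mulVec hU] at h1
      exact (mul_eq_zero.1 h1).resolve_left (star_dotProduct_self_ne_zero (hne z))
  rw [hx, Matrix.mulVec_single]
  ext w
  simp [column, mul_comm]

end Eigen

/-! Powers of tuples of Pauli gates. -/

/-- New factors are multiplied from the right, so each of them meets the joint eigenvector first and
contributes only its sign. -/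
lemma loop_pauliMul_app {n : ℕ} (A : Pauli n) (ψ : Vec n) :
    ∀ {m : ℕ} (P : Fin m → Pauli n) (x y : Fin m → ZMod 2)
      (_ : ∀ j, (P j).app ψ = sgn (y j) • ψ),
      (loop m (fun j B => do
        let b ← op (decide (x j = 1))
        if b then pauliMul B (P j) else pure B) A).val.app ψ = sgn (x ⬝ᵥ y) • A.app ψ
  | 0, P, x, y, _ => by simp [loop, dotProduct]
  | m + 1, P, x, y, h => by
    have ih := loop_pauliMul_app A ψ (fun j => P j.castSucc) (fun j => x j.castSucc)
      (fun j => y j.castSucc) fun j => h j.castSucc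
    have hd : x ⬝ᵥ y = (fun j : Fin m => x j.castSucc) ⬝ᵥ (fun j => y j.castSucc) +
        x (Fin.last m) * y (Fin.last m) := by
      simp [dotProduct, Fin.sum_univ_castSucc]
    rw [loop]
    simp only [bind_val, op_val]
    rcases bit_cases (x (Fin.last m)) with h0 | h0
    · simp only [hd, h0, zero_mul, add_zero]
      exact ih
    · simp only [hd, h0, one_mul, sgn_add, decide_true, if_true, pauliMul_val]
      rw [Pauli.app_mul, h, Pauli.app_smul, ih, smul_smul, mul_comm]

lemma loop_pauliMul_pq {n : ℕ} (A : Pauli n) :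
    ∀ {m : ℕ} (P : Fin m → Pauli n) (x : Fin m → ZMod 2),
      (loop m (fun j B => do
        let b ← op (decide (x j = 1))
        if b then pauliMul B (P j) else pure B) A).val.p = A.p + comb x (fun j => (P j).p) ∧
      (loop m (fun j B => do
        let b ← op (decide (x j = 1))
        if b then pauliMul B (P j) else pure B) A).val.q = A.q + comb x (fun j => (P j).q)
  | 0, P, x => by
    constructor <;> ext c <;> simp [loop, comb]
  | m + 1, P, x => by
    obtain ⟨ih1, ih2⟩ := loop_pauliMul_pq A (fun j => P j.castSucc) (fun j => x j.castSucc)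
    have hc : ∀ B : Fin (m + 1) → Label n, comb x B =
        comb (fun j : Fin m => x j.castSucc) (fun j => B j.castSucc) +
        x (Fin.last m) • B (Fin.last m) := fun B => by
      ext c
      simp [comb, Fin.sum_univ_castSucc]
    rw [loop]
    simp only [bind_val, op_val]
    rcases bit_cases (x (Fin.last m)) with h0 | h0
    · simp only [hc, h0, zero_smul, add_zero]
      exact ⟨ih1, ih2⟩
    · simp only [hc, h0, one_smul, decide_true, if_true, pauliMul_val, Pauli.mul]
      rw [← add_assoc, ← add_assoc]
      exact ⟨congrArg (· + (P (Fin.last m)).p) ih1, congrArg (· + (P (Fin.last m)).q) ih2⟩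

lemma pauliMulPower_app {n : ℕ} (A : Pauli n) (P : Fin n → Pauli n) (x y : Fin n → ZMod 2)
    {ψ : Vec n} (h : ∀ j, (P j).app ψ = sgn (y j) • ψ) :
    (pauliMulPower A P x).val.app ψ = sgn (x ⬝ᵥ y) • A.app ψ :=
  loop_pauliMul_app A ψ P x y h

lemma pauliMulPower_p {n : ℕ} (A : Pauli n) (P : Fin n → Pauli n) (x : Fin n → ZMod 2) :
    (pauliMulPower A P x).val.p = A.p + comb x (fun j => (P j).p) := (loop_pauliMul_pq A P x).1

lemma pauliMulPower_q {n : ℕ} (A : Pauli n) (P : Fin n → Pauli n) (x : Fin n → ZMod 2) :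
    (pauliMulPower A P x).val.q = A.q + comb x (fun j => (P j).q) := (loop_pauliMul_pq A P x).2

/-- A Pauli gate that fixes all vectors is a multiple of the identity. -/
lemma Pauli.pq_eq_zero {n : ℕ} (A : Pauli n) (h : ∀ ψ : Vec n, A.app ψ = ψ) :
    A.p = 0 ∧ A.q = 0 := by
  have hq : A.q = 0 := by
    by_contra hq
    have h1 := congrFun (h (Pi.single 0 1)) 0
    simp [Pauli.app, hq] at h1
  refine ⟨label_ext_dotProduct fun z => ?_, hq⟩
  have h0 := congrFun (h (Pi.single 0 1)) 0
  have h1 := congrFun (h (Pi.single z 1)) z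
  simp only [Pauli.app, hq, add_zero, Pi.single_eq_same, dotProduct_zero, sgn_zero, mul_one] at h0 h1
  rw [h0, one_mul, ← sgn_zero] at h1
  exact sgn_injective h1

lemma Pauli.app_of_pq_eq_zero {n : ℕ} (A : Pauli n) (hp : A.p = 0) (hq : A.q = 0) (ψ : Vec n) :
    A.app ψ = ipow A.r • ψ := by
  ext w
  simp [Pauli.app, hp, hq]

/-! The extraction algorithm. -/

@[simp] lemma makeUnitVec_val {n : ℕ} (i : Fin n) : (makeUnitVec i).val = unitVec i := by
  ext j
  simp [makeUnitVec, unitVec_apply]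

/-- The triple of the first column. -/
noncomputable def firstTriple {n : ℕ} (C : Mat n) : AffineTriple n :=
  (stateToTriple (column C 0)).val

/-- The generators of the stabiliser group of the first column. -/
noncomputable def generators {n : ℕ} (C : Mat n) (i : Fin n) : Pauli n :=
  ((tripleToCheckMatrix (firstTriple C)).val i).toPauli

/-- The first nonzero position in the column of weight one with number `j`. -/
noncomputable def position {n : ℕ} (C : Mat n) (j : Fin n) : Label n :=
  label (match (findFirst fun t : Fin (2 ^ n) => do
      let a ← op (C (label t) (unitVec j))
      op (decide (a ≠ 0))).val with
    | some t => (t : ℕ)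
    | none => 0)

/-- The signs with which the generators act on the columns of weight one. -/
noncomputable def signs {n : ℕ} (C : Mat n) (i j : Fin n) : ZMod 2 :=
  if (generators C i).app (column C (unitVec j)) (position C j) = C (position C j) (unitVec j)
  then 0 else 1

/-- The gates `U_i` that are extracted. -/
noncomputable def extractU {n : ℕ} (C : Mat n) (i : Fin n) : Pauli n :=
  (pauliMulPower (Pauli.one n) (generators C) ((rightInverse (signs C)).val i)).val

/-- The pairs `(q, p)` of the gates `U_i`. -/
def symplecticRows {n : ℕ} (U : Fin n → Pauli n) (i : Fin n) (c : Fin (n + n)) : ZMod 2 :=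
  Fin.append (U i).q (U i).p c

/-- The gates `W_i` of order two that anticommute with `U_i` only. -/
def antiGates {n : ℕ} (U : Fin n → Pauli n) (i : Fin n) : Pauli n :=
  PauliBits.toPauli ⟨fun c => (rightInverse (symplecticRows U)).val (Fin.castAdd n c) i,
    fun c => (rightInverse (symplecticRows U)).val (Fin.natAdd n c) i, 0⟩

/-- The position at which the columns are compared with those of `W_i C`. -/
noncomputable def comparePos {n : ℕ} (C : Mat n) (i : Fin n) : Label n :=
  (firstTriple C).shift + (antiGates (extractU C) i).q

/-- The phase between `C |e_i⟩` and `W_i C |0⟩`. -/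
noncomputable def comparePhase {n : ℕ} (C : Mat n) (i : Fin n) : ℂ :=
  C (comparePos C i) (makeUnitVec i).val / (antiGates (extractU C) i).app (column C 0) (comparePos C i)

/-- Whether the phase is imaginary. -/
noncomputable def compareD {n : ℕ} (C : Mat n) (i : Fin n) : ZMod 2 :=
  if comparePhase C i = Complex.I ∨ comparePhase C i = -Complex.I then 1 else 0

/-- The sign of the phase. -/
noncomputable def compareC {n : ℕ} (C : Mat n) (i : Fin n) : ZMod 2 :=
  if comparePhase C i = (-Complex.I) ^ (compareD C i).val then 0 else 1

/-- The signs by which the `W_i` have to be corrected. -/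
noncomputable def compareV {n : ℕ} (C : Mat n) (i : Fin n) : Label n := fun j =>
  if C (comparePos C i + (antiGates (extractU C) j).q) ((makeUnitVec i).val + (makeUnitVec j).val) =
    comparePhase C i * (antiGates (extractU C) i).app (column C (makeUnitVec j).val)
      (comparePos C i + (antiGates (extractU C) j).q) then 0 else 1

/-- The gates `V_i` that are extracted. -/
noncomputable def extractV {n : ℕ} (C : Mat n) (i : Fin n) : Pauli n :=
  (pauliMulPower ⟨(antiGates (extractU C) i).p, (antiGates (extractU C) i).q,
    (antiGates (extractU C) i).r + 2 * ((compareC C i).val : ZMod 4) +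
      3 * ((compareD C i).val : ZMod 4)⟩ (extractU C) (compareV C i)).val

lemma extractTuple_U {n : ℕ} (C : Mat n) : (extractTuple C).val.U = extractU C := by
  simp only [extractTuple, bind_val, table_val, makeUnitVec_val]
  rfl

/-- The correction of `W_i` to `V_i`. -/
noncomputable def correctGate {n : ℕ} (C : Mat n) (zero shift : Label n) (U W : Fin n → Pauli n)
    (i : Fin n) : Timed (Pauli n) := do
  let e ← makeUnitVec i
  let w ← vadd shift (W i).q
  let b ← pauliApply (W i) (column C zero) w
  let a ← op (C w e)
  let t ← op (a / b)
  let d ← op (if t = Complex.I ∨ t = -Complex.I then (1 : ZMod 2) else 0)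
  let c ← op (if t = (-Complex.I) ^ d.val then (0 : ZMod 2) else 1)
  let v ← table fun j => do
    let f ← makeUnitVec j
    let ef ← vadd e f
    let w' ← vadd w (W j).q
    let b ← pauliApply (W i) (column C f) w'
    let a ← op (C w' ef)
    let tb ← op (t * b)
    op (if a = tb then (0 : ZMod 2) else 1)
  let r ← op ((W i).r + 2 * (c.val : ZMod 4) + 3 * (d.val : ZMod 4))
  pauliMulPower ⟨(W i).p, (W i).q, r⟩ U v

lemma extractTuple_V_eq {n : ℕ} (C : Mat n) : (extractTuple C).val.V = fun i =>
    (correctGate C 0 (firstTriple C).shift (extractTuple C).val.U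
      (antiGates (extractTuple C).val.U) i).val := rfl

lemma correctGate_val {n : ℕ} (C : Mat n) (i : Fin n) :
    (correctGate C 0 (firstTriple C).shift (extractU C) (antiGates (extractU C)) i).val =
      extractV C i := rfl

lemma extractTuple_V {n : ℕ} (C : Mat n) : (extractTuple C).val.V = extractV C := by
  rw [extractTuple_V_eq, extractTuple_U]
  exact funext (correctGate_val C)

/-! Correctness of the extraction. -/

section Rows

variable {n : ℕ} {U : Fin n → Pauli n} {M : Mat n}

/-- A relation makes `U^x` a scalar. Yet it acts on column `z` by `(-1)^(x·z)`, which is the same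
for all `z` only if `x = 0`. -/
lemma symplecticRows_independent (hU : ∀ i z, (U i).app (column M z) = sgn (z i) • column M z)
    (hne : ∀ z, column M z ≠ 0) (x : Label n) (hx : comb x (symplecticRows U) = 0) : x = 0 := by
  have hq : comb x (fun i => (U i).q) = 0 := by
    ext c
    have := congrFun hx (Fin.castAdd n c)
    simpa [comb, symplecticRows, Fin.append_left] using this
  have hp : comb x (fun i => (U i).p) = 0 := by
    ext c
    have := congrFun hx (Fin.natAdd n c)
    simp only [comb, symplecticRows, Fin.append_right] at this
    exact this
  set B := (pauliMulPower (Pauli.one n) U x).val with hB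
  have hBp : B.p = 0 := by rw [hB, pauliMulPower_p, hp]; rfl
  have hBq : B.q = 0 := by rw [hB, pauliMulPower_q, hq]; rfl
  have key : ∀ z, sgn (x ⬝ᵥ z) = ipow B.r := by
    intro z
    have h1 := pauliMulPower_app (Pauli.one n) U x z fun j => hU j z
    rw [← hB, B.app_of_pq_eq_zero hBp hBq, Pauli.app_one] at h1
    obtain ⟨w, hw⟩ := Function.ne_iff.1 (hne z)
    exact (mul_right_cancel₀ hw (congrFun h1 w)).symm
  refine label_ext_dotProduct fun z => sgn_injective ?_
  rw [key, ← key 0, dotProduct_zero]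

/-- The rows list `q` before `p`, so their product with a column of the right inverse, split into
`p` and `q` of `W_i`, is the symplectic form. -/
lemma omega_antiGates (hU : ∀ i z, (U i).app (column M z) = sgn (z i) • column M z)
    (hne : ∀ z, column M z ≠ 0) (i j : Fin n) :
    (U j).omega (antiGates U i) = if i = j then 1 else 0 := by
  have h := congrFun (rightInverse_spec (symplecticRows U)
    (symplecticRows_independent hU hne) (unitVec j)) i
  rw [unitVec_comb, unitVec_apply] at h
  rw [← h, comb, Fin.sum_univ_add]
  simp only [symplecticRows, Fin.append_left, Fin.append_right, Pauli.omega, antiGates,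
    PauliBits.toPauli, dotProduct]
  rw [add_comm]

end Rows

lemma antiGates_app_app {n : ℕ} (U : Fin n → Pauli n) (i : Fin n) (ψ : Vec n) :
    (antiGates U i).app ((antiGates U i).app ψ) = ψ := by
  rw [Pauli.app_app]
  have : ∀ d : ZMod 2, ipow (2 * (2 * ((0 : ZMod 2).val : ZMod 4) + 3 * (d.val : ZMod 4))) *
      sgn d = 1 := by
    intro d
    rcases bit_cases d with rfl | rfl
    · simp
    · have : (2 * (2 * ((0 : ZMod 2).val : ZMod 4) + 3 * ((1 : ZMod 2).val : ZMod 4))) = 2 := by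
        decide
      rw [this]; simp
  exact (congrArg (· • ψ) (this _)).trans (one_smul _ _)

/-- Two equality tests identify a fourth root of unity as `(-1)^c (-i)^d`. -/
lemma phase_of_cases {t : ℂ} (ht : t = 1 ∨ t = -1 ∨ t = Complex.I ∨ t = -Complex.I) (d c : ZMod 2)
    (hd : d = if t = Complex.I ∨ t = -Complex.I then 1 else 0)
    (hc : c = if t = (-Complex.I) ^ d.val then 0 else 1) :
    ipow (2 * (c.val : ZMod 4) + 3 * (d.val : ZMod 4)) = t := by
  have hI1 : 1 ≠ Complex.I := fun h => by simpa using congrArg Complex.re h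
  have hI2 : 1 ≠ -Complex.I := fun h => by simpa using congrArg Complex.re h
  have hI3 : -1 ≠ Complex.I := fun h => by simpa using congrArg Complex.re h
  have hI4 : Complex.I ≠ -Complex.I := fun h => by
    have := congrArg Complex.im h
    norm_num at this
  have hone : (-1 : ℂ) ≠ 1 := by norm_num
  rw [ipow_add, ipow_two_mul_val, ipow_three_mul_val]
  rcases ht with rfl | rfl | rfl | rfl
  · simp only [hI1, hI2, or_self, if_false] at hd
    subst hd
    simp only [ZMod.val_zero, pow_zero, if_true] at hc
    simp [hc]
  · simp only [hI3, neg_inj, hI1, or_self, if_false] at hd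
    subst hd
    simp only [ZMod.val_zero, pow_zero, hone, if_false] at hc
    simp [hc]
  · simp only [true_or, if_true] at hd
    subst hd
    simp only [ZMod.val_one, pow_one, hI4, if_false] at hc
    simp [hc, ZMod.val_one]
  · simp only [or_true, if_true] at hd
    subst hd
    simp only [ZMod.val_one, pow_one, if_true] at hc
    simp [hc, ZMod.val_one]

section Clifford

variable {n : ℕ} {C : Mat n} {U V : Fin n → Pauli n}

lemma column_ne_zero (hC : C.conjTranspose * C = 1) (z : Label n) : column C z ≠ 0 := by
  intro h
  have h1 : (C.conjTranspose * C) z z = star (column C z) ⬝ᵥ column C z := rfl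
  rw [hC, h] at h1
  simp at h1

lemma star_dotProduct_self {n : ℕ} (φ : Vec n) :
    star φ ⬝ᵥ φ = ((∑ w, ‖φ w‖ ^ 2 : ℝ) : ℂ) := by
  rw [dotProduct]
  push_cast
  refine Finset.sum_congr rfl fun w _ => ?_
  rw [Pi.star_apply, Complex.star_def, Complex.conj_mul']

lemma sum_norm_column (hC : C.conjTranspose * C = 1) (z : Label n) :
    ∑ w, ‖column C z w‖ ^ 2 = 1 := by
  have h1 : (C.conjTranspose * C) z z = star (column C z) ⬝ᵥ column C z := rfl
  rw [hC, Matrix.one_apply_eq] at h1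
  rw [star_dotProduct_self] at h1
  exact_mod_cast h1.symm

/-- The first column of a Clifford gate is a stabiliser state. -/
lemma IsTableau.isStabiliserState (h : IsTableau U V C) (hC : C.conjTranspose * C = 1) :
    IsStabiliserState (column C 0) := by
  refine isStabiliserState_of_fixed (sum_norm_column hC 0) fun φ hφ => ?_
  -- The `U_i` fix the first column, so whatever is fixed by its whole stabiliser lies in their
  -- joint eigenspace for label zero.
  refine eq_smul_column h.U_app (column_ne_zero hC) 0 φ fun i => ?_
  have h1 := h.U_app i 0
  rw [Pi.zero_apply, sgn_zero, one_smul] at h1 ⊢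
  exact hφ _ h1

/-- A Pauli gate that fixes the first column acts on the columns by signs. -/
lemma IsTableau.app_of_fixed (h : IsTableau U V C) {P : Pauli n}
    (hP : P.app (column C 0) = column C 0) (z : Label n) :
    P.app (column C z) = sgn ((fun j => P.omega (V j)) ⬝ᵥ z) • column C z := by
  induction z using label_induction with
  | h0 => rw [hP, dotProduct_zero, sgn_zero, one_smul]
  | hs z i ih =>
    rw [← h.V_app, Pauli.app_comm, ih, Pauli.app_smul, smul_smul, dotProduct_add,
      dotProduct_unitVec, sgn_add, mul_comm]

lemma position_ne_zero (hC : C.conjTranspose * C = 1) (j : Fin n) :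
    C (position C j) (unitVec j) ≠ 0 := by
  obtain ⟨w, hw⟩ := Function.ne_iff.1 (column_ne_zero hC (unitVec j))
  obtain ⟨t, rfl⟩ := (label_bijective n).2 w
  obtain ⟨s, hs, hs'⟩ := findFirst_isSome (f := fun t : Fin (2 ^ n) => do
      let a ← op (C (label t) (unitVec j))
      op (decide (a ≠ 0))) (i := t) (decide_eq_true hw)
  unfold position
  rw [hs]
  exact of_decide_eq_true hs'

/-- The generators of the stabiliser group act on the columns with the signs that are found. -/
lemma IsTableau.generators_app (h : IsTableau U V C) (hC : C.conjTranspose * C = 1) (i : Fin n)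
    (z : Label n) : (generators C i).app (column C z) = sgn (signs C i ⬝ᵥ z) • column C z := by
  have hrep := represents_of_isStabiliserState (h.isStabiliserState hC)
  have h1 := h.app_of_fixed (hrep.checkMatrix_app i)
  -- One nonzero entry suffices to tell the two possible signs apart.
  have h2 : signs C i = fun j => (generators C i).omega (V j) := by
    ext j
    unfold signs
    have h3 := congrFun (h1 (unitVec j)) (position C j)
    rw [dotProduct_unitVec, Pi.smul_apply, smul_eq_mul] at h3
    have h4 : (generators C i).app (column C (unitVec j)) (position C j) =
      sgn ((generators C i).omega (V j)) * C (position C j) (unitVec j) := h3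
    rw [h4]
    rcases bit_cases ((generators C i).omega (V j)) with h0 | h0
    · rw [h0, sgn_zero, one_mul, if_pos rfl]
    · rw [h0, sgn_one, neg_one_mul, if_neg (neg_ne_self.2 (position_ne_zero hC j))]
  rw [h2]
  exact h1 z

/-- A relation makes a product of generators fix every column, so it is the identity as `C` is
invertible. Its `p` and `q` parts vanish, which contradicts the independence of the check matrix
unless `x = 0`. -/
lemma IsTableau.signs_independent (h : IsTableau U V C) (hC : C.conjTranspose * C = 1)
    (x : Label n) (hx : comb x (signs C) = 0) : x = 0 := by
  have hrep := represents_of_isStabiliserState (h.isStabiliserState hC)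
  set B := (pauliMulPower (Pauli.one n) (generators C) x).val with hB
  have hcol : ∀ z, B.app (column C z) = column C z := fun z => by
    have h1 := pauliMulPower_app (Pauli.one n) (generators C) x (fun j => signs C j ⬝ᵥ z)
      fun j => h.generators_app hC j z
    rw [← hB, Pauli.app_one, ← comb_dotProduct, hx, zero_dotProduct, sgn_zero, one_smul] at h1
    exact h1
  have hmat : B.toMat = 1 := by
    have h1 : B.toMat * C = C := mat_ext_column fun z => by
      rw [column_mul, Pauli.toMat_mulVec, hcol]
    calc B.toMat = B.toMat * (C * C.conjTranspose) := by rw [mul_eq_one_comm.1 hC, mul_one]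
      _ = 1 := by rw [← mul_assoc, h1, mul_eq_one_comm.1 hC]
  obtain ⟨hp, hq⟩ := B.pq_eq_zero fun ψ => by
    rw [← Pauli.toMat_mulVec, hmat, Matrix.one_mulVec]
  rw [hB, pauliMulPower_p] at hp
  rw [hB, pauliMulPower_q] at hq
  exact hrep.checkMatrix_independent x ((zero_add _).symm.trans hp) ((zero_add _).symm.trans hq)

/-- The extracted gates `U_i` are correct. -/
lemma IsTableau.extractU_app (h : IsTableau U V C) (hC : C.conjTranspose * C = 1) (i : Fin n)
    (z : Label n) : (extractU C i).app (column C z) = sgn (z i) • column C z := by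
  have h1 := pauliMulPower_app (Pauli.one n) (generators C) ((rightInverse (signs C)).val i)
    (fun j => signs C j ⬝ᵥ z) fun j => h.generators_app hC j z
  have h2 := rightInverse_spec' (signs C) (h.signs_independent hC) (unitVec i)
  rw [unitVec_comb] at h2
  rw [← comb_dotProduct, h2, unitVec_dotProduct, Pauli.app_one] at h1
  exact h1

/-- How the gates `W_i` act on the columns. -/
lemma IsTableau.antiGates_app (h : IsTableau U V C) (hC : C.conjTranspose * C = 1) (i : Fin n) :
    ∃ (s : ℂ) (v : Label n), (s = 1 ∨ s = -1 ∨ s = Complex.I ∨ s = -Complex.I) ∧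
      ∀ z, (antiGates (extractU C) i).app (column C z) =
        (s * sgn (v ⬝ᵥ z)) • column C (z + unitVec i) := by
  set W := antiGates (extractU C) i with hW
  have hU := h.extractU_app hC
  have hne := column_ne_zero hC
  -- By the commutation signs, `W_i C|0⟩` has the eigenvalues of column `e_i`.
  obtain ⟨s, hs⟩ := eq_smul_column hU hne (unitVec i) (W.app (column C 0)) fun j => by
    rw [Pauli.app_comm, hU, hW, omega_antiGates hU hne, Pi.zero_apply, sgn_zero, one_smul,
      unitVec_apply]
    simp only [eq_comm]
  -- The true gates `V_j` carry the relation from column to column; each one changes it by its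
  -- commutation sign with `W_i`.
  have hall : ∀ z, W.app (column C z) =
      (s * sgn ((fun j => W.omega (V j)) ⬝ᵥ z)) • column C (z + unitVec i) := by
    intro z
    induction z using label_induction with
    | h0 => rw [hs, dotProduct_zero, sgn_zero, mul_one, zero_add]
    | hs z j ih =>
      rw [← h.V_app, Pauli.app_comm, ih, Pauli.app_smul, h.V_app, smul_smul, dotProduct_add,
        dotProduct_unitVec, sgn_add, add_right_comm]
      congr 1
      ring
  refine ⟨s, _, sq_cases ?_, hall⟩
  have h1 := antiGates_app_app (extractU C) i (column C 0)
  rw [← hW, hs, Pauli.app_smul, hall, label_add_self, smul_smul] at h1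
  obtain ⟨w, hw⟩ := Function.ne_iff.1 (hne 0)
  have h2 : s * (s * sgn ((fun j => W.omega (V j)) ⬝ᵥ unitVec i)) = 1 :=
    mul_right_cancel₀ hw ((congrFun h1 w).trans (one_mul _).symm)
  rcases bit_cases ((fun j => W.omega (V j)) ⬝ᵥ unitVec i) with h0 | h0 <;> rw [h0] at h2
  · left; simpa using h2
  · right
    rw [sgn_one] at h2
    linear_combination (-1 : ℂ) * h2

/-- The extracted gates `V_i` are correct. -/
lemma IsTableau.extractV_app (h : IsTableau U V C) (hC : C.conjTranspose * C = 1) (i : Fin n)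
    (z : Label n) : (extractV C i).app (column C z) = column C (z + unitVec i) := by
  have hrep := represents_of_isStabiliserState (h.isStabiliserState hC)
  have hU := h.extractU_app hC
  obtain ⟨s, v, hs, hW⟩ := h.antiGates_app hC i
  have hs0 : s ≠ 0 := by rcases hs with rfl | rfl | rfl | rfl <;> simp
  set W := antiGates (extractU C) with hWdef
  have hshift : column C 0 (firstTriple C).shift ≠ 0 := hrep.shift_ne
  -- The known nonzero entry of the first column is moved by `W_j` to one of column `e_j`; no search
  -- is necessary.
  have hnz : ∀ j, column C (unitVec j) ((firstTriple C).shift + (W j).q) ≠ 0 := by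
    intro j
    obtain ⟨s', v', -, hW'⟩ := h.antiGates_app hC j
    have h1 := (W j).app_ne_zero hshift
    rw [hW' 0, zero_add] at h1
    exact right_ne_zero_of_mul h1
  have ht : comparePhase C i = s⁻¹ := by
    unfold comparePhase
    rw [makeUnitVec_val]
    have h1 : (W i).app (column C 0) (comparePos C i) = s * C (comparePos C i) (unitVec i) := by
      rw [hW 0, dotProduct_zero, sgn_zero, mul_one, zero_add]; rfl
    have h2 : C (comparePos C i) (unitVec i) ≠ 0 := hnz i
    rw [h1]
    field_simp
  have ht' : comparePhase C i = 1 ∨ comparePhase C i = -1 ∨ comparePhase C i = Complex.I ∨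
      comparePhase C i = -Complex.I := by
    rw [ht]
    rcases hs with rfl | rfl | rfl | rfl <;> simp
  have hphase := phase_of_cases ht' (compareD C i) (compareC C i) rfl rfl
  have hv : compareV C i = v := by
    ext j
    unfold compareV
    rw [makeUnitVec_val, makeUnitVec_val]
    have h1 := congrFun (hW (unitVec j)) (comparePos C i + (W j).q)
    have h2 : (W i).app (column C (unitVec j)) (comparePos C i + (W j).q) =
        s * sgn (v j) * C (comparePos C i + (W j).q) (unitVec i + unitVec j) := by
      rw [h1, dotProduct_unitVec, add_comm (unitVec j)]; rfl
    -- Applying `W_i` to the nonzero entry of column `e_j` gives a nonzero entry of column `e_i +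
    -- e_j`.
    have h3 : C (comparePos C i + (W j).q) (unitVec i + unitVec j) ≠ 0 := by
      have h4 := (W i).app_ne_zero (hnz j)
      rw [add_right_comm] at h4
      intro h5
      rw [h5, mul_zero] at h2
      exact h4 h2
    rw [h2, ht, mul_assoc, inv_mul_cancel_left₀ hs0]
    rcases bit_cases (v j) with h0 | h0
    · rw [h0, sgn_zero, one_mul, if_pos rfl]
    · rw [h0, sgn_one, neg_one_mul, if_neg (self_ne_neg.2 h3)]
  unfold extractV
  rw [pauliMulPower_app _ _ _ _ fun j => hU j z, hv]
  have h1 : (⟨(W i).p, (W i).q, (W i).r + 2 * ((compareC C i).val : ZMod 4) +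
      3 * ((compareD C i).val : ZMod 4)⟩ : Pauli n).app (column C z) =
      s⁻¹ • (W i).app (column C z) := by
    ext w
    simp only [Pauli.app, Pi.smul_apply, smul_eq_mul]
    rw [add_assoc, ipow_add, hphase, ht]
    ring
  rw [h1, hW, smul_smul, smul_smul]
  -- The factor `U^v` contributes the sign `(-1)^(v·z)` a second time, and the phase correction
  -- contributes the inverse of `s`.
  have h2 : sgn (v ⬝ᵥ z) * (s⁻¹ * (s * sgn (v ⬝ᵥ z))) = 1 := by
    rw [inv_mul_cancel_left₀ hs0, sgn_mul_self]
  rw [mul_assoc, h2, one_smul]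

lemma IsTableau.extract (h : IsTableau U V C) (hC : C.conjTranspose * C = 1) :
    IsTableau (extractU C) (extractV C) C :=
  ⟨h.extractU_app hC, h.extractV_app hC⟩

end Clifford

/-! ### From Pauli gates to bits. -/

/-- Gates whose square is the identity have real signs. -/
lemma Pauli.r_of_app_app {n : ℕ} {P : Pauli n} {ψ : Vec n} (hψ : ψ ≠ 0)
    (h : P.app (P.app ψ) = ψ) :
    P.r = 3 * ((P.p ⬝ᵥ P.q).val : ZMod 4) ∨ P.r = 3 * ((P.p ⬝ᵥ P.q).val : ZMod 4) + 2 := by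
  rw [Pauli.app_app] at h
  obtain ⟨w, hw⟩ := Function.ne_iff.1 hψ
  have h1 : ipow (2 * P.r) * sgn (P.p ⬝ᵥ P.q) = 1 :=
    mul_right_cancel₀ hw ((congrFun h w).trans (one_mul _).symm)
  rw [← ipow_two_mul_val, ← ipow_add, ← ipow_zero] at h1
  have key : ∀ (r : ZMod 4) (d : ZMod 2), 2 * r + 2 * (d.val : ZMod 4) = 0 →
      r = 3 * (d.val : ZMod 4) ∨ r = 3 * (d.val : ZMod 4) + 2 := by decide
  exact key _ _ (ipow_injective h1)

lemma Pauli.app_app_of_r {n : ℕ} {P : Pauli n}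
    (h : P.r = 3 * ((P.p ⬝ᵥ P.q).val : ZMod 4) ∨ P.r = 3 * ((P.p ⬝ᵥ P.q).val : ZMod 4) + 2)
    (ψ : Vec n) : P.app (P.app ψ) = ψ := by
  rw [Pauli.app_app, ← ipow_two_mul_val, ← ipow_add]
  have key : ∀ (r : ZMod 4) (d : ZMod 2), (r = 3 * (d.val : ZMod 4) ∨
      r = 3 * (d.val : ZMod 4) + 2) → 2 * r + 2 * (d.val : ZMod 4) = 0 := by decide
  rw [key _ _ h, ipow_zero, one_smul]

lemma toBits_toMatrix {n : ℕ} {P : Pauli n}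
    (h : P.r = 3 * ((P.p ⬝ᵥ P.q).val : ZMod 4) ∨ P.r = 3 * ((P.p ⬝ᵥ P.q).val : ZMod 4) + 2) :
    (toBits P).val.toMatrix = P.toMat := by
  have h1 : (toBits P).val = ⟨P.p, P.q, if P.r = 3 * ((P.p ⬝ᵥ P.q).val : ZMod 4) then 0 else 1⟩ :=
    rfl
  rw [h1, PauliBits.toMatrix, Pauli.toMat]
  congr 1
  rw [← ipow_three_mul_val]
  simp only
  rcases h with h | h
  · rw [if_pos h, h]; simp
  · rw [if_neg, h, ipow_add]
    · simp [ZMod.val_one]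
    · rw [h]
      have : ∀ a : ZMod 4, a + 2 ≠ a := by decide
      exact this _

/-- The extraction algorithm is correct. -/
lemma cliffordToTableau_correct {n : ℕ} {C : Mat n} (hC : IsClifford C) :
    IsConjugateTupleOf (cliffordToTableau C).val C := by
  obtain ⟨hCC, U, V, h⟩ := (isClifford_iff C).1 hC
  have hT := h.extract hCC
  have hCC' := mul_eq_one_comm.1 hCC
  have hval : ∀ i, (cliffordToTableau C).val i =
      ((toBits (extractU C i)).val, (toBits (extractV C i)).val) := fun i => by
    rw [← extractTuple_U, ← extractTuple_V]; rfl
  intro i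
  rw [hval]
  constructor
  · rw [toBits_toMatrix (Pauli.r_of_app_app (column_ne_zero hCC 0) _)]
    · rw [← toMat_mul_eq_zGate_iff.2 fun z => by rw [hT.U_app i z, unitVec_dotProduct], mul_assoc,
        hCC', mul_one]
    · rw [hT.U_app, Pi.zero_apply, sgn_zero, one_smul, hT.U_app, Pi.zero_apply, sgn_zero, one_smul]
  · rw [toBits_toMatrix (Pauli.r_of_app_app (column_ne_zero hCC 0) _)]
    · rw [← toMat_mul_eq_xGate_iff.2 (hT.V_app i), mul_assoc, hCC', mul_one]
    · rw [hT.V_app, hT.V_app, label_add_add_cancel]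

/-! The walk along the Gray code. -/

/-- The `t`-th label of the Gray code. -/
def gray {n : ℕ} (t : ℕ) : Label n := fun i =>
  (if t.testBit i then 1 else 0) + if t.testBit (i + 1) then 1 else 0

lemma gray_zero {n : ℕ} : (gray 0 : Label n) = 0 := by
  ext i; simp [gray]

/-- Subtracting one from a number whose lowest digit one is at position `i` clears that digit and
sets all lower ones. -/
lemma testBit_of_succ (i : ℕ) : ∀ t : ℕ, (∀ j < i, (t + 1).testBit j = false) →
    (t + 1).testBit i = true → ∀ j, t.testBit j =
      if j < i then true else if j = i then false else (t + 1).testBit j := by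
  induction i with
  | zero =>
    intro t _ h j
    rw [Nat.testBit_zero, decide_eq_true_iff] at h
    cases j with
    | zero => simp; omega
    | succ j =>
      rw [Nat.testBit_succ, Nat.testBit_succ, show (t + 1) / 2 = t / 2 by omega]
      simp
  | succ i ih =>
    intro t h0 h j
    have h1 := h0 0 (Nat.succ_pos i)
    rw [Nat.testBit_zero, decide_eq_false_iff_not] at h1
    have h2 : (t + 1) / 2 = t / 2 + 1 := by omega
    cases j with
    | zero => simp; omega
    | succ j =>
      have := ih (t / 2) (fun j hj => by
        rw [← h2, ← Nat.testBit_succ]; exact h0 _ (Nat.succ_lt_succ hj))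
        (by rw [← h2, ← Nat.testBit_succ]; exact h) j
      rw [Nat.testBit_succ, this, Nat.testBit_succ (t + 1), h2]
      simp

/-- Digit `j` of the code adds the digits `j` and `j + 1` of `t`. Incrementing flips all digits up
to `i`, so both summands flip for `j < i` and just one of them for `j = i`. -/
lemma gray_succ {n : ℕ} {t : ℕ} {i : Fin n} (h0 : ∀ j < (i : ℕ), (t + 1).testBit j = false)
    (h1 : (t + 1).testBit i = true) : gray (t + 1) = gray t + unitVec i := by
  ext j
  have h := testBit_of_succ i t h0 h1
  simp only [gray, Pi.add_apply, unitVec_apply, h j, h (j + 1), Fin.ext_iff]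
  have h2 : (1 : ZMod 2) + 1 = 0 := by decide
  rcases lt_trichotomy (j : ℕ) i with hj | hj | hj
  · rw [h0 j hj]
    rcases Nat.lt_or_ge (j + 1) i with hj' | hj'
    · rw [h0 _ hj']
      simp [hj, hj', hj.ne, h2]
    · have : (j : ℕ) + 1 = i := by omega
      simp [this, h1, hj, hj.ne]
  · simp [hj, h1, add_comm]
  · simp [hj.ne', hj.not_gt, show ¬ (j : ℕ) + 1 < i by omega, show ¬ (j : ℕ) + 1 = i by omega]

/-- The Gray code visits every label. -/
lemma exists_gray {n : ℕ} (z : Label n) : ∃ t < 2 ^ n, gray t = z := by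
  -- The code takes sums of adjacent digits, so it is inverted by the sums over all higher
  -- positions.
  obtain ⟨t, ht⟩ := (label_bijective n).2 fun i => ∑ j with i ≤ j, z j
  refine ⟨t, t.2, ?_⟩
  ext i
  have hbit : ∀ k : Fin n, (if (t : ℕ).testBit k then (1 : ZMod 2) else 0) = ∑ j with k ≤ j, z j :=
    fun k => congrFun ht k
  rw [gray, hbit]
  have hsplit : (Finset.univ.filter fun j => i ≤ j) =
      insert i (Finset.univ.filter fun j => i < j) := by
    ext j; simp [le_iff_eq_or_lt, eq_comm]
  rw [hsplit, Finset.sum_insert (by simp)]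
  have hnext : (if (t : ℕ).testBit (i + 1) then (1 : ZMod 2) else 0) = ∑ j with i < j, z j := by
    by_cases hi : (i : ℕ) + 1 < n
    · exact (hbit ⟨i + 1, hi⟩).trans (by rfl)
    · rw [Nat.testBit_lt_two_pow (lt_of_lt_of_le t.2 (Nat.pow_le_pow_right two_pos (by omega)))]
      rw [Finset.sum_eq_zero]
      · simp
      · intro j hj
        simp only [Finset.mem_filter, Finset.mem_univ, true_and, Fin.lt_def] at hj
        omega
  rw [hnext, add_assoc, bit_add_self, add_zero]

/-- One step of the walk along the Gray code. -/
noncomputable def grayStep {n : ℕ} (V : Fin n → Pauli n) (M : Mat n) (t : Fin (2 ^ n - 1))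
    (s : GrayState n) : Timed (GrayState n) := do
  let bit ← findFirst fun i : Fin n => op (Nat.testBit ((t : ℕ) + 1) i)
  match bit with
  | none => pure s
  | some i => do
    let e ← makeUnitVec i
    let z ← vadd s.z e
    let w ← vadd s.w (V i).q
    let b ← pauliApply (V i) (column M s.z) w
    let a ← op (M w z)
    let ok ← op (s.ok && decide (b = a))
    pure ⟨z, w, ok⟩

/-- Since `0 < t + 1 < 2^n`, some digit within range is one, so the search succeeds; the first hit
is the lowest such digit, as `gray_succ` requires. -/
lemma grayStep_val {n : ℕ} (V : Fin n → Pauli n) (M : Mat n) (t : Fin (2 ^ n - 1))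
    (s : GrayState n) : ∃ i : Fin n, gray (t + 1) = (gray t + unitVec i : Label n) ∧
      (grayStep V M t s).val = ⟨s.z + unitVec i, s.w + (V i).q,
        s.ok && decide ((V i).app (column M s.z) (s.w + (V i).q) =
          M (s.w + (V i).q) (s.z + unitVec i))⟩ := by
  have ht : (t : ℕ) + 1 < 2 ^ n := by omega
  obtain ⟨j, hj⟩ : ∃ j, ((t : ℕ) + 1).testBit j = true := Nat.exists_testBit_of_ne_zero (by omega)
  have hjn : j < n := by
    by_contra h
    rw [Nat.testBit_lt_two_pow (lt_of_lt_of_le ht (Nat.pow_le_pow_right two_pos (by omega)))] at hj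
    exact Bool.false_ne_true hj
  set f : Fin n → Timed Bool := fun i => op (Nat.testBit ((t : ℕ) + 1) i) with hf
  obtain ⟨i, hi, hi'⟩ := findFirst_isSome (f := f) (i := ⟨j, hjn⟩) hj
  have hmin : ∀ k < (i : ℕ), ((t : ℕ) + 1).testBit k = false := by
    intro k hk
    have h1 := List.find?_eq_some_iff_getElem.1 hi
    obtain ⟨-, l, hl, hli, hlt⟩ := h1
    have hl' : l = i := by simpa using congrArg Fin.val hli
    have h2 := hlt k (by omega)
    simpa [hf] using h2
  refine ⟨i, gray_succ hmin hi', ?_⟩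
  unfold grayStep
  rw [bind_val, ← hf, hi, ← makeUnitVec_val]
  rfl

lemma checkGray_val {n : ℕ} (V : Fin n → Pauli n) (M : Mat n) (z₀ : Label n) :
    (checkGray V M z₀).val =
      (loop (2 ^ n - 1) (grayStep V M) ⟨0, z₀, decide (M z₀ 0 ≠ 0)⟩).val.ok := rfl

lemma checkGray_of_app {n : ℕ} {V : Fin n → Pauli n} {M : Mat n} {z₀ : Label n}
    (hV : ∀ i z, (V i).app (column M z) = column M (z + unitVec i)) (h0 : M z₀ 0 ≠ 0) :
    (checkGray V M z₀).val = true := by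
  rw [checkGray_val]
  refine loop_invariant (fun _ (s : GrayState n) => s.ok = true) _ _ _ (decide_eq_true h0) fun t s hs => ?_
  obtain ⟨i, -, hi⟩ := grayStep_val V M t s
  rw [hi, hV]
  simp only [hs, Bool.true_and]
  exact decide_eq_true rfl

/-- What a successful walk along the Gray code proves. -/
lemma of_checkGray {n : ℕ} {V : Fin n → Pauli n} {M : Mat n} {z₀ : Label n}
    (h : (checkGray V M z₀).val = true) : (∀ z, column M z ≠ 0) ∧
      ∀ t < 2 ^ n - 1, ∃ (i : Fin n) (w : Label n),
        gray (t + 1) = (gray t + unitVec i : Label n) ∧ M w (gray (t + 1)) ≠ 0 ∧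
        (V i).app (column M (gray t)) w = M w (gray (t + 1)) := by
  rw [checkGray_val] at h
  -- Everything except the label is conditional on the flag, because the walk continues after a
  -- failed check. A nonzero position is carried along, so every comparison that succeeds also
  -- proves the next column nonzero.
  have key := loop_invariant (fun t (s : GrayState n) => s.z = gray t ∧ (s.ok = true →
    M s.w s.z ≠ 0 ∧ (∀ t' ≤ t, column M (gray t') ≠ 0) ∧ ∀ t' < t, ∃ (i : Fin n) (w : Label n),
        gray (t' + 1) = (gray t' + unitVec i : Label n) ∧ M w (gray (t' + 1)) ≠ 0 ∧
        (V i).app (column M (gray t')) w = M w (gray (t' + 1))))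
    (2 ^ n - 1) (grayStep V M) ⟨0, z₀, decide (M z₀ 0 ≠ 0)⟩ ⟨gray_zero.symm, fun h0 => by
      have h0' := of_decide_eq_true h0
      refine ⟨h0', fun t' ht' => ?_, fun t' ht' => absurd ht' (Nat.not_lt_zero _)⟩
      rw [Nat.le_zero.1 ht', gray_zero]
      exact fun h1 => h0' (congrFun h1 z₀)⟩ fun t s hs => by
      obtain ⟨i, hg, hi⟩ := grayStep_val V M t s
      obtain ⟨hz, hs⟩ := hs
      rw [hi]
      refine ⟨by rw [hg, hz], fun hok => ?_⟩
      simp only [Bool.and_eq_true, decide_eq_true_eq] at hok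
      obtain ⟨hok1, hok2⟩ := hok
      obtain ⟨h1, h2, h3⟩ := hs hok1
      have h4 : M (s.w + (V i).q) (s.z + unitVec i) ≠ 0 := by
        rw [← hok2]; exact (V i).app_ne_zero h1
      rw [hz, ← hg] at h4 hok2
      refine ⟨by rw [hz, ← hg]; exact h4, fun t' ht' => ?_, fun t' ht' => ?_⟩
      · rcases Nat.lt_or_eq_of_le ht' with ht' | rfl
        · exact h2 t' (Nat.lt_succ_iff.1 ht')
        · exact fun h5 => h4 (congrFun h5 _)
      · rcases Nat.lt_or_eq_of_le (Nat.lt_succ_iff.1 ht') with ht' | rfl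
        · exact h3 t' ht'
        · exact ⟨i, _, hg, h4, hok2⟩
  obtain ⟨-, h2, h3⟩ := key.2 h
  refine ⟨fun z => ?_, h3⟩
  obtain ⟨t, ht, rfl⟩ := exists_gray z
  exact h2 t (by omega)

/-! Commuting involutions. -/

/-- Apply the gates `V_i` with `z i = 1` and `i` in the list. -/
noncomputable def applyList {n : ℕ} (V : Fin n → Pauli n) (ψ : Vec n) (z : Label n) :
    List (Fin n) → Vec n
  | [] => ψ
  | j :: L => if z j = 1 then (V j).app (applyList V ψ z L) else applyList V ψ z L

section Involutions

variable {n : ℕ} {V : Fin n → Pauli n} {ψ : Vec n}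

lemma applyList_of_not_mem (z : Label n) {i : Fin n} :
    ∀ {L : List (Fin n)}, i ∉ L → applyList V ψ (z + unitVec i) L = applyList V ψ z L
  | [], _ => rfl
  | j :: L, h => by
    rw [List.mem_cons, not_or] at h
    rw [applyList, applyList, applyList_of_not_mem z h.2, Pi.add_apply, unitVec_apply,
      if_neg (Ne.symm h.1), add_zero]

/-- The gate `V_i` commutes past the others to its own place in the product, where it is inserted if
absent and cancels if present. -/
lemma app_applyList (hsq : ∀ i φ, (V i).app ((V i).app φ) = φ)
    (hcomm : ∀ i j φ, (V i).app ((V j).app φ) = (V j).app ((V i).app φ)) (z : Label n)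
    {i : Fin n} : ∀ {L : List (Fin n)}, L.Nodup → i ∈ L →
      (V i).app (applyList V ψ z L) = applyList V ψ (z + unitVec i) L
  | [], _, h => absurd h (List.not_mem_nil)
  | j :: L, hL, h => by
    rw [List.nodup_cons] at hL
    rw [applyList, applyList, Pi.add_apply, unitVec_apply]
    by_cases hj : j = i
    · subst hj
      rw [applyList_of_not_mem z hL.1, if_pos rfl]
      rcases bit_cases (z j) with h0 | h0 <;> simp [h0, hsq, bit_add_self]
    · have h' : i ∈ L := (List.mem_cons.1 h).resolve_left fun h => hj h.symm
      rw [if_neg hj, add_zero, ← app_applyList hsq hcomm z hL.2 h']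
      split_ifs
      · rw [hcomm]
      · rfl

/-- Gates that map the columns of `M` to each other along the Gray code do so everywhere. -/
lemma app_column_of_gray {M : Mat n} (hsq : ∀ i φ, (V i).app ((V i).app φ) = φ)
    (hcomm : ∀ i j φ, (V i).app ((V j).app φ) = (V j).app ((V i).app φ))
    (hgray : ∀ t < 2 ^ n - 1, ∃ i : Fin n, gray (t + 1) = (gray t + unitVec i : Label n) ∧
      (V i).app (column M (gray t)) = column M (gray (t + 1))) (i : Fin n) (z : Label n) :
    (V i).app (column M z) = column M (z + unitVec i) := by
  have hL := fun z i => app_applyList (ψ := column M 0) hsq hcomm z (List.nodup_finRange n)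
    (List.mem_finRange i)
  -- The products of the `V_i` applied to the first column agree with the columns along the Gray
  -- code, which visits all labels. Products obey the desired relation for every step.
  have hD : ∀ t < 2 ^ n, applyList V (column M 0) (gray t) (List.finRange n) =
      column M (gray t) := by
    intro t
    induction t with
    | zero =>
      intro _
      rw [gray_zero]
      have : ∀ L, applyList V (column M 0) 0 L = column M 0 := fun L => by
        induction L with
        | nil => rfl
        | cons j L ih => rw [applyList, ih]; simp
      exact this _
    | succ t ih =>
      intro ht
      obtain ⟨i, hi, hi'⟩ := hgray t (by omega)
      rw [hi, ← hL, ih (by omega), hi', hi]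
  have hall : ∀ z, applyList V (column M 0) z (List.finRange n) = column M z := fun z => by
    obtain ⟨t, ht, rfl⟩ := exists_gray z
    exact hD t ht
  rw [← hall z, hL, hall]

end Involutions

/-! Verification of Clifford gates. -/

lemma verifyClifford_val {n : ℕ} (M : Mat n) : (verifyClifford M).val = true ↔
    (verifyStabiliserState (column M 0)).val = true ∧ (checkColumns (extractU M) M).val = true ∧
      (∀ i, (extractV M i).r = 3 * (((extractV M i).p ⬝ᵥ (extractV M i).q).val : ZMod 4) ∨
        (extractV M i).r = 3 * (((extractV M i).p ⬝ᵥ (extractV M i).q).val : ZMod 4) + 2) ∧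
      (∀ i j, (extractV M i).p ⬝ᵥ (extractV M j).q = (extractV M i).q ⬝ᵥ (extractV M j).p) ∧
      (checkGray (extractV M) M (firstTriple M).shift).val = true := by
  have h1 : (verifyClifford M).val = ((verifyStabiliserState (column M 0)).val &&
      (checkColumns (extractTuple M).val.U M).val &&
      (allOver fun i => pauliIsHermitian ((extractTuple M).val.V i)).val &&
      (allOver fun i => allOver fun j =>
        pauliCommute ((extractTuple M).val.V i) ((extractTuple M).val.V j)).val &&
      (checkGray (extractTuple M).val.V M (firstTriple M).shift).val) := rfl
  rw [h1, extractTuple_U, extractTuple_V]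
  simp only [Bool.and_eq_true, and_assoc, allOver_val]
  have h2 : ∀ i, (pauliIsHermitian (extractV M i)).val = true ↔
      ((extractV M i).r = 3 * (((extractV M i).p ⬝ᵥ (extractV M i).q).val : ZMod 4) ∨
        (extractV M i).r = 3 * (((extractV M i).p ⬝ᵥ (extractV M i).q).val : ZMod 4) + 2) :=
    fun i => decide_eq_true_iff
  have h3 : ∀ i j, (pauliCommute (extractV M i) (extractV M j)).val = true ↔
      (extractV M i).p ⬝ᵥ (extractV M j).q = (extractV M i).q ⬝ᵥ (extractV M j).p :=
    fun i j => decide_eq_true_iff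
  simp only [h2, h3]

lemma checkColumns_val {n : ℕ} (U : Fin n → Pauli n) (M : Mat n) :
    (checkColumns U M).val = true ↔ ∀ i z, (U i).app (column M z) = sgn (z i) • column M z := by
  unfold checkColumns
  rw [allOver_val]
  constructor
  · intro h i z
    obtain ⟨s, rfl⟩ := (label_bijective n).2 z
    ext w
    obtain ⟨t, rfl⟩ := (label_bijective n).2 w
    exact of_decide_eq_true ((allOver_val _).1 ((allOver_val _).1 (h s) i) t)
  · intro h s
    refine (allOver_val _).2 fun i => (allOver_val _).2 fun t => decide_eq_true ?_
    exact congrFun (h i (label s)) (label t)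

section

variable {n : ℕ} {M : Mat n}

lemma omega_eq_zero_of_app_comm {A B : Pauli n} {φ : Vec n} (hφ : φ ≠ 0)
    (h : A.app (B.app φ) = B.app (A.app φ)) : A.omega B = 0 := by
  obtain ⟨w, hw⟩ := Function.ne_iff.1 hφ
  have h1 := A.app_comm B φ
  have h2 := B.app_ne_zero (A.app_ne_zero hw)
  rw [h] at h1
  rcases bit_cases (A.omega B) with h0 | h0
  · exact h0
  · have h3 := congrFun h1 (w + A.q + B.q)
    rw [h0, sgn_one, neg_smul, one_smul, Pi.neg_apply, self_eq_neg] at h3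
    exact absurd h3 h2

/-- The gates `V_i` map every column to a multiple of the right one. -/
lemma extractV_app_column (hU : ∀ i z, (extractU M i).app (column M z) = sgn (z i) • column M z)
    (hne : ∀ z, column M z ≠ 0) (i : Fin n) (z : Label n) :
    ∃ a : ℂ, (extractV M i).app (column M z) = a • column M (z + unitVec i) := by
  refine eq_smul_column hU hne _ _ fun j => ?_
  unfold extractV
  rw [pauliMulPower_app _ _ _ _ fun j => hU j z, Pauli.app_smul, Pauli.app_comm, hU,
    Pauli.app_smul, smul_smul, smul_smul, smul_smul]
  congr 1
  have h := omega_antiGates hU hne i j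
  have h1 : (extractU M j).omega ⟨(antiGates (extractU M) i).p, (antiGates (extractU M) i).q,
      (antiGates (extractU M) i).r + 2 * ((compareC M i).val : ZMod 4) +
      3 * ((compareD M i).val : ZMod 4)⟩ = (unitVec i : Label n) j := by
    rw [unitVec_apply]
    simp only [eq_comm (a := j)]
    exact h
  rw [h1, Pi.add_apply, sgn_add]
  ring

/-- On a step of the walk, the image of a column is a multiple of the next one by
`extractV_app_column`, and the compared nonzero entry fixes the multiple as one. -/
lemma isTableau_of_verify
    (hU : ∀ i z, (extractU M i).app (column M z) = sgn (z i) • column M z)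
    (hr : ∀ i, (extractV M i).r = 3 * (((extractV M i).p ⬝ᵥ (extractV M i).q).val : ZMod 4) ∨
      (extractV M i).r = 3 * (((extractV M i).p ⬝ᵥ (extractV M i).q).val : ZMod 4) + 2)
    (hc : ∀ i j, (extractV M i).p ⬝ᵥ (extractV M j).q = (extractV M i).q ⬝ᵥ (extractV M j).p)
    {z₀ : Label n} (hg : (checkGray (extractV M) M z₀).val = true) :
    IsTableau (extractU M) (extractV M) M := by
  obtain ⟨hne, hgray⟩ := of_checkGray hg
  refine ⟨hU, app_column_of_gray (fun i φ => Pauli.app_app_of_r (hr i) φ) (fun i j φ => ?_)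
    fun t ht => ?_⟩
  · rw [Pauli.app_comm, Pauli.omega, hc, bit_add_self, sgn_zero, one_smul]
  · obtain ⟨i, w, hi, hw, hw'⟩ := hgray t ht
    refine ⟨i, hi, ?_⟩
    obtain ⟨a, ha⟩ := extractV_app_column hU hne i (gray t)
    rw [← hi] at ha
    have h1 : a * M w (gray (t + 1)) = M w (gray (t + 1)) :=
      (congrFun ha w).symm.trans hw'
    rw [ha, mul_right_cancel₀ hw (h1.trans (one_mul _).symm), one_smul]

/-- A matrix with a tableau is unitary if its first column has norm one. -/
lemma IsTableau.conjTranspose_mul {U V : Fin n → Pauli n} (h : IsTableau U V M)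
    (h0 : ∑ w, ‖column M 0 w‖ ^ 2 = 1) : M.conjTranspose * M = 1 := by
  -- The `V_i` are isometries that reach every column from the first.
  have hdiag : ∀ z, star (column M z) ⬝ᵥ column M z = 1 := by
    intro z
    induction z using label_induction with
    | h0 => rw [star_dotProduct_self, h0, Complex.ofReal_one]
    | hs z i ih => rw [← h.V_app, Pauli.dot_app, ih]
  ext y z
  change star (column M y) ⬝ᵥ column M z = _
  by_cases hyz : y = z
  · rw [hyz, hdiag, Matrix.one_apply_eq]
  · rw [Matrix.one_apply_ne hyz]
    exact column_orthogonal h.U_app (Ne.symm hyz) fun i => h.U_app i z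

/-- The verification accepts exactly the Clifford gates. -/
lemma verifyClifford_iff (M : Mat n) : (verifyClifford M).val = true ↔ IsClifford M := by
  rw [verifyClifford_val, checkColumns_val, verifyStabiliserState_iff, isClifford_iff]
  constructor
  · rintro ⟨h0, hU, hr, hc, hg⟩
    have h := isTableau_of_verify hU hr hc hg
    exact ⟨h.conjTranspose_mul h0.1, _, _, h⟩
  · rintro ⟨hMM, U, V, hUV⟩
    have h := hUV.extract hMM
    have hne := column_ne_zero hMM
    have hrep := represents_of_isStabiliserState (hUV.isStabiliserState hMM)
    refine ⟨hUV.isStabiliserState hMM, h.U_app, fun i => ?_, fun i j => ?_,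
      checkGray_of_app h.V_app hrep.shift_ne⟩
    · refine Pauli.r_of_app_app (hne 0) ?_
      rw [h.V_app, h.V_app, label_add_add_cancel]
    · have h1 := omega_eq_zero_of_app_comm (A := extractV M i) (B := extractV M j) (hne 0) (by
        rw [h.V_app, h.V_app, h.V_app, h.V_app, add_right_comm])
      rw [Pauli.omega] at h1
      exact (CharTwo.add_eq_zero).1 h1

end

/-! Costs. -/

@[simp] lemma bind_cost {α β : Type} (x : Timed α) (f : α → Timed β) :
    (x >>= f).cost = x.cost + (f x.val).cost := rfl

@[simp] lemma pure_cost {α : Type} (a : α) : (pure a : Timed α).cost = 0 := rfl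

@[simp] lemma op_cost {α : Type} (a : α) : (op a).cost = 1 := rfl

@[simp] lemma ops_cost {α : Type} (c : ℕ) (a : α) : (ops c a).cost = c := rfl

lemma bind_cost_le {α β : Type} {x : Timed α} {f : α → Timed β} {a b : ℕ} (hx : x.cost ≤ a)
    (hf : ∀ v, (f v).cost ≤ b) : (x >>= f).cost ≤ a + b := Nat.add_le_add hx (hf _)

/-- The predicate `p` passes on the size of an intermediate result, such as the length of a list or
a dimension, on which later costs depend. -/
lemma bind_cost_le_of {α β : Type} (p : α → Prop) {x : Timed α} {f : α → Timed β} {a b : ℕ}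
    (hp : p x.val) (hx : x.cost ≤ a) (hf : ∀ v, p v → (f v).cost ≤ b) :
    (x >>= f).cost ≤ a + b := Nat.add_le_add hx (hf _ hp)

lemma sum_cost_le {m c : ℕ} {f : Fin m → ℕ} (h : ∀ i, f i ≤ c) :
    ∑ i, (f i + 1) ≤ m * (c + 1) := by
  refine (Finset.sum_le_card_nsmul _ _ _ fun i _ => Nat.succ_le_succ (h i)).trans ?_
  simp

lemma table_cost_le {α : Type} {m c : ℕ} {f : Fin m → Timed α} (h : ∀ i, (f i).cost ≤ c) :
    (table f).cost ≤ m * (c + 1) := sum_cost_le h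

lemma sumOver_cost_le {m c : ℕ} {f : Fin m → Timed (ZMod 2)} (h : ∀ i, (f i).cost ≤ c) :
    (sumOver f).cost ≤ m * (c + 1) := sum_cost_le h

lemma allOver_cost_le {m c : ℕ} {f : Fin m → Timed Bool} (h : ∀ i, (f i).cost ≤ c) :
    (allOver f).cost ≤ m * (c + 1) := sum_cost_le h

lemma findFirst_cost_le {m c : ℕ} {f : Fin m → Timed Bool} (h : ∀ i, (f i).cost ≤ c) :
    (findFirst f).cost ≤ m * (c + 1) := sum_cost_le h

lemma collect_cost_le {m c : ℕ} {f : Fin m → Timed Bool} (h : ∀ i, (f i).cost ≤ c) :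
    (collect f).cost ≤ m * (c + 1) := sum_cost_le h

lemma mapList_cost_le {α β : Type} {c : ℕ} {f : α → Timed β} (l : List α)
    (h : ∀ a, (f a).cost ≤ c) : (mapList f l).cost ≤ l.length * (c + 1) := by
  refine (List.sum_le_card_nsmul _ (c + 1) ?_).trans ?_
  · intro x hx
    obtain ⟨a, -, rfl⟩ := List.mem_map.1 hx
    exact Nat.succ_le_succ (h a)
  · simp

lemma loop_cost_le {σ : Type} {c : ℕ} : ∀ {m : ℕ} {f : Fin m → σ → Timed σ} {s : σ}
    (_ : ∀ i s, (f i s).cost ≤ c), (loop m f s).cost ≤ m * (c + 1)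
  | 0, _, _, _ => Nat.zero_le _
  | m + 1, f, s, h => by
    refine (bind_cost_le (loop_cost_le fun i s => h i.castSucc s) fun v =>
      bind_cost_le (h _ _) fun v => le_refl (op v).cost).trans ?_
    rw [Nat.succ_mul]

lemma table_op_cost {α : Type} {m : ℕ} (f : Fin m → α) :
    (table fun i => op (f i)).cost ≤ m * 2 := table_cost_le fun _ => le_refl 1

lemma table_table_op_cost {α : Type} {k m : ℕ} (f : Fin k → Fin m → α) :
    (table fun i => table fun j => op (f i j)).cost ≤ k * (m * 2 + 1) :=
  table_cost_le fun i => table_op_cost (f i)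

lemma vadd_cost {m : ℕ} (u v : Fin m → ZMod 2) : (vadd u v).cost ≤ m * 2 := table_op_cost _

lemma dot_cost {m : ℕ} (u v : Fin m → ZMod 2) : (dot u v).cost ≤ m * 2 :=
  sumOver_cost_le fun _ => le_refl 1

lemma linComb_cost {k m : ℕ} (x : Fin k → ZMod 2) (A : Fin k → Fin m → ZMod 2) :
    (linComb x A).cost ≤ m * (k * 2 + 1) :=
  table_cost_le fun _ => sumOver_cost_le fun _ => le_refl 1

lemma matMul_cost {k l m : ℕ} (A : Fin k → Fin l → ZMod 2) (B : Fin l → Fin m → ZMod 2) :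
    (matMul A B).cost ≤ k * (m * (l * 2 + 1) + 1) :=
  table_cost_le fun i => linComb_cost (A i) B

lemma addRowTo_cost {k m : ℕ} (r : Fin k) (marked : Fin k → Bool) (A : Fin k → Fin m → ZMod 2) :
    (addRowTo r marked A).cost ≤ k * (1 + m * 2 + 1) := by
  refine table_cost_le fun t => bind_cost_le le_rfl fun b => ?_
  split_ifs
  · exact vadd_cost _ _
  · exact Nat.zero_le _

/-- Polynomials of degree three are bounded by multiples of the cube. -/
lemma pow_le_cube {s : ℕ} (hs : 1 ≤ s) : 1 ≤ s ^ 3 ∧ s ≤ s ^ 3 ∧ s ^ 2 ≤ s ^ 3 :=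
  ⟨Nat.one_le_pow _ _ hs, Nat.le_self_pow (by norm_num) s, Nat.pow_le_pow_right hs (by norm_num)⟩

lemma rowReduce_cost {k m : ℕ} (A : Fin k → Fin m → ZMod 2) {s : ℕ} (hk : k ≤ s) (hm : m ≤ s)
    (hs : 1 ≤ s) : (rowReduce A).cost ≤ 30 * s ^ 3 := by
  refine (bind_cost_le (table_table_op_cost _) fun one => bind_cost_le (table_op_cost _) fun _ =>
    -- One round: pivot search, marking of rows, two row operations, update of the pivots.
    loop_cost_le (c := m * 2 + (k * 2 + (k * (1 + m * 2 + 1) + (k * (1 + k * 2 + 1) + k * 2))))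
      fun r st => bind_cost_le (findFirst_cost_le fun _ => le_refl 1) fun piv => ?_).trans ?_
  · match piv with
    | none => exact Nat.zero_le _
    | some c =>
      exact bind_cost_le (table_op_cost _) fun _ => bind_cost_le (addRowTo_cost _ _ _) fun _ =>
        bind_cost_le (addRowTo_cost _ _ _) fun _ => bind_cost_le (b := 0) (table_op_cost _)
          fun _ => le_rfl
  · obtain ⟨h1, h2, h3⟩ := pow_le_cube hs
    calc _ ≤ s * (s * 2 + 1) + (s * 2 + s * (s * 2 + (s * 2 + (s * (1 + s * 2 + 1) +
          (s * (1 + s * 2 + 1) + s * 2))) + 1)) := by gcongr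
      _ ≤ _ := by ring_nf; ring_nf at h1 h2 h3; linarith

lemma pivotRows_cost {k m : ℕ} (R : RowReduction k m) {s : ℕ} (hk : k ≤ s) (hm : m ≤ s)
    (hs : 1 ≤ s) : (pivotRows R).cost ≤ 3 * s ^ 3 := by
  refine (table_cost_le fun c => findFirst_cost_le fun i => le_refl 1).trans ?_
  obtain ⟨h1, h2, h3⟩ := pow_le_cube hs
  calc _ ≤ s * (s * 2 + 1) := by gcongr
    _ ≤ _ := by ring_nf; ring_nf at h1 h2 h3; linarith

lemma rightInverse_cost {k m : ℕ} (A : Fin k → Fin m → ZMod 2) {s : ℕ} (hk : k ≤ s) (hm : m ≤ s)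
    (hs : 1 ≤ s) : (rightInverse A).cost ≤ 36 * s ^ 3 := by
  refine (bind_cost_le (rowReduce_cost A hk hm hs) fun R =>
    bind_cost_le (pivotRows_cost R hk hm hs) fun inv => table_cost_le fun c =>
      table_cost_le (c := 1) fun j => ?_).trans ?_
  · cases inv c <;> exact le_rfl
  · obtain ⟨h1, h2, h3⟩ := pow_le_cube hs
    calc _ ≤ 30 * s ^ 3 + (3 * s ^ 3 + s * (s * 2 + 1)) := by gcongr
      _ ≤ _ := by ring_nf; ring_nf at h1 h2 h3; linarith

/-! Costs for states. -/

lemma merge_cost {n : ℕ} (as bs : List (Label n)) :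
    (merge as bs).cost ≤ 2 * (as.length + bs.length) := by
  fun_induction merge as bs with
  | case1 bs => exact Nat.zero_le _
  | case2 a as => exact Nat.zero_le _
  | case3 a as b bs ih1 ih2 =>
    refine (bind_cost_le (b := 2 * (as.length + bs.length + 1) + 1) le_rfl fun le => ?_).trans ?_
    · split_ifs
      · refine bind_cost_le (ih1.trans ?_) fun _ => le_rfl
        simp; omega
      · refine bind_cost_le (ih2.trans ?_) fun _ => le_rfl
        simp; omega
    · simp; omega

/-- Splitting and merging cost at most three steps per element and level. The fourth covers the
additive constants, because a list that is split has at least two elements. -/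
lemma mergeSort_cost {n : ℕ} : ∀ (d : ℕ) (l : List (Label n)),
    (mergeSort d l).cost ≤ 1 + 4 * d * l.length
  | 0, l => Nat.zero_le _
  | d + 1, l => by
    by_cases h : l.length ≤ 1
    · simp [mergeSort, h]
    · have h1 := mergeSort_cost d (l.take (l.length / 2))
      have h2 := mergeSort_cost d (l.drop (l.length / 2))
      have h3 := merge_cost (mergeSort d (l.take (l.length / 2))).val
        (mergeSort d (l.drop (l.length / 2))).val
      rw [(mergeSort_perm _ _).length_eq, (mergeSort_perm _ _).length_eq] at h3
      have h4 : (l.take (l.length / 2)).length + (l.drop (l.length / 2)).length = l.length := by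
        rw [← List.length_append, List.take_append_drop]
      have h5 : 4 * d * (l.take (l.length / 2)).length + 4 * d * (l.drop (l.length / 2)).length =
        4 * d * l.length := by rw [← mul_add, h4]
      have h6 : 4 * (d + 1) * l.length = 4 * d * l.length + 4 * l.length := by ring
      rw [h4] at h3
      have h7 : (mergeSort (d + 1) l).cost = 1 + (l.length +
          ((mergeSort d (l.take (l.length / 2))).cost + ((mergeSort d (l.drop (l.length / 2))).cost
            + (merge (mergeSort d (l.take (l.length / 2))).val
              (mergeSort d (l.drop (l.length / 2))).val).cost))) := by
        simp only [mergeSort, bind_cost, op_val, h, decide_false, List.splitAt_eq, op_cost,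
          ops_cost, ops_val, Bool.false_eq_true, if_false]
      omega

lemma findSupport_cost {n : ℕ} (hn : 1 ≤ n) (ψ : Vec n) :
    (findSupport ψ).cost ≤ 14 * (n * 2 ^ n) := by
  have hlen : ∀ {f : Fin (2 ^ n) → Timed Bool}, (collect f).val.length ≤ 2 ^ n := fun {f} =>
    (List.length_filter_le _ _).trans (List.length_finRange).le
  unfold findSupport
  refine (bind_cost_le_of (fun l => l.length ≤ 2 ^ n) hlen
    (collect_cost_le (c := 2) fun t => le_rfl) (b := 2 ^ n * 2 + (1 + (2 ^ n * (n * 2 + 1) +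
      (1 + 4 * n * 2 ^ n + 0)))) fun l hl => ?_).trans ?_
  · have hl' : (do let a ← l; pure (a : ℕ)).length ≤ 2 ^ n := by
      simpa [bind_pure_comp, List.map_eq_map] using hl
    refine bind_cost_le_of (fun l => l.length ≤ 2 ^ n) ((List.length_map _).trans_le hl')
      ((mapList_cost_le (c := 1) _ fun _ => le_rfl).trans (Nat.mul_le_mul_right _ hl'))
      fun supp hsupp => bind_cost_le le_rfl fun z₀ => ?_
    exact bind_cost_le_of (fun l => l.length ≤ 2 ^ n) ((List.length_map _).trans_le hsupp)
      ((mapList_cost_le _ fun _ => vadd_cost _ _).trans (Nat.mul_le_mul_right _ hsupp))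
      fun l hl => bind_cost_le ((mergeSort_cost n l).trans
        (Nat.add_le_add_left (Nat.mul_le_mul_left _ hl) 1)) fun _ => le_rfl
  · have h1 : 2 ^ n ≤ n * 2 ^ n := Nat.le_mul_of_pos_left _ hn
    have h2 : 1 ≤ 2 ^ n := Nat.one_le_two_pow
    nlinarith

lemma log_length_le {n : ℕ} {S : ShiftedSupport n} (hS : S.elements.length ≤ 2 ^ n) :
    Nat.log 2 S.elements.length ≤ n :=
  (Nat.log_mono_right hS).trans_eq (Nat.log_pow one_lt_two n)

lemma readTriple_cost {n : ℕ} (hn : 1 ≤ n) (ψ : Vec n) {S : ShiftedSupport n}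
    (hS : S.elements.length ≤ 2 ^ n) : (readTriple ψ S).cost ≤ 30 * n ^ 3 := by
  obtain ⟨h1, h2, h3⟩ := pow_le_cube hn
  refine (bind_cost_le_of (fun k => k ≤ n) (log_length_le hS) (a := n + 1) le_rfl
    (b := n * 2 + (1 + (n * (n * 2 + 2 + 1) + (n * 2 + (n * 2 +
      (n * (n * (n * 2 + (n * 2 + 5) + 1) + 1)))))))
    fun k hk => (bind_cost_le (table_op_cost _) fun basis => bind_cost_le (op_cost _).le fun a₀ =>
      bind_cost_le (table_cost_le (c := n * 2 + 2) fun i =>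
        bind_cost_le (vadd_cost _ _) fun _ => le_rfl) fun ratios =>
      bind_cost_le (table_op_cost _) fun ell => bind_cost_le (table_op_cost _) fun diag =>
      bind_cost_le (b := 0) (table_cost_le fun i =>
        table_cost_le (c := n * 2 + (n * 2 + 5)) fun j => ?_) fun _ => le_rfl).trans ?_).trans ?_
  · split_ifs
    · rw [op_cost]; omega
    · rw [op_cost]; omega
    · exact bind_cost_le (vadd_cost _ _) fun _ => bind_cost_le (vadd_cost _ _) fun _ => le_rfl
  · simp only [Nat.add_zero]; gcongr
  · ring_nf; ring_nf at h1 h2 h3; linarith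

/-- At most `2^n` points are checked, and each needs linear combinations and a quadratic form at
`O(n^2)` steps. -/
lemma verifyStabiliserState_cost {n : ℕ} (hn : 1 ≤ n) (ψ : Vec n) :
    (verifyStabiliserState ψ).cost ≤ 100 * (2 ^ n * n ^ 2) := by
  refine (bind_cost_le_of (fun S => S.elements.length ≤ 2 ^ n) (findSupport_length_le ψ)
    (findSupport_cost hn ψ) (b := 30 * n ^ 3 + (1 + (n + 1 +
      (2 ^ n * (n + (n * (n * 2 + 1) + (n + 1)) + 1) +
      (2 ^ n * (n + (n * (n * 2 + 1) + (n * 2 + (n * 2 + (n * (n * 2 + 1) + (n * 2 + 4))))) + 1) +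
      (n + 3 + 1)))))) fun S hS => ?_).trans ?_
  · refine bind_cost_le_of (fun T => T.k ≤ n) (log_length_le hS) (readTriple_cost hn ψ hS)
      fun T hT => ?_
    refine (bind_cost_le (op_cost _).le fun a₀ => bind_cost_le (ops_cost _ _).le fun size =>
      bind_cost_le (allOver_cost_le fun t => bind_cost_le (ops_cost _ _).le fun x =>
        bind_cost_le (linComb_cost _ _) fun v => (ops_cost _ _).le) fun affine =>
      bind_cost_le (allOver_cost_le fun t => bind_cost_le (ops_cost _ _).le fun x =>
        bind_cost_le (linComb_cost _ _) fun v => bind_cost_le (vadd_cost _ _) fun z =>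
        bind_cost_le (dot_cost _ _) fun l =>
        bind_cost_le (table_cost_le fun i => dot_cost _ _) fun Qx =>
        bind_cost_le (b := 4) (dot_cost _ _) fun b => le_rfl) fun coefficients =>
      bind_cost_le (b := 1) (ops_cost _ _).le fun normalised => le_rfl).trans ?_
    gcongr <;> norm_num
  · have h1 : 2 ^ n ≤ 2 ^ n * n := Nat.le_mul_of_pos_right _ hn
    have h2 : 2 ^ n * n ≤ 2 ^ n * n ^ 2 := by gcongr; exact Nat.le_self_pow (by norm_num) n
    have h3 : n < 2 ^ n := Nat.lt_two_pow_self
    have h4 : n ^ 3 ≤ 2 ^ n * n ^ 2 := by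
      rw [show n ^ 3 = n * n ^ 2 by ring]; gcongr
    ring_nf at *
    linarith

/-! Costs of the extraction. -/

lemma stateToTriple_cost {n : ℕ} (hn : 1 ≤ n) (ψ : Vec n) :
    (stateToTriple ψ).cost ≤ 14 * (n * 2 ^ n) + 30 * n ^ 3 :=
  bind_cost_le_of (fun S => S.elements.length ≤ 2 ^ n) (findSupport_length_le ψ)
    (findSupport_cost hn ψ) fun _ hS => readTriple_cost hn ψ hS

lemma stateToTriple_k_le {n : ℕ} (ψ : Vec n) : (stateToTriple ψ).val.k ≤ n :=
  log_length_le (findSupport_length_le ψ)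

lemma tripleToCheckMatrix_cost {n : ℕ} (hn : 1 ≤ n) {T : AffineTriple n} (hT : T.k ≤ n) :
    (tripleToCheckMatrix T).cost ≤ 100 * n ^ 3 := by
  obtain ⟨h1, h2, h3⟩ := pow_le_cube hn
  refine (bind_cost_le (rowReduce_cost _ hT le_rfl hn) fun R =>
    bind_cost_le (pivotRows_cost _ hT le_rfl hn) fun inv =>
    bind_cost_le (table_cost_le fun i => dot_cost _ _) fun ell =>
    bind_cost_le (table_table_op_cost _) fun transposed =>
    bind_cost_le (matMul_cost _ _) fun half => bind_cost_le (matMul_cost _ _) fun full =>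
    bind_cost_le (table_cost_le fun i => table_cost_le (c := 1) fun j => ?_) fun upper =>
    table_cost_le (c := n * 2 + (n * 2 + (n * 2 + (n * 2 + 1)))) fun c => ?_).trans ?_
  · split_ifs <;> exact le_rfl
  · match inv c with
    | some i =>
      refine bind_cost_le (table_cost_le (c := 1) fun d => ?_) fun p =>
        bind_cost_le (dot_cost _ _) fun pq => bind_cost_le (vadd_cost _ _) fun shifted =>
        bind_cost_le (b := 1) (dot_cost _ _) fun e => le_rfl
      match inv d with
      | some j => dsimp only; split_ifs <;> exact le_rfl
      | none => exact le_rfl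
    | none =>
      refine (bind_cost_le (table_cost_le (c := 1) fun d => ?_) fun ρ =>
        bind_cost_le (dot_cost _ _) fun γ => bind_cost_le (b := 0) (table_op_cost _)
          fun zero => le_rfl).trans (by omega)
      match inv d with
      | some j => exact le_rfl
      | none => exact le_rfl
  · calc _ ≤ 30 * n ^ 3 + (3 * n ^ 3 + (n * (n * 2 + 1) + (n * (n * 2 + 1) +
          (n * (n * (n * 2 + 1) + 1) + (n * (n * (n * 2 + 1) + 1) + (n * (n * (1 + 1) + 1) +
          n * (n * 2 + (n * 2 + (n * 2 + (n * 2 + 1))) + 1))))))) := by gcongr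
      _ ≤ _ := by ring_nf; ring_nf at h1 h2 h3; linarith

lemma fromBits_cost {n : ℕ} (P : PauliBits n) : (fromBits P).cost ≤ n * 2 + 1 :=
  bind_cost_le (dot_cost _ _) fun _ => le_rfl

lemma toBits_cost {n : ℕ} (P : Pauli n) : (toBits P).cost ≤ n * 2 + 1 :=
  bind_cost_le (dot_cost _ _) fun _ => le_rfl

lemma pauliMul_cost {n : ℕ} (A B : Pauli n) : (pauliMul A B).cost ≤ n * 6 + 1 :=
  (bind_cost_le (vadd_cost _ _) fun _ => bind_cost_le (vadd_cost _ _) fun _ =>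
    bind_cost_le (b := 1) (dot_cost _ _) fun _ => le_rfl).trans (by omega)

lemma pauliMulPower_cost {n : ℕ} (A : Pauli n) (P : Fin n → Pauli n) (x : Fin n → ZMod 2) :
    (pauliMulPower A P x).cost ≤ n * (1 + (n * 6 + 1) + 1) := by
  refine loop_cost_le fun j B => bind_cost_le (op_cost _).le fun b => ?_
  split_ifs
  · exact pauliMul_cost _ _
  · exact Nat.zero_le _

lemma pauliApply_cost {n : ℕ} (P : Pauli n) (ψ : Vec n) (w : Label n) :
    (pauliApply P ψ w).cost ≤ n * 4 + 3 :=
  (bind_cost_le (dot_cost _ _) fun _ => bind_cost_le (b := 3) (vadd_cost _ _)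
    fun _ => le_rfl).trans (by omega)

lemma makeUnitVec_cost {n : ℕ} (i : Fin n) : (makeUnitVec i).cost ≤ n * 2 := table_op_cost _

/-- Linear algebra on `n` qubits is thereby absorbed into `N log N`. -/
lemma cube_le_two_pow (n : ℕ) : n ^ 3 ≤ 2 * (2 ^ n * n) := by
  have h : ∀ n : ℕ, n ^ 2 ≤ 2 * 2 ^ n := by
    intro n
    induction n with
    | zero => norm_num
    | succ n ih =>
      rcases Nat.lt_or_ge n 3 with h | h
      · interval_cases n <;> norm_num
      · rw [pow_succ 2 n]; nlinarith
  calc n ^ 3 = n ^ 2 * n := by ring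
    _ ≤ 2 * 2 ^ n * n := Nat.mul_le_mul_right _ (h n)
    _ = _ := by ring

lemma extractTuple_cost {n : ℕ} (hn : 1 ≤ n) (C : Mat n) :
    (extractTuple C).cost ≤ 2000 * (2 ^ n * n) := by
  obtain ⟨h1, h2, h3⟩ := pow_le_cube hn
  refine (bind_cost_le (table_op_cost _) fun zero =>
    bind_cost_le_of (fun T => T.k ≤ n) (stateToTriple_k_le _) (stateToTriple_cost hn _)
      fun T hT => bind_cost_le (tripleToCheckMatrix_cost hn hT) fun bits =>
    bind_cost_le (table_cost_le fun i => fromBits_cost _) fun P =>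
    bind_cost_le (table_cost_le fun j => bind_cost_le (makeUnitVec_cost _) fun e =>
      bind_cost_le (findFirst_cost_le (c := 2) fun t => le_rfl) fun t => (op_cost _).le)
      fun positions =>
    bind_cost_le (table_cost_le fun i => table_cost_le fun j =>
      bind_cost_le (makeUnitVec_cost _) fun e =>
      bind_cost_le (b := 2) (pauliApply_cost _ _ _) fun b => le_rfl) fun ρ =>
    bind_cost_le (rightInverse_cost _ le_rfl le_rfl hn) fun μ =>
    bind_cost_le (table_op_cost _) fun one =>
    bind_cost_le (table_cost_le fun i => pauliMulPower_cost _ _ _) fun U =>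
    bind_cost_le (table_table_op_cost _) fun rows =>
    -- The symplectic matrix has `2 n` columns.
    bind_cost_le (rightInverse_cost (s := n + n) _ (by omega) le_rfl (by omega)) fun inv =>
    bind_cost_le (table_cost_le fun i => bind_cost_le (table_op_cost _) fun α =>
      bind_cost_le (table_op_cost _) fun β => fromBits_cost _) fun W =>
    bind_cost_le (b := 0) (table_cost_le fun i => bind_cost_le (makeUnitVec_cost _) fun e =>
      bind_cost_le (vadd_cost _ _) fun w => bind_cost_le (pauliApply_cost _ _ _) fun b =>
      bind_cost_le (op_cost _).le fun a => bind_cost_le (op_cost _).le fun t =>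
      bind_cost_le (op_cost _).le fun d => bind_cost_le (op_cost _).le fun c =>
      bind_cost_le (table_cost_le fun j => bind_cost_le (makeUnitVec_cost _) fun f =>
        bind_cost_le (vadd_cost _ _) fun ef => bind_cost_le (vadd_cost _ _) fun w' =>
        bind_cost_le (b := 3) (pauliApply_cost _ _ _) fun b => le_rfl) fun v =>
      bind_cost_le (op_cost _).le fun r => pauliMulPower_cost _ _ _) fun V => le_rfl).trans ?_
  have h4 := cube_le_two_pow n
  ring_nf at *
  linarith

lemma cliffordToTableau_cost {n : ℕ} (hn : 1 ≤ n) (C : Mat n) :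
    (cliffordToTableau C).cost ≤ 3000 * (2 ^ n * n) := by
  obtain ⟨h1, h2, h3⟩ := pow_le_cube hn
  refine (bind_cost_le (extractTuple_cost hn C) fun X => table_cost_le fun i =>
    bind_cost_le (toBits_cost _) fun u => bind_cost_le (toBits_cost _) fun v =>
      (op_cost _).le).trans ?_
  have h4 := cube_le_two_pow n
  ring_nf at *
  linarith

/-! Costs of the verification of Clifford gates. -/

/-- This is the dominant part of the verification: `N` columns, `n` gates, `N` entries, and `O(n)`
steps for each entry. -/
lemma checkColumns_cost {n : ℕ} (U : Fin n → Pauli n) (M : Mat n) :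
    (checkColumns U M).cost ≤ 2 ^ n * (1 + n * (2 ^ n * (1 + (n * 4 + 3 + 3) + 1) + 1) + 1) :=
  allOver_cost_le fun _ => bind_cost_le (op_cost _).le fun _ => allOver_cost_le fun _ =>
    allOver_cost_le fun _ => bind_cost_le (op_cost _).le fun _ =>
      bind_cost_le (pauliApply_cost _ _ _) fun _ => le_rfl

lemma checkGray_cost {n : ℕ} (V : Fin n → Pauli n) (M : Mat n) (z₀ : Label n) :
    (checkGray V M z₀).cost ≤ n * 2 + (2 + 2 ^ n * (n * 2 + (n * 10 + 5) + 1)) := by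
  refine (bind_cost_le (table_op_cost _) fun zero => bind_cost_le (op_cost _).le fun a₀ =>
    bind_cost_le (op_cost _).le fun start => bind_cost_le (b := 0) (loop_cost_le
      (c := n * 2 + (n * 10 + 5)) fun t s =>
        bind_cost_le (findFirst_cost_le (c := 1) fun i => le_rfl) fun bit => ?_)
      fun _ => le_rfl).trans ?_
  · match bit with
    | none => exact Nat.zero_le _
    | some i =>
      exact (bind_cost_le (makeUnitVec_cost _) fun e => bind_cost_le (vadd_cost _ _) fun z =>
        bind_cost_le (vadd_cost _ _) fun w => bind_cost_le (b := 2) (pauliApply_cost _ _ _)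
          fun b => le_rfl).trans (by omega)
  · have : (2 ^ n - 1) * (n * 2 + (n * 10 + 5) + 1) ≤ 2 ^ n * (n * 2 + (n * 10 + 5) + 1) :=
      Nat.mul_le_mul_right _ (Nat.sub_le _ _)
    omega

lemma verifyClifford_cost {n : ℕ} (hn : 1 ≤ n) (M : Mat n) :
    (verifyClifford M).cost ≤ 3000 * ((2 ^ n) ^ 2 * n ^ 2) := by
  refine (bind_cost_le (table_op_cost _) fun zero =>
    bind_cost_le (verifyStabiliserState_cost hn _) fun first =>
    bind_cost_le (findSupport_cost hn _) fun S =>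
    bind_cost_le (extractTuple_cost hn M) fun X =>
    bind_cost_le (checkColumns_cost _ _) fun columns =>
    bind_cost_le (allOver_cost_le fun i => bind_cost_le (b := 1) (dot_cost _ _) fun _ => le_rfl)
      fun hermitian =>
    bind_cost_le (allOver_cost_le fun i => allOver_cost_le fun j =>
      bind_cost_le (dot_cost _ _) fun _ => bind_cost_le (b := 1) (dot_cost _ _) fun _ => le_rfl)
      fun commuting =>
    bind_cost_le (checkGray_cost _ _ _) fun phases => (op_cost _).le).trans ?_
  have h3 : n ≤ 2 ^ n := Nat.lt_two_pow_self.le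
  generalize 2 ^ n = N at *
  have h1 : 1 ≤ N := hn.trans h3
  have hN : N ≤ N ^ 2 := Nat.le_self_pow (by norm_num) N
  have hn2 : n ≤ n ^ 2 := Nat.le_self_pow (by norm_num) n
  have a1 : N * n ^ 2 ≤ N ^ 2 * n ^ 2 := Nat.mul_le_mul_right _ hN
  have a2 : N * n ≤ N * n ^ 2 := Nat.mul_le_mul_left _ hn2
  have a3 : N ^ 2 * n ≤ N ^ 2 * n ^ 2 := Nat.mul_le_mul_left _ hn2
  have a4 : n ^ 3 ≤ N * n ^ 2 := by rw [pow_succ' n 2]; exact Nat.mul_le_mul_right _ h3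
  have a5 : n ^ 2 ≤ N * n ^ 2 := Nat.le_mul_of_pos_left _ h1
  have a6 : N ≤ N * n := Nat.le_mul_of_pos_right _ hn
  ring_nf at *
  linarith

end Stab

theorem mainTheorem7 :
    (∃ K : ℕ, ∀ n : ℕ, 1 ≤ n → ∀ C : Stab.Mat n, Stab.IsClifford C →
      Stab.IsConjugateTupleOf (Stab.cliffordToTableau C).val C ∧
      (Stab.cliffordToTableau C).cost ≤ K * (2 ^ n * Nat.log 2 (2 ^ n))) ∧
    (∃ K : ℕ, ∀ n : ℕ, 1 ≤ n → ∀ ψ : Stab.Vec n,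
      ((Stab.verifyStabiliserState ψ).val = true ↔ Stab.IsStabiliserState ψ) ∧
      (Stab.verifyStabiliserState ψ).cost ≤ K * (2 ^ n * Nat.log 2 (2 ^ n) ^ 2)) ∧
    (∃ K : ℕ, ∀ n : ℕ, 1 ≤ n → ∀ M : Stab.Mat n,
      ((Stab.verifyClifford M).val = true ↔ Stab.IsClifford M) ∧
      (Stab.verifyClifford M).cost ≤ K * ((2 ^ n) ^ 2 * Nat.log 2 (2 ^ n) ^ 2)) := by
  have hlog : ∀ n, Nat.log 2 (2 ^ n) = n := Nat.log_pow one_lt_two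
  simp only [hlog]
  exact ⟨⟨3000, fun n hn C hC =>
      ⟨Stab.cliffordToTableau_correct hC, Stab.cliffordToTableau_cost hn C⟩⟩,
    ⟨100, fun n hn ψ => ⟨Stab.verifyStabiliserState_iff ψ, Stab.verifyStabiliserState_cost hn ψ⟩⟩,
    ⟨3000, fun n hn M => ⟨Stab.verifyClifford_iff M, Stab.verifyClifford_cost hn M⟩⟩⟩
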